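/- Let $M$ be a smooth ($n$-dimensional, Hausdorff, second countable) manifold, $L\to M$ a smooth real vector bundle of finite rank, and let $E=L\oplus L^*$ carry the structure of a Courant algebroid whose fibre metric $h$ is the natural pairing: a smooth anchor $\rho:E\to TM$ and an $\mathbb R$-bilinear bracket $[\cdot,\cdot]$ on $\Gamma^\infty(E)$ with $[e_1,[e_2,e_3]]=[[e_1,e_2],e_3]+[e_2,[e_1,e_3]]$, $[e_1,e_2]+[e_2,e_1]=\mathcal D h(e_1,e_2)$, where $h(\mathcal Df,e)=\rho(e)f$, and $\rho(e_1)h(e_2,e_3)=h([e_1,e_2],e_3)+h(e_2,[e_1,e_3])$. Assume that $L$ is a Dirac structure, i.e. that $\Gamma^\infty(L)$ is closed under the bracket, so that $L$ is a Lie algebroid with differential $d_L$ on $\Gamma^\infty(\Lambda^\bullet L^*)$. Choose a connection on $L$, let $\nabla$ be the induced metric connection on $E$ with curvature $R$, and let $\tau:T^*M\to M$ be the cotangent projection. With local coordinates $(q^i,p_i)$ on $T^*M$, a local frame $u_A$ of $E$ with dual frame $u^A$, and $j$, $i$ the interior products from the right and from the left, the Rothstein–Poisson bracket on sections of $\tau^\sharp\Lambda^\bullet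 E\to T^*M$ is $$\{\xi,\zeta\}=\nabla_{\partial_{q^i}}\xi\wedge\partial_{p_i}\zeta-\partial_{p_i}\xi\wedge\nabla_{\partial_{q^i}}\zeta-\tfrac12h^{AB}R^C_{Aij}\,u_B\wedge u_C\wedge\partial_{p_i}\xi\wedge\partial_{p_j}\zeta+h_{AB}\,j(u^A)\xi\wedge i(u^B)\zeta .$$ Sections over $M$ are identified with their pull-backs along $\tau$. Let $T(e_1,e_2,e_3)=h(\nabla_{\rho(e_1)}e_2-\nabla_{\rho(e_2)}e_1-[e_1,e_2],e_3)+h(\nabla_{\rho(e_3)}e_1,e_2)$, and, with a local frame $a_\alpha$ of $L$ and its dual frame $a^\alpha$ of $L^*$, $$\mu=-p_i\rho^i(a_\alpha)a^\alpha+\tfrac12T(a_\alpha,a_\beta,a^\gamma)\,a^\alpha\wedge a^\beta\wedge a_\gamma,\qquad \gamma=-p_i\rho^i(a^\alpha)a_\alpha+\tfrac12T(a^\alpha,a^\beta,a_\gamma)\,a_\alpha\wedge a_\beta\wedge a^\gamma,$$ $$\phi=\tfrac16T(a^\alpha,a^\beta,a^\gamma)\,a_\alpha\wedge a_\beta\wedge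 a_\gamma .$$ Put $[\xi,\zeta]_\gamma=\{\{\xi,\gamma\},\zeta\}$ and $[\eta_1,\eta_2,\eta_3]_\phi=\{\{\{\phi,\eta_1\},\eta_2\},\eta_3\}$. Then for every two-form $\eta\in\Gamma^\infty(\Lambda^2L^*)$, $$d_\eta=\{\mu,\cdot\}+\{\{\eta,\gamma\},\cdot\}+\tfrac12\{\{\{\phi,\eta\},\eta\},\cdot\}=d_L+[\eta,\cdot]_\gamma+\tfrac12[\eta,\eta,\cdot]_\phi$$ defines a graded derivation of degree one of the $\wedge$-product on $\Gamma^\infty(\Lambda^\bullet L^*)$: it is $\mathbb R$-linear, maps $\Gamma^\infty(\Lambda^kL^*)$ to $\Gamma^\infty(\Lambda^{k+1}L^*)$, and $d_\eta(\alpha\wedge\beta)=d_\eta\alpha\wedge\beta+(-1)^k\alpha\wedge d_\eta\beta$ for $\alpha\in\Gamma^\infty(\Lambda^kL^*)$, $\beta\in\Gamma^\infty(\Lambda^\bullet L^*)$. Moreover, $d_L\eta+\tfrac12[\eta,\eta]_\gamma+\tfrac16[\eta,\eta,\eta]_\phi$ is a three-form in $\Gamma^\infty(\Lambda^3L^*)$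 and $$d_\eta\Bigl(d_L\eta+\tfrac12[\eta,\eta]_\gamma+\tfrac16[\eta,\eta,\eta]_\phi\Bigr)=0 .$$ -/

import Mathlib

open Bundle
open scoped Manifold ContDiff

noncomputable section

namespace DiracDeformation

variable {n : ℕ} {M : Type*} [TopologicalSpace M] [ChartedSpace (EuclideanSpace ℝ (Fin n)) M]
  [IsManifold (𝓡 n) ∞ M]
variable (F : Type*) [NormedAddCommGroup F] [NormedSpace ℝ F] [FiniteDimensional ℝ F]
variable (L : M → Type*) [∀ x, AddCommGroup (L x)] [∀ x, Module ℝ (L x)]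
  [∀ x, TopologicalSpace (L x)] [TopologicalSpace (TotalSpace F L)]
  [∀ x, IsTopologicalAddGroup (L x)] [∀ x, ContinuousSMul ℝ (L x)]
  [FiberBundle F L] [VectorBundle ℝ F L] [ContMDiffVectorBundle ∞ F L (𝓡 n)]

/-! ### Sections of the bundle `E = L ⊕ L*` and Courant algebroid structures on it -/

/-- The fibre of `E = L ⊕ L*` at `x`. -/
abbrev Dbl (x : M) : Type _ := L x × (L x →L[ℝ] ℝ)

/-- Smooth sections of `L`. -/
abbrev SecL : Type _ := Cₛ^∞⟮𝓡 n; F, L⟯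

/-- Smooth sections of the dual bundle `L*`. -/
abbrev SecDual : Type _ := Cₛ^∞⟮𝓡 n; F →L[ℝ] ℝ, fun x : M ↦ L x →L[ℝ] ℝ⟯

/-- Smooth sections of `E = L ⊕ L*`. -/
abbrev SecE : Type _ := SecL (n := n) F L × SecDual (n := n) F L

variable {L}

/-- The natural pairing on a fibre of `L ⊕ L*`. -/
def pairing {x : M} (e e' : Dbl L x) : ℝ := e.2 e'.1 + e'.2 e.1

variable {F}

/-- The value of a section of `L ⊕ L*` at a point. -/
def valE (e : SecE (n := n) F L) (x : M) : Dbl L x := (e.1 x, e.2 x)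

/-- The function `h(e, e')` on `M`. -/
def pairE (e e' : SecE (n := n) F L) (x : M) : ℝ := pairing (valE e x) (valE e' x)

/-- The derivative of a function `f` on `M` in the direction of the tangent vector `v` at `x`. -/
def dirDeriv (f : M → ℝ) (x : M) (v : TangentSpace (𝓡 n) x) : ℝ :=
  mfderiv (𝓡 n) 𝓘(ℝ, ℝ) f x v

variable (n F L)

/-- A Courant algebroid structure on `E = L ⊕ L*` whose fibre metric `h` is the natural pairing.
The axiom `symm` is `[e₁, e₂] + [e₂, e₁] = 𝒟 h(e₁, e₂)` with `h(𝒟 f, e) = ρ(e) f`, tested against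
all sections. -/
structure CourantAlgebroid where
  /-- the anchor `ρ : E → TM`, a smooth bundle map -/
  anchor : ∀ x : M, Dbl L x →ₗ[ℝ] TangentSpace (𝓡 n) x
  smooth_anchor : ∀ e : SecE (n := n) F L, ContMDiff (𝓡 n) (𝓡 n).tangent ∞
    (fun x ↦ (⟨x, anchor x (valE e x)⟩ : TangentBundle (𝓡 n) M))
  /-- the Courant bracket on the smooth sections of `E` -/
  bracket : SecE (n := n) F L →ₗ[ℝ] SecE (n := n) F L →ₗ[ℝ] SecE (n := n) F L
  jacobi : ∀ e₁ e₂ e₃, bracket e₁ (bracket e₂ e₃) =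
    bracket (bracket e₁ e₂) e₃ + bracket e₂ (bracket e₁ e₃)
  symm : ∀ e₁ e₂ e x, pairE (bracket e₁ e₂ + bracket e₂ e₁) e x =
    dirDeriv (pairE e₁ e₂) x (anchor x (valE e x))
  invariant : ∀ e₁ e₂ e₃ x, dirDeriv (pairE e₂ e₃) x (anchor x (valE e₁ x)) =
    pairE (bracket e₁ e₂) e₃ x + pairE e₂ (bracket e₁ e₃) x

variable {n F L}

/-- `L` is a Dirac structure in `L ⊕ L*`: its sections are closed under the Courant bracket.
(For the natural pairing, `L` is always maximally isotropic.) -/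
def CourantAlgebroid.IsDirac (C : CourantAlgebroid n F L) : Prop :=
  ∀ s t : SecL (n := n) F L, (C.bracket (s, 0) (t, 0)).2 = 0

/-- The bracket of the Lie algebroid `L`: the restriction of the Courant bracket. -/
def CourantAlgebroid.bracketL (C : CourantAlgebroid n F L) (s t : SecL (n := n) F L) :
    SecL (n := n) F L :=
  (C.bracket (s, 0) (t, 0)).1

/-! ### Local frames -/

variable (F L)

/-- The local frame `a_α` of `L` belonging to the trivialization around `x`, at the point `y`. -/
def frameL (x : M) (α : Fin (Module.finrank ℝ F)) (y : M) : L y :=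
  (trivializationAt F L x).symmL ℝ y (Module.finBasis ℝ F α)

/-- The dual frame `a^α` of `L*` at the point `x`. -/
def coframeL (x : M) (α : Fin (Module.finrank ℝ F)) : L x →L[ℝ] ℝ :=
  (LinearMap.toContinuousLinearMap ((Module.finBasis ℝ F).coord α)).comp
    ((trivializationAt F L x).continuousLinearMapAt ℝ x)

/-- Indices of the local frame `u_A` of `E = L ⊕ L*` that consists of the `a_α` (`inl α`)
and the `a^α` (`inr α`). -/
abbrev Idx : Type := Fin (Module.finrank ℝ F) ⊕ Fin (Module.finrank ℝ F)

/-- The frame `u_A` of `E` at `x`. -/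
def frameE (x : M) : Idx F → Dbl L x :=
  Sum.elim (fun α ↦ (frameL F L x α x, 0)) (fun α ↦ (0, coframeL F L x α))

variable {L} in
/-- The functional on `E` at `x` that a vector of `L` defines via the natural pairing. -/
def vecDual {x : M} (v : L x) : Module.Dual ℝ (Dbl L x) where
  toFun e := e.2 v
  map_add' _ _ := rfl
  map_smul' _ _ := rfl

variable {L} in
/-- The functional on `E` at `x` that an element of `L*` defines via the natural pairing. -/
def covecDual {x : M} (ξ : L x →L[ℝ] ℝ) : Module.Dual ℝ (Dbl L x) :=
  ξ.toLinearMap ∘ₗ LinearMap.fst ℝ (L x) (L x →L[ℝ] ℝ)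

/-- The dual frame `u^A` of `E*` at `x`. -/
def coframeE (x : M) : Idx F → Module.Dual ℝ (Dbl L x) :=
  Sum.elim (fun α ↦ covecDual (coframeL F L x α)) (fun α ↦ vecDual (frameL F L x α x))

variable {F L} in
/-- If an endomorphism `D` of the fibre of `L` has `D a_β = g β`, these are the images of the
frame `u_A` under the endomorphism of `E = L ⊕ L*` that is `D` on `L` and `-Dᵗ` on `L*`. -/
def inducedE {x : M} (g : Fin (Module.finrank ℝ F) → L x) : Idx F → Dbl L x :=
  Sum.elim (fun α ↦ (g α, 0))
    (fun α ↦ (0, -∑ β, (coframeL F L x α (g β)) • coframeL F L x β))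

/-- A global smooth section of `L` with the value `v` at `x`. -/
def extL (x : M) (v : L x) : SecL (n := n) F L := Classical.epsilon fun s ↦ s x = v

/-- A global smooth section of `L*` with the value `ξ` at `x`. -/
def extDual (x : M) (ξ : L x →L[ℝ] ℝ) : SecDual (n := n) F L :=
  Classical.epsilon fun s ↦ s x = ξ

/-! ### Sections of `Λ E` over `M` and of its pull-back to `T*M` -/

variable (n)

/-- The Grassmann algebra of the fibre of `E = L ⊕ L*` at `x`. -/
abbrev GrE (x : M) : Type _ := ExteriorAlgebra ℝ (Dbl L x)

/-- Sections of `Λ E → M` (no smoothness imposed). -/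
abbrev SecGr : Type _ := ∀ x : M, GrE L x

/-- Sections of the pull-back `τ^♯ Λ E → T*M` of `Λ E` along `τ : T*M → M` (no smoothness
imposed); points of `T*M` are pairs of `x : M` and a covector `p` at `x`. -/
abbrev SecPull : Type _ := ∀ x : M, (TangentSpace (𝓡 n) x →L[ℝ] ℝ) → GrE L x

variable {L}

/-- Pull-back of sections along `τ : T*M → M`. -/
def pull (θ : SecGr L) : SecPull n L := fun x _ ↦ θ x

variable {n}

/-- Derivative at `0` of a curve in a finite-dimensional real vector space, taken component-wise
(that is, after applying arbitrary linear functionals). -/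
def curveDeriv {V : Type*} [AddCommGroup V] [Module ℝ V] (f : ℝ → V) : V :=
  open scoped Classical in
  if h : ∃ v : V, ∀ l : Module.Dual ℝ V, HasDerivAt (fun t ↦ l (f t)) (l v) 0
  then h.choose else 0

/-- Interior product from the left. -/
def intL {x : M} (d : Module.Dual ℝ (Dbl L x)) : GrE L x →ₗ[ℝ] GrE L x :=
  CliffordAlgebra.contractLeft d

/-- Interior product from the right. -/
def intR {x : M} (d : Module.Dual ℝ (Dbl L x)) (ψ : GrE L x) : GrE L x :=
  CliffordAlgebra.contractRight ψ d

/-! ### The Rothstein-Poisson bracket -/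

/-- The covector `dx^i` at `x`, for the preferred chart around `x`. -/
def coordForm (x : M) (i : Fin n) : TangentSpace (𝓡 n) x →L[ℝ] ℝ :=
  (EuclideanSpace.proj i : EuclideanSpace ℝ (Fin n) →L[ℝ] ℝ)

/-- `∂φ/∂p_i`. -/
def dP (φ : SecPull n L) (i : Fin n) : SecPull n L := fun x p ↦
  curveDeriv fun t : ℝ ↦ φ x (p + t • coordForm x i)

/-- The coordinate vector `∂/∂x^i` at `x`, for the preferred chart around `x`. -/
def coordVec (x : M) (i : Fin n) : TangentSpace (𝓡 n) x :=
  (EuclideanSpace.single i (1 : ℝ) : EuclideanSpace ℝ (Fin n))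

/-- The point with the coordinates of `x` except that the `i`-th one is increased by `t`,
in the chart around `x`. -/
def coordCurve (x : M) (i : Fin n) (t : ℝ) : M :=
  (extChartAt (𝓡 n) x).symm
    (extChartAt (𝓡 n) x x + t • (EuclideanSpace.single i (1 : ℝ) : EuclideanSpace ℝ (Fin n)))

/-- The covector at `y` that has the same momenta as the covector `p` at `x`, with respect to the
chart around `x`. -/
def coordCovec (x : M) (p : TangentSpace (𝓡 n) x →L[ℝ] ℝ) (y : M) :
    TangentSpace (𝓡 n) y →L[ℝ] ℝ :=
  ContinuousLinearMap.comp (p : EuclideanSpace ℝ (Fin n) →L[ℝ] ℝ)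
    (mfderiv (𝓡 n) 𝓘(ℝ, EuclideanSpace ℝ (Fin n)) (extChartAt (𝓡 n) x) y)

/-- The isomorphism from the fibre of `L` at `y` to that at `z` given by the trivialization
around `x`. -/
def transL (x y z : M) : L y →L[ℝ] L z :=
  ((trivializationAt F L x).symmL ℝ z).comp ((trivializationAt F L x).continuousLinearMapAt ℝ y)

/-- The isomorphism of Grassmann algebras from the fibre of `Λ E` at `y` to the one at `x` given by
the local frame `u_A` around `x`. -/
def transGr (x y : M) : GrE L y →ₐ[ℝ] GrE L x :=
  ExteriorAlgebra.map (LinearMap.prodMap (transL F x y x).toLinearMap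
    { toFun := fun ξ : L y →L[ℝ] ℝ ↦ ξ.comp (transL F x x y)
      map_add' := fun _ _ ↦ rfl
      map_smul' := fun _ _ ↦ rfl })

variable {F}

/-- `(∇_v u_A)(x)` for the local frame `u_A` of `E = L ⊕ L*` around `x`, where `E` carries the
connection induced by the connection `cov` of `L`. -/
def covFrame (cov : CovariantDerivative (𝓡 n) F L) (x : M) (v : TangentSpace (𝓡 n) x) :
    Idx F → Dbl L x :=
  inducedE fun β ↦ cov (frameL F L x β) x v

/-- The covariant derivative `(τ^♯∇)_{∂/∂q^i} φ` with respect to the pull-back connection: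
`∂/∂q^i` of the components of `φ` plus the Christoffel part `(∇_i u_A) ∧ i(u^A) φ`. -/
def dQ (cov : CovariantDerivative (𝓡 n) F L) (φ : SecPull n L) (i : Fin n) : SecPull n L :=
  fun x p ↦
    curveDeriv (fun t : ℝ ↦ transGr F x (coordCurve x i t)
      (φ (coordCurve x i t) (coordCovec x p (coordCurve x i t))))
    + ∑ A : Idx F, ExteriorAlgebra.ι ℝ (covFrame cov x (coordVec x i) A)
        * intL (coframeE F L x A) (φ x p)

/-- The coordinate vector field `∂/∂x^i` of the chart around `x`, at the point `y`. -/
def coordField (x : M) (i : Fin n) (y : M) : TangentSpace (𝓡 n) y :=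
  (trivializationAt (EuclideanSpace ℝ (Fin n)) (TangentSpace (𝓡 n) : M → Type _) x).symmL ℝ y
    (EuclideanSpace.single i (1 : ℝ))

/-- `R(∂_i, ∂_j) u_A` at `x`, for the curvature `R` of the connection on `E = L ⊕ L*`. -/
def curvFrame (cov : CovariantDerivative (𝓡 n) F L) (x : M) (i j : Fin n) : Idx F → Dbl L x :=
  inducedE fun β ↦
    cov (fun y ↦ cov (frameL F L x β) y (coordField x j y)) x (coordVec x i)
      - cov (fun y ↦ cov (frameL F L x β) y (coordField x i y)) x (coordVec x j)

/-- The Rothstein-Poisson bracket on the sections of `τ^♯ Λ E`,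
`∇_{q^i} φ ∧ ∂_{p_i} ψ - ∂_{p_i} φ ∧ ∇_{q^i} ψ
  - ½ h^{AB} R^C_{A i j} u_B ∧ u_C ∧ ∂_{p_i} φ ∧ ∂_{p_j} ψ + h_{AB} j(u^A) φ ∧ i(u^B) ψ`.
In the frame `u_A` the metric coefficients are `1` for a pair of indices exchanged by
`Sum.swap`, and `0` otherwise. -/
def roth (cov : CovariantDerivative (𝓡 n) F L) (φ ψ : SecPull n L) : SecPull n L := fun x p ↦
  ∑ i, (dQ cov φ i x p * dP ψ i x p - dP φ i x p * dQ cov ψ i x p)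
    - (1 / 2 : ℝ) • ∑ i, ∑ j, (∑ A : Idx F, ExteriorAlgebra.ι ℝ (frameE F L x A.swap)
        * ExteriorAlgebra.ι ℝ (curvFrame cov x i j A)) * dP φ i x p * dP ψ j x p
    + ∑ A : Idx F, intR (coframeE F L x A) (φ x p) * intL (coframeE F L x A.swap) (ψ x p)

/-! ### The elements `μ`, `γ`, `φ` of a Courant algebroid `L ⊕ L*` with Dirac structure `L` -/

/-- `h(∇_v e, e')` at `x`, where on the `L*`-part `(∇_v σ)(s) = v(σ(s)) - σ(∇_v s)`. -/
def hCov (cov : CovariantDerivative (𝓡 n) F L) (x : M) (v : TangentSpace (𝓡 n) x)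
    (e e' : SecE (n := n) F L) : ℝ :=
  dirDeriv (fun y ↦ e.2 y (e'.1 y)) x v - e.2 x (cov e'.1 x v) + e'.2 x (cov e.1 x v)

/-- The torsion tensor
`T(e₁, e₂, e₃) = h(∇_{ρ(e₁)} e₂ - ∇_{ρ(e₂)} e₁ - [e₁, e₂], e₃) + h(∇_{ρ(e₃)} e₁, e₂)` at `x`. -/
def torsion (C : CourantAlgebroid n F L) (cov : CovariantDerivative (𝓡 n) F L)
    (e₁ e₂ e₃ : SecE (n := n) F L) (x : M) : ℝ :=
  hCov cov x (C.anchor x (valE e₁ x)) e₂ e₃ - hCov cov x (C.anchor x (valE e₂ x)) e₁ e₃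
    - pairE (C.bracket e₁ e₂) e₃ x + hCov cov x (C.anchor x (valE e₃ x)) e₁ e₂

/-- The component `T(u_A, u_B, u_C)` of the torsion tensor at `x`; the tensor is evaluated on
arbitrary smooth sections through the vectors of the frame. -/
def torsionCoeff (C : CourantAlgebroid n F L) (cov : CovariantDerivative (𝓡 n) F L) (x : M)
    (A B D : Idx F) : ℝ :=
  torsion C cov (extL F L x (frameE F L x A).1, extDual F L x (frameE F L x A).2)
    (extL F L x (frameE F L x B).1, extDual F L x (frameE F L x B).2)
    (extL F L x (frameE F L x D).1, extDual F L x (frameE F L x D).2) x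

/-- `μ = - p_i ρ^i(a_α) a^α + ½ T(a_α, a_β, a^γ) a^α ∧ a^β ∧ a_γ`. -/
def muElt (C : CourantAlgebroid n F L) (cov : CovariantDerivative (𝓡 n) F L) : SecPull n L :=
  fun x p ↦
    -∑ α, p (C.anchor x (frameE F L x (.inl α))) • ExteriorAlgebra.ι ℝ (frameE F L x (.inr α))
    + (1 / 2 : ℝ) • ∑ α, ∑ β, ∑ γ, torsionCoeff C cov x (.inl α) (.inl β) (.inr γ) •
        (ExteriorAlgebra.ι ℝ (frameE F L x (.inr α)) * ExteriorAlgebra.ι ℝ (frameE F L x (.inr β))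
          * ExteriorAlgebra.ι ℝ (frameE F L x (.inl γ)))

/-- `γ = - p_i ρ^i(a^α) a_α + ½ T(a^α, a^β, a_γ) a_α ∧ a_β ∧ a^γ`. -/
def gammaElt (C : CourantAlgebroid n F L) (cov : CovariantDerivative (𝓡 n) F L) : SecPull n L :=
  fun x p ↦
    -∑ α, p (C.anchor x (frameE F L x (.inr α))) • ExteriorAlgebra.ι ℝ (frameE F L x (.inl α))
    + (1 / 2 : ℝ) • ∑ α, ∑ β, ∑ γ, torsionCoeff C cov x (.inr α) (.inr β) (.inl γ) •
        (ExteriorAlgebra.ι ℝ (frameE F L x (.inl α)) * ExteriorAlgebra.ι ℝ (frameE F L x (.inl β))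
          * ExteriorAlgebra.ι ℝ (frameE F L x (.inr γ)))

/-- `φ = ⅙ T(a^α, a^β, a^γ) a_α ∧ a_β ∧ a_γ`. -/
def phiElt (C : CourantAlgebroid n F L) (cov : CovariantDerivative (𝓡 n) F L) : SecPull n L :=
  fun x _ ↦
    (1 / 6 : ℝ) • ∑ α, ∑ β, ∑ γ, torsionCoeff C cov x (.inr α) (.inr β) (.inr γ) •
        (ExteriorAlgebra.ι ℝ (frameE F L x (.inl α)) * ExteriorAlgebra.ι ℝ (frameE F L x (.inl β))
          * ExteriorAlgebra.ι ℝ (frameE F L x (.inl γ)))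

/-! ### Forms on `L` and the Lie algebroid differential -/

/-- The iterated interior product `i_{v_k} ⋯ i_{v_1}`. -/
def contractList {x : M} : List (L x) → (GrE L x →ₗ[ℝ] GrE L x)
  | [] => LinearMap.id
  | v :: l => contractList l ∘ₗ intL (vecDual v)

/-- The value `θ(v_1, …, v_k) = i_{v_k} ⋯ i_{v_1} θ` of a form on vectors of `L`. -/
def evalForm {x : M} {k : ℕ} (v : Fin k → L x) : GrE L x →ₗ[ℝ] ℝ :=
  ExteriorAlgebra.algebraMapInv.toLinearMap ∘ₗ contractList (List.ofFn v)

/-- `Λ^k L*` at `x`, as a subspace of `Λ(L ⊕ L*)`. -/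
def dualPower (L : M → Type*) [∀ x, AddCommGroup (L x)] [∀ x, Module ℝ (L x)]
    [∀ x, TopologicalSpace (L x)] [∀ x, IsTopologicalAddGroup (L x)]
    [∀ x, ContinuousSMul ℝ (L x)] (k : ℕ) (x : M) : Submodule ℝ (GrE L x) :=
  (⋀[ℝ]^k (L x →L[ℝ] ℝ)).map
    (ExteriorAlgebra.map (LinearMap.inr ℝ (L x) (L x →L[ℝ] ℝ))).toLinearMap

variable (n F L)

/-- The space `Γ^∞(Λ^k L*)` of smooth `k`-forms on `L`. -/
def forms (k : ℕ) : Submodule ℝ (SecGr L) where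
  carrier := {θ | (∀ x, θ x ∈ dualPower L k x) ∧
    ∀ s : Fin k → SecL (n := n) F L,
      ContMDiff (𝓡 n) 𝓘(ℝ, ℝ) ∞ fun x ↦ evalForm (fun i ↦ s i x) (θ x)}
  add_mem' := by
    rintro a b ⟨ha, ha'⟩ ⟨hb, hb'⟩
    refine ⟨fun x ↦ add_mem (ha x) (hb x), fun s ↦ ?_⟩
    simp only [Pi.add_apply, map_add]
    exact (ha' s).add (hb' s)
  zero_mem' := by
    refine ⟨fun x ↦ zero_mem _, fun s ↦ ?_⟩
    simpa only [Pi.zero_apply, map_zero] using contMDiff_const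
  smul_mem' := by
    rintro c a ⟨ha, ha'⟩
    refine ⟨fun x ↦ Submodule.smul_mem _ c (ha x), fun s ↦ ?_⟩
    simp only [Pi.smul_apply, map_smul]
    exact (contMDiff_const (c := c)).mul (ha' s)

/-- The space `Γ^∞(Λ^• L*)` of all smooth forms on `L`. -/
def allForms : Submodule ℝ (SecGr L) := ⨆ k, forms n F L k

variable {n F L}

/-- The Koszul formula for `(d_L θ)(s_0, …, s_k)`, `θ` a `k`-form:
`∑_i (-1)^i ρ(s_i) θ(s_0, …, ŝ_i, …, s_k)
  + ∑_{i<j} (-1)^{i+j} θ([s_i, s_j], s_0, …, ŝ_i, …, ŝ_j, …, s_k)`.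
In the second sum `[s_i, s_j]` has been moved to the `i`-th place, which turns the sign
into `(-1)^j`. -/
def koszul (C : CourantAlgebroid n F L) {k : ℕ} (θ : SecGr L)
    (s : Fin (k + 1) → SecL (n := n) F L) (x : M) : ℝ :=
  ∑ i : Fin (k + 1), (-1 : ℝ) ^ (i : ℕ) *
      dirDeriv (fun y ↦ evalForm (fun m ↦ s (i.succAbove m) y) (θ y)) x
        (C.anchor x (s i x, 0))
    + ∑ j : Fin (k + 1), ∑ i ∈ Finset.Iio j, (-1 : ℝ) ^ (j : ℕ) *
      evalForm (fun m ↦ Function.update s i (C.bracketL (s i) (s j)) (j.succAbove m) x) (θ x)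

/-- The Lie algebroid differential `d_L` on `k`-forms: the `(k+1)`-form with the components
`(d_L θ)(a_{α_0}, …, a_{α_k})` given by the Koszul formula, evaluated on arbitrary smooth sections
through the vectors of the frame. -/
def dL (C : CourantAlgebroid n F L) (k : ℕ) (θ : SecGr L) : SecGr L := fun x ↦
  ((k + 1).factorial : ℝ)⁻¹ • ∑ α : Fin (k + 1) → Fin (Module.finrank ℝ F),
    koszul C θ (fun m ↦ extL F L x (frameL F L x (α m) x)) x •
      ExteriorAlgebra.ιMulti ℝ (k + 1) (fun m ↦ frameE F L x (.inr (α m)))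

/-! ### The brackets and the twisted differential -/

/-- The derived bracket `[ξ, ζ]_γ = {{ξ, γ}, ζ}`. -/
def gammaBracket (C : CourantAlgebroid n F L) (cov : CovariantDerivative (𝓡 n) F L)
    (ξ ζ : SecPull n L) : SecPull n L :=
  roth cov (roth cov ξ (gammaElt C cov)) ζ

/-- The triple bracket `[η₁, η₂, η₃]_φ = {{{φ, η₁}, η₂}, η₃}`. -/
def phiBracket (C : CourantAlgebroid n F L) (cov : CovariantDerivative (𝓡 n) F L)
    (η₁ η₂ η₃ : SecPull n L) : SecPull n L :=
  roth cov (roth cov (roth cov (phiElt C cov) η₁) η₂) η₃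

/-- `d_η = {μ, ·} + {{η, γ}, ·} + ½ {{{φ, η}, η}, ·}`. -/
def dEta (C : CourantAlgebroid n F L) (cov : CovariantDerivative (𝓡 n) F L) (η : SecGr L)
    (ζ : SecPull n L) : SecPull n L :=
  roth cov (muElt C cov) ζ + roth cov (roth cov (pull n η) (gammaElt C cov)) ζ
    + (1 / 2 : ℝ) • roth cov (roth cov (roth cov (phiElt C cov) (pull n η)) (pull n η)) ζ

/-- The Maurer-Cartan expression `d_L η + ½ [η, η]_γ + ⅙ [η, η, η]_φ` of a two-form `η`. -/
def maurerCartan (C : CourantAlgebroid n F L) (cov : CovariantDerivative (𝓡 n) F L)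
    (η : SecGr L) : SecPull n L :=
  pull n (dL C 2 η) + (1 / 2 : ℝ) • gammaBracket C cov (pull n η) (pull n η)
    + (1 / 6 : ℝ) • phiBracket C cov (pull n η) (pull n η) (pull n η)

end DiracDeformation

end

open DiracDeformation

set_option linter.unusedSectionVars false

noncomputable section

namespace DiracDeformation

section Fibre

/-! ### The Grassmann algebra of a fibre -/

section Exterior

variable {V : Type*} [AddCommGroup V] [Module ℝ V]

/-! The graph of `η`, spanned by `g_s = s + i_s η`, is a Lagrangian complement of `L*`, and `d_η` is
given by the Koszul formula with anchor `ρ(g_s)` and bracket `pr_L [g_s, g_t]`. Everything asserted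
follows from this description.

To reach it, note that `μ`, `γ`, `φ` and their brackets with `η` are at most affine in the momenta,
while a form on `L` does not depend on them at all. In a Rothstein bracket with a form the curvature
term therefore disappears, and what remains is a covariant derivative plus a contraction
(`roth_pull_right`, `roth_pull_left`). Collecting terms, `dEta_pull` shows that `d_η` is a first
order operator `koszulOp`: it wedges with `a^α` the covariant derivative along `ρ(g_{a_α})` and adds
an algebraic derivation built from an `L`-valued torsion. The graded Leibniz rule is then visible
(`koszulOp_mul`). A Cartan formula, `contr_koszulOp`, gives the values of the operator on sections
by induction on the degree (`evalForm_koszulOp`). The torsion tensor of the Courant algebroid is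
skew and tensorial, and this identifies the bracket that occurs there with `pr_L [g_s, g_t]`
(`covBracket_graph`). The connection has thereby dropped out, and smoothness of the values can be
read off (`twistedD_mem`).

For the Maurer-Cartan part, let `P(t)` be `h([g₀, g₁], g₂)` for the graph of `tη`, a cubic
polynomial in `t`. The Courant axioms show that `d_{tη} η` is its derivative `P'(t)`, and `P(0) = 0`
because `L` is Dirac. Integrating `d_{tη} η = d_L η + t [η, η]_γ + t²/2 [η, η, η]_φ` from `0` to `1`
gives the Maurer-Cartan expression, so its value on three sections is `h([g₀, g₁], g₂)`
(`evalForm_maurerCartanForm`). Applying the Koszul formula for `d_η` to this three-form produces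
exactly the Jacobi identity of the Courant bracket paired with a fourth section of the graph
(`twistedD_maurerCartanForm`). Brackets of graph sections may leave the graph; the defect is
controlled by the Lagrangian splitting of `h`. -/

open CliffordAlgebra in
lemma contractLeft_mul (d : Module.Dual ℝ V) (a b : ExteriorAlgebra ℝ V) :
    contractLeft (Q := (0 : QuadraticForm ℝ V)) d (a * b) =
      contractLeft (Q := (0 : QuadraticForm ℝ V)) d a * b
        + involute a * contractLeft (Q := (0 : QuadraticForm ℝ V)) d b := by
  induction a using ExteriorAlgebra.induction generalizing b with
  | algebraMap r =>
    rw [contractLeft_algebraMap_mul, contractLeft_algebraMap, zero_mul, zero_add, AlgHom.commutes]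
  | ι m =>
    rw [contractLeft_ι_mul, contractLeft_ι, ← Algebra.smul_def, involute_ι, neg_mul, sub_eq_add_neg]
  | add x y hx hy => rw [add_mul, map_add, hx, hy, map_add, map_add]; noncomm_ring
  | mul x y hx hy =>
    rw [mul_assoc, hx, hy, hx, map_mul]; noncomm_ring

open CliffordAlgebra in
lemma ι_mul_eq (m : V) (a : ExteriorAlgebra ℝ V) :
    ExteriorAlgebra.ι ℝ m * a = involute a * ExteriorAlgebra.ι ℝ m := by
  induction a using ExteriorAlgebra.induction with
  | algebraMap r => rw [AlgHom.commutes, Algebra.commutes]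
  | ι v => rw [involute_ι, neg_mul, eq_neg_iff_add_eq_zero]; exact ExteriorAlgebra.ι_add_mul_swap m v
  | add x y hx hy => rw [mul_add, hx, hy, map_add, add_mul]
  | mul x y hx hy => rw [← mul_assoc, hx, mul_assoc, hy, map_mul, mul_assoc]

-- Wedging with `m` and contracting with `d` are both odd, so the composite is even and the signs of
-- the graded Leibniz rule cancel. Christoffel terms and endomorphisms of `L` thus act as ordinary
-- derivations.
open CliffordAlgebra in
lemma ι_mul_contractLeft_mul (m : V) (d : Module.Dual ℝ V) (a b : ExteriorAlgebra ℝ V) :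
    ExteriorAlgebra.ι ℝ m * contractLeft (Q := (0 : QuadraticForm ℝ V)) d (a * b) =
      (ExteriorAlgebra.ι ℝ m * contractLeft (Q := (0 : QuadraticForm ℝ V)) d a) * b
      + a * (ExteriorAlgebra.ι ℝ m * contractLeft (Q := (0 : QuadraticForm ℝ V)) d b) := by
  rw [contractLeft_mul, mul_add, ← mul_assoc, ← mul_assoc, ι_mul_eq m (involute a),
    involute_involute, mul_assoc a]

end Exterior

variable {M : Type*} {L : M → Type*} [∀ x, AddCommGroup (L x)] [∀ x, Module ℝ (L x)]
  [∀ x, TopologicalSpace (L x)] {x : M}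

lemma intL_mul (d : Module.Dual ℝ (Dbl L x)) (a b : GrE L x) :
    intL d (a * b) = intL d a * b + CliffordAlgebra.involute a * intL d b :=
  contractLeft_mul d a b

lemma intL_anticomm (d d' : Module.Dual ℝ (Dbl L x)) (a : GrE L x) :
    intL d (intL d' a) = -intL d' (intL d a) :=
  CliffordAlgebra.contractLeft_comm d d' a

lemma intL_algebraMap (d : Module.Dual ℝ (Dbl L x)) (r : ℝ) :
    intL d (algebraMap ℝ (GrE L x) r) = 0 :=
  CliffordAlgebra.contractLeft_algebraMap (Q := (0 : QuadraticForm ℝ (Dbl L x))) _ r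

variable [∀ x, IsTopologicalAddGroup (L x)] [∀ x, ContinuousSMul ℝ (L x)]

/-- A covector of `L`, as an element of the Grassmann algebra of `L ⊕ L*`. -/
def covec : (L x →L[ℝ] ℝ) →ₗ[ℝ] GrE L x :=
  ExteriorAlgebra.ι ℝ ∘ₗ LinearMap.inr ℝ (L x) (L x →L[ℝ] ℝ)

/-- A vector of `L`, as an element of the Grassmann algebra of `L ⊕ L*`. -/
def vec : L x →ₗ[ℝ] GrE L x :=
  ExteriorAlgebra.ι ℝ ∘ₗ LinearMap.inl ℝ (L x) (L x →L[ℝ] ℝ)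

/-- The interior product with a vector of `L`, linear in the vector. -/
def contr : L x →ₗ[ℝ] GrE L x →ₗ[ℝ] GrE L x :=
  CliffordAlgebra.contractLeft ∘ₗ
    { toFun := vecDual
      map_add' := fun v w ↦ by ext e <;> simp [vecDual]
      map_smul' := fun c v ↦ by ext e <;> simp [vecDual] }

lemma intL_vecDual (v : L x) : intL (vecDual v) = contr v := rfl

lemma covec_apply (ξ : L x →L[ℝ] ℝ) : ExteriorAlgebra.ι ℝ ((0, ξ) : Dbl L x) = covec ξ := rfl

lemma contr_covec_mul (v : L x) (ξ : L x →L[ℝ] ℝ) (a : GrE L x) :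
    contr v (covec ξ * a) = ξ v • a - covec ξ * contr v a :=
  CliffordAlgebra.contractLeft_ι_mul (d := vecDual v) ((0, ξ) : Dbl L x) a

lemma contr_covec (v : L x) (ξ : L x →L[ℝ] ℝ) : contr v (covec ξ) = algebraMap ℝ _ (ξ v) :=
  CliffordAlgebra.contractLeft_ι (0 : QuadraticForm ℝ (Dbl L x)) (vecDual v) ((0, ξ) : Dbl L x)

lemma contr_anticomm (v w : L x) (a : GrE L x) : contr v (contr w a) = -contr w (contr v a) :=
  intL_anticomm _ _ _

lemma contr_algebraMap (v : L x) (r : ℝ) : contr v (algebraMap ℝ (GrE L x) r) = 0 :=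
  CliffordAlgebra.contractLeft_algebraMap (Q := (0 : QuadraticForm ℝ (Dbl L x))) _ r

lemma covec_mul (ξ : L x →L[ℝ] ℝ) (a : GrE L x) :
    covec ξ * a = CliffordAlgebra.involute a * covec ξ := ι_mul_eq _ a

lemma covec_mul_covec (ξ ζ : L x →L[ℝ] ℝ) : covec ξ * covec ζ = -(covec ζ * covec ξ) :=
  eq_neg_of_add_eq_zero_left (ExteriorAlgebra.ι_add_mul_swap _ _)

/-! ### Evaluation of forms -/

lemma evalForm_zero (v : Fin 0 → L x) (a : GrE L x) :
    evalForm v a = ExteriorAlgebra.algebraMapInv a := rfl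

lemma evalForm_succ {k : ℕ} (v : Fin (k + 1) → L x) (a : GrE L x) :
    evalForm v a = evalForm (fun i ↦ v i.succ) (contr (v 0) a) := by
  simp only [evalForm, List.ofFn_succ, contractList]
  rfl

lemma evalForm_update_zero {k : ℕ} (v : Fin (k + 1) → L x) (w : L x) (a : GrE L x) :
    evalForm (Function.update v 0 w) a = evalForm (fun i ↦ v i.succ) (contr w a) := by
  rw [evalForm_succ]
  simp [Fin.succ_ne_zero]

lemma evalForm_update_succ {k : ℕ} (v : Fin (k + 1) → L x) (j : Fin k) (w : L x) (a : GrE L x) :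
    evalForm (Function.update v j.succ w) a
      = evalForm (Function.update (fun i ↦ v i.succ) j w) (contr (v 0) a) := by
  rw [evalForm_succ, Function.update_of_ne (Fin.succ_ne_zero j).symm]
  congr 2
  ext i
  by_cases h : i = j
  · subst h; simp
  · simp [Function.update_of_ne h, Function.update_of_ne ((Fin.succ_injective _).ne h)]

lemma evalForm_update_add {k : ℕ} (v : Fin k → L x) (j : Fin k) (w w' : L x) (a : GrE L x) :
    evalForm (Function.update v j (w + w')) a
      = evalForm (Function.update v j w) a + evalForm (Function.update v j w') a := by
  induction k generalizing a with
  | zero => exact j.elim0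
  | succ k ih =>
    refine Fin.cases ?_ (fun j ↦ ?_) j
    · simp [evalForm_update_zero]
    · simp only [evalForm_update_succ, ih]

lemma evalForm_update_smul {k : ℕ} (v : Fin k → L x) (j : Fin k) (c : ℝ) (w : L x) (a : GrE L x) :
    evalForm (Function.update v j (c • w)) a = c * evalForm (Function.update v j w) a := by
  induction k generalizing a with
  | zero => exact j.elim0
  | succ k ih =>
    refine Fin.cases ?_ (fun j ↦ ?_) j
    · simp [evalForm_update_zero]
    · simp only [evalForm_update_succ, ih]

lemma evalForm_update_neg {k : ℕ} (v : Fin k → L x) (j : Fin k) (w : L x) (a : GrE L x) :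
    evalForm (Function.update v j (-w)) a = -evalForm (Function.update v j w) a := by
  rw [← neg_one_smul ℝ w, evalForm_update_smul, neg_one_mul]

lemma evalForm_update_sub {k : ℕ} (v : Fin k → L x) (j : Fin k) (w w' : L x) (a : GrE L x) :
    evalForm (Function.update v j (w - w')) a
      = evalForm (Function.update v j w) a - evalForm (Function.update v j w') a := by
  rw [sub_eq_add_neg, evalForm_update_add, evalForm_update_neg, sub_eq_add_neg]

/-- Moving the first argument of a form to the `j`-th place. -/
lemma evalForm_succAbove_contr {k : ℕ} (v : Fin (k + 1) → L x) (j : Fin (k + 1)) (w : L x)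
    (a : GrE L x) :
    evalForm (fun m ↦ v (j.succAbove m)) (contr w a)
      = (-1) ^ (j : ℕ) * evalForm (Function.update v j w) a := by
  induction k generalizing w a with
  | zero =>
    obtain rfl : j = 0 := Fin.fin_one_eq_zero j
    simp [evalForm_update_zero]
  | succ k ih =>
    refine Fin.cases ?_ (fun j ↦ ?_) j
    · simp [evalForm_update_zero]
    · rw [evalForm_succ, evalForm_update_succ]
      simp only [Fin.succ_succAbove_succ, Fin.succ_succAbove_zero]
      rw [contr_anticomm, map_neg, ih (fun i ↦ v i.succ) j w (contr (v 0) a), Fin.val_succ]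
      ring

/-! ### Resolutions of the identity and derivations -/

section Frame

variable {ι : Type*} [Fintype ι] {a : ι → L x} {b : ι → L x →L[ℝ] ℝ}

/-- The extension of the transpose of an endomorphism of `L` to a derivation of the Grassmann
algebra of `L*`. -/
def deriv (a : ι → L x) (b : ι → L x →L[ℝ] ℝ) (B : L x →ₗ[ℝ] L x) (θ : GrE L x) : GrE L x :=
  ∑ α, covec (b α) * contr (B (a α)) θ

lemma sum_coeff_contr (h : ∀ v, ∑ α, b α v • a α = v) (B : L x →ₗ[ℝ] L x) (v : L x) (θ : GrE L x) :
    ∑ α, b α v • contr (B (a α)) θ = contr (B v) θ := by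
  conv_rhs => rw [← h v]
  simp [map_sum]

/-- The contraction either meets a dual frame vector, where the resolution of the identity turns the
sum into `i_{Bv}`, or passes on to the next contraction, where two signs cancel. So `[i_v, D_B] =
i_{Bv}`. -/
lemma contr_deriv (h : ∀ v, ∑ α, b α v • a α = v) (B : L x →ₗ[ℝ] L x) (v : L x) (θ : GrE L x) :
    contr v (deriv a b B θ) = contr (B v) θ + deriv a b B (contr v θ) := by
  simp only [deriv, map_sum, contr_covec_mul, Finset.sum_sub_distrib, sum_coeff_contr h]
  rw [sub_eq_add_neg, ← Finset.sum_neg_distrib]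
  congr 1
  refine Finset.sum_congr rfl fun α _ ↦ ?_
  rw [contr_anticomm, mul_neg, neg_neg]

lemma evalForm_covec_mul_zero (ξ : L x →L[ℝ] ℝ) (θ : GrE L x) (v : Fin 0 → L x) :
    evalForm v (covec ξ * θ) = 0 := by
  rw [evalForm_zero, map_mul]
  have : ExteriorAlgebra.algebraMapInv (covec ξ : GrE L x) = 0 := by
    simp [covec, ExteriorAlgebra.algebraMapInv]
  rw [this, zero_mul]

lemma evalForm_deriv (h : ∀ v, ∑ α, b α v • a α = v) (B : L x →ₗ[ℝ] L x) {k : ℕ} (v : Fin k → L x)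
    (θ : GrE L x) :
    evalForm v (deriv a b B θ) = ∑ m, evalForm (Function.update v m (B (v m))) θ := by
  induction k generalizing θ with
  | zero =>
    simp only [deriv, map_sum, evalForm_covec_mul_zero]
    simp
  | succ k ih =>
    rw [evalForm_succ, contr_deriv h, map_add, ih, Fin.sum_univ_succ, evalForm_update_zero]
    simp only [evalForm_update_succ]

/-- The extension of a vector valued two-form on `L` to a derivation of degree one. -/
def derivTwo (a : ι → L x) (b : ι → L x →L[ℝ] ℝ) (τ : L x →ₗ[ℝ] L x →ₗ[ℝ] L x) (θ : GrE L x) :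
    GrE L x :=
  (1 / 2 : ℝ) • ∑ α, covec (b α) * deriv a b (τ (a α)) θ

/-- The vector `v` can be absorbed by either of the two arguments of `τ`; by skewness both give the
same derivation, which cancels the factor one half. This is the algebraic part of the Cartan
formula. -/
lemma contr_derivTwo (h : ∀ v, ∑ α, b α v • a α = v) (τ : L x →ₗ[ℝ] L x →ₗ[ℝ] L x)
    (hτ : ∀ v w, τ v w = -τ w v) (v : L x) (θ : GrE L x) :
    contr v (derivTwo a b τ θ) = deriv a b (τ v) θ - derivTwo a b τ (contr v θ) := by
  have h1 : ∑ α, b α v • deriv a b (τ (a α)) θ = deriv a b (τ v) θ := by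
    simp only [deriv, Finset.smul_sum]
    rw [Finset.sum_comm]
    refine Finset.sum_congr rfl fun β _ ↦ ?_
    simp only [← mul_smul_comm, ← Finset.mul_sum]
    congr 1
    exact sum_coeff_contr h (τ.flip (a β)) v θ
  have h2 : ∑ α, covec (b α) * contr (τ (a α) v) θ = - deriv a b (τ v) θ := by
    simp only [deriv, ← Finset.sum_neg_distrib]
    refine Finset.sum_congr rfl fun β _ ↦ ?_
    rw [hτ, map_neg, LinearMap.neg_apply, mul_neg]
  simp only [derivTwo, map_smul, map_sum, contr_covec_mul, Finset.sum_sub_distrib, h1,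
    contr_deriv h, mul_add, Finset.sum_add_distrib, h2]
  module

end Frame

/-! ### The exterior powers of the dual -/

lemma dualPower_eq_span (k : ℕ) :
    dualPower L k x = Submodule.span ℝ (Set.range fun ξ : Fin k → L x →L[ℝ] ℝ ↦
      (List.ofFn fun i ↦ (covec (ξ i) : GrE L x)).prod) := by
  rw [dualPower, ← ExteriorAlgebra.ιMulti_span_fixedDegree, Submodule.map_span, ← Set.range_comp]
  congr 2
  ext ξ
  simp [ExteriorAlgebra.ιMulti_apply, map_list_prod, List.map_ofFn, Function.comp_def, covec]

lemma dualPower_induction {k : ℕ} {p : GrE L x → Prop} (zero : p 0)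
    (add : ∀ a b, p a → p b → p (a + b)) (smul : ∀ (c : ℝ) a, p a → p (c • a))
    (prod : ∀ ξ : Fin k → L x →L[ℝ] ℝ, p (List.ofFn fun i ↦ (covec (ξ i) : GrE L x)).prod)
    {θ : GrE L x} (hθ : θ ∈ dualPower L k x) : p θ := by
  rw [dualPower_eq_span] at hθ
  induction hθ using Submodule.span_induction with
  | mem y hy => obtain ⟨ξ, rfl⟩ := hy; exact prod ξ
  | zero => exact zero
  | add y z _ _ hy hz => exact add y z hy hz
  | smul c y _ hy => exact smul c y hy

lemma one_mem_dualPower : (1 : GrE L x) ∈ dualPower L 0 x := by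
  rw [dualPower_eq_span]
  exact Submodule.subset_span ⟨Fin.elim0, by simp⟩

lemma mem_dualPower_zero {θ : GrE L x} (hθ : θ ∈ dualPower L 0 x) :
    ∃ r : ℝ, θ = algebraMap ℝ _ r := by
  refine dualPower_induction (p := fun θ ↦ ∃ r : ℝ, θ = algebraMap ℝ _ r) ⟨0, by simp⟩ ?_ ?_ ?_ hθ
  · rintro _ _ ⟨r, rfl⟩ ⟨s, rfl⟩; exact ⟨r + s, by simp⟩
  · rintro c _ ⟨r, rfl⟩; exact ⟨c * r, by simp [Algebra.smul_def]⟩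
  · intro ξ; exact ⟨1, by simp⟩

lemma covec_mul_mem {k : ℕ} (ξ : L x →L[ℝ] ℝ) {θ : GrE L x} (hθ : θ ∈ dualPower L k x) :
    covec ξ * θ ∈ dualPower L (k + 1) x := by
  refine dualPower_induction (p := fun θ ↦ covec ξ * θ ∈ dualPower L (k + 1) x) ?_ ?_ ?_ ?_ hθ
  · simp
  · intro a b ha hb; rw [mul_add]; exact add_mem ha hb
  · intro c a ha; rw [mul_smul_comm]; exact Submodule.smul_mem _ c ha
  · intro ζ
    rw [dualPower_eq_span]
    exact Submodule.subset_span ⟨Fin.cons ξ ζ, by simp [List.ofFn_succ]⟩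

lemma covec_mem (ξ : L x →L[ℝ] ℝ) : covec ξ ∈ dualPower L 1 x := by
  simpa using covec_mul_mem ξ one_mem_dualPower

/-- An induction principle that builds up the elements of `Λ^k L*` by multiplication with
covectors. -/
lemma dualPower_succ_induction {k : ℕ} {p : GrE L x → Prop} (zero : p 0)
    (add : ∀ a b, p a → p b → p (a + b))
    (mul : ∀ (ξ : L x →L[ℝ] ℝ), ∀ a ∈ dualPower L k x, p (covec ξ * a))
    {θ : GrE L x} (hθ : θ ∈ dualPower L (k + 1) x) : p θ := by
  -- The strengthened predicate includes all scalar multiples. A scalar in front of a product of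
  -- covectors is absorbed into the second factor, so `p` itself need not be assumed to respect
  -- scalars.
  have key : θ ∈ {θ | p θ ∧ ∀ c : ℝ, p (c • θ)} := by
    refine dualPower_induction (p := fun θ ↦ p θ ∧ ∀ c : ℝ, p (c • θ)) ?_ ?_ ?_ ?_ hθ
    · exact ⟨zero, fun c ↦ by rwa [smul_zero]⟩
    · rintro a b ⟨ha, ha'⟩ ⟨hb, hb'⟩
      exact ⟨add _ _ ha hb, fun c ↦ by rw [smul_add]; exact add _ _ (ha' c) (hb' c)⟩
    · rintro c a ⟨_, ha'⟩
      exact ⟨ha' c, fun d ↦ by rw [smul_smul]; exact ha' _⟩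
    · intro ξ
      have h : ∀ c : ℝ, p (c • (List.ofFn fun i ↦ (covec (ξ i) : GrE L x)).prod) := by
        intro c
        rw [List.ofFn_succ, List.prod_cons, ← mul_smul_comm]
        refine mul _ _ (Submodule.smul_mem _ c ?_)
        rw [dualPower_eq_span]
        exact Submodule.subset_span ⟨_, rfl⟩
      exact ⟨by simpa using h 1, h⟩
  exact key.1

lemma dualPower_mul_mem {k l : ℕ} {θ θ' : GrE L x} (hθ : θ ∈ dualPower L k x)
    (hθ' : θ' ∈ dualPower L l x) : θ * θ' ∈ dualPower L (k + l) x := by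
  induction k generalizing θ with
  | zero =>
    obtain ⟨r, rfl⟩ := mem_dualPower_zero hθ
    rw [← Algebra.smul_def, zero_add]
    exact Submodule.smul_mem _ r hθ'
  | succ k ih =>
    refine dualPower_succ_induction (p := fun θ ↦ θ * θ' ∈ dualPower L (k + 1 + l) x)
      ?_ ?_ ?_ hθ
    · simp
    · intro a b ha hb; rw [add_mul]; exact add_mem ha hb
    · intro ξ a ha
      rw [mul_assoc, Nat.add_right_comm]
      exact covec_mul_mem ξ (ih ha)

lemma contr_eq_zero {θ : GrE L x} (hθ : θ ∈ dualPower L 0 x) (v : L x) : contr v θ = 0 := by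
  obtain ⟨r, rfl⟩ := mem_dualPower_zero hθ
  exact contr_algebraMap v r

lemma contr_mem {k : ℕ} (v : L x) {θ : GrE L x} (hθ : θ ∈ dualPower L (k + 1) x) :
    contr v θ ∈ dualPower L k x := by
  induction k generalizing θ with
  | zero =>
    refine dualPower_succ_induction (p := fun θ ↦ contr v θ ∈ dualPower L 0 x) (by simp) ?_ ?_ hθ
    · intro a b ha hb; rw [map_add]; exact add_mem ha hb
    · intro ξ a ha
      rw [contr_covec_mul, contr_eq_zero ha, mul_zero, sub_zero]
      exact Submodule.smul_mem _ _ ha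
  | succ k ih =>
    refine dualPower_succ_induction (p := fun θ ↦ contr v θ ∈ dualPower L (k + 1) x)
      (by simp) ?_ ?_ hθ
    · intro a b ha hb; rw [map_add]; exact add_mem ha hb
    · intro ξ a ha
      rw [contr_covec_mul]
      exact sub_mem (Submodule.smul_mem _ _ ha) (covec_mul_mem ξ (ih ha))

lemma involute_of_mem {k : ℕ} {θ : GrE L x} (hθ : θ ∈ dualPower L k x) :
    CliffordAlgebra.involute θ = (-1 : ℝ) ^ k • θ := by
  induction k generalizing θ with
  | zero =>
    obtain ⟨r, rfl⟩ := mem_dualPower_zero hθ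
    rw [AlgHom.commutes]; simp
  | succ k ih =>
    refine dualPower_succ_induction
      (p := fun θ ↦ CliffordAlgebra.involute θ = (-1 : ℝ) ^ (k + 1) • θ) (by simp) ?_ ?_ hθ
    · intro a b ha hb; rw [map_add, ha, hb, smul_add]
    · intro ξ a ha
      rw [map_mul, ih ha]
      have : CliffordAlgebra.involute (covec ξ : GrE L x) = -covec ξ :=
        CliffordAlgebra.involute_ι _
      rw [this, pow_succ, mul_smul_comm]
      simp

/-- `L*` is isotropic, so contraction with a covector kills every generator of the algebra of forms
on `L`. Half of the metric term of the Rothstein bracket vanishes for this reason. -/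
lemma intL_covecDual_of_mem {k : ℕ} (ξ : L x →L[ℝ] ℝ) {θ : GrE L x} (hθ : θ ∈ dualPower L k x) :
    intL (covecDual ξ) θ = 0 := by
  induction k generalizing θ with
  | zero =>
    obtain ⟨r, rfl⟩ := mem_dualPower_zero hθ
    exact intL_algebraMap _ _
  | succ k ih =>
    refine dualPower_succ_induction (p := fun θ ↦ intL (covecDual ξ) θ = 0) (by simp) ?_ ?_ hθ
    · intro a b ha hb; rw [map_add, ha, hb, add_zero]
    · intro ζ a ha
      have := CliffordAlgebra.contractLeft_ι_mul (Q := (0 : QuadraticForm ℝ (Dbl L x)))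
        (d := covecDual ξ) ((0, ζ) : Dbl L x) a
      refine this.trans ?_
      change covecDual ξ ((0, ζ) : Dbl L x) • a - _ * intL (covecDual ξ) a = 0
      rw [ih ha]
      simp [covecDual]

lemma deriv_mem {ι : Type*} [Fintype ι] (a : ι → L x) (b : ι → L x →L[ℝ] ℝ) (B : L x →ₗ[ℝ] L x)
    {k : ℕ} {θ : GrE L x} (hθ : θ ∈ dualPower L k x) : deriv a b B θ ∈ dualPower L k x := by
  refine Submodule.sum_mem _ fun α _ ↦ ?_
  cases k with
  | zero => rw [contr_eq_zero hθ, mul_zero]; exact zero_mem _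
  | succ k => exact covec_mul_mem _ (contr_mem _ hθ)

lemma derivTwo_mem {ι : Type*} [Fintype ι] (a : ι → L x) (b : ι → L x →L[ℝ] ℝ)
    (τ : L x →ₗ[ℝ] L x →ₗ[ℝ] L x)
    {k : ℕ} {θ : GrE L x} (hθ : θ ∈ dualPower L k x) :
    derivTwo a b τ θ ∈ dualPower L (k + 1) x :=
  Submodule.smul_mem _ _ (Submodule.sum_mem _ fun _ _ ↦ covec_mul_mem _ (deriv_mem _ _ _ hθ))

/-! ### Forms are determined by their values -/

section Frame

variable {ι : Type*} [Fintype ι] {a : ι → L x} {b : ι → L x →L[ℝ] ℝ}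

/-- This operator is the derivation that extends the identity of `L*`, hence it counts the degree.
-/
lemma sum_covec_mul_contr (h : ∀ v, ∑ α, b α v • a α = v) {k : ℕ} {θ : GrE L x}
    (hθ : θ ∈ dualPower L k x) : ∑ α, covec (b α) * contr (a α) θ = (k : ℝ) • θ := by
  induction k generalizing θ with
  | zero => simp [contr_eq_zero hθ]
  | succ k ih =>
    refine dualPower_succ_induction
      (p := fun θ ↦ ∑ α, covec (b α) * contr (a α) θ = ((k + 1 : ℕ) : ℝ) • θ) (by simp) ?_ ?_ hθ
    · intro c d hc hd; simp only [map_add, mul_add, Finset.sum_add_distrib, hc, hd, smul_add]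
    · intro ξ c hc
      have h1 : ∑ α, ξ (a α) • covec (b α) = (covec ξ : GrE L x) := by
        simp only [← map_smul, ← map_sum]
        congr 1
        ext v
        conv_rhs => rw [← h v]
        simp [mul_comm]
      simp only [contr_covec_mul, mul_sub, mul_smul_comm, Finset.sum_sub_distrib]
      simp only [← smul_mul_assoc, ← Finset.sum_mul, h1]
      have h2 : ∀ α, covec (b α) * (covec ξ * contr (a α) c)
          = -(covec ξ * (covec (b α) * contr (a α) c)) := by
        intro α
        rw [← mul_assoc, covec_mul_covec, neg_mul, mul_assoc]
      simp only [h2, Finset.sum_neg_distrib, ← Finset.mul_sum, ih hc]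
      rw [mul_smul_comm, sub_neg_eq_add, Nat.cast_succ, add_smul, one_smul, add_comm,
        add_mul, smul_mul_assoc]

/-- Iterating the degree operator `k` times gives the factors `k`, `k - 1`, and so on down to `1`.
The factorial reflects that the sum runs over all tuples and not only over the increasing ones. -/
lemma sum_evalForm_smul (h : ∀ v, ∑ α, b α v • a α = v) {k : ℕ} {θ : GrE L x}
    (hθ : θ ∈ dualPower L k x) :
    ∑ α : Fin k → ι, evalForm (fun i ↦ a (α i)) θ •
      (List.ofFn fun i ↦ (covec (b (α i)) : GrE L x)).prod = (k.factorial : ℝ) • θ := by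
  induction k generalizing θ with
  | zero =>
    obtain ⟨r, rfl⟩ := mem_dualPower_zero hθ
    simp only [evalForm_zero, Algebra.algebraMap_eq_smul_one]
    simp
  | succ k ih =>
    rw [← (Fin.consEquiv fun _ ↦ ι).sum_comp, Fintype.sum_prod_type, Nat.factorial_succ, mul_comm,
      Nat.cast_mul, mul_smul, ← sum_covec_mul_contr h hθ, Finset.smul_sum]
    refine Finset.sum_congr rfl fun α _ ↦ ?_
    rw [← mul_smul_comm, ← ih (contr_mem _ hθ), Finset.mul_sum]
    refine Finset.sum_congr rfl fun β _ ↦ ?_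
    rw [evalForm_succ, List.ofFn_succ, List.prod_cons, mul_smul_comm]
    simp

lemma eq_of_evalForm_eq (h : ∀ v, ∑ α, b α v • a α = v) {k : ℕ} {θ θ' : GrE L x}
    (hθ : θ ∈ dualPower L k x) (hθ' : θ' ∈ dualPower L k x)
    (H : ∀ v : Fin k → L x, evalForm v θ = evalForm v θ') : θ = θ' := by
  have h0 : (k.factorial : ℝ) ≠ 0 := by exact_mod_cast k.factorial_ne_zero
  refine smul_right_injective _ h0 ?_
  simp only [← sum_evalForm_smul h hθ, ← sum_evalForm_smul h hθ', H]

end Frame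

end Fibre

/-! ### Global sections with prescribed local behaviour -/

section Sections

open Filter Topology

variable {n : ℕ} {M : Type*} [TopologicalSpace M] [ChartedSpace (EuclideanSpace ℝ (Fin n)) M]
  [IsManifold (𝓡 n) ∞ M]
variable {G : Type*} [NormedAddCommGroup G] [NormedSpace ℝ G]
variable {W : M → Type*} [∀ x, AddCommGroup (W x)] [∀ x, Module ℝ (W x)]
  [∀ x, TopologicalSpace (W x)] [TopologicalSpace (TotalSpace G W)]
  [FiberBundle G W] [VectorBundle ℝ G W]

/-- The product of a smooth function and a smooth section. -/
def mulSec (f : C^∞⟮𝓡 n, M; 𝓘(ℝ, ℝ), ℝ⟯) (s : Cₛ^∞⟮𝓡 n; G, W⟯) : Cₛ^∞⟮𝓡 n; G, W⟯ :=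
  ⟨fun x ↦ f x • s x, f.contMDiff.smul_section s.contMDiff⟩

@[simp]
lemma mulSec_apply (f : C^∞⟮𝓡 n, M; 𝓘(ℝ, ℝ), ℝ⟯) (s : Cₛ^∞⟮𝓡 n; G, W⟯) (x : M) :
    mulSec f s x = f x • s x := rfl

lemma sum_mulSec_apply {ι : Type*} [Fintype ι] (f : ι → C^∞⟮𝓡 n, M; 𝓘(ℝ, ℝ), ℝ⟯)
    (s : ι → Cₛ^∞⟮𝓡 n; G, W⟯) (x : M) :
    (∑ i, mulSec (f i) (s i)) x = ∑ i, f i x • s i x := by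
  have h := congrFun (map_sum (ContMDiffSection.coeAddHom (𝓡 n) G ∞ W)
    (fun i ↦ mulSec (f i) (s i)) Finset.univ) x
  rw [Finset.sum_apply] at h
  exact h

lemma exists_bump [T2Space M] (x : M) {u : Set M} (hu : u ∈ 𝓝 x) :
    ∃ ψ : C^∞⟮𝓡 n, M; 𝓘(ℝ, ℝ), ℝ⟯, (∀ᶠ y in 𝓝 x, ψ y = 1) ∧ tsupport ψ ⊆ u := by
  obtain ⟨f, -, hf⟩ := (SmoothBumpFunction.nhds_basis_tsupport (I := 𝓡 n) x).mem_iff.1 hu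
  exact ⟨⟨f, f.contMDiff⟩, f.eventuallyEq_one, hf⟩

variable [FiniteDimensional ℝ G] [ContMDiffVectorBundle ∞ G W (𝓡 n)]

variable (G W) in
lemma contMDiffOn_symmL_const (x : M) (v : G) :
    ContMDiffOn (𝓡 n) ((𝓡 n).prod 𝓘(ℝ, G)) ∞
      (fun y ↦ TotalSpace.mk' G y ((trivializationAt G W x).symmL ℝ y v))
      (trivializationAt G W x).baseSet := by
  rw [Trivialization.contMDiffOn_section_baseSet_iff]
  refine contMDiffOn_const (c := v) |>.congr fun y hy ↦ ?_
  simp [Trivialization.symmL_apply _ hy, Trivialization.apply_mk_symm _ hy]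

variable (G W) in
/-- Smooth global sections that agree near `x` with the frame defined by the trivialization
around `x`. -/
lemma exists_frame_extension [T2Space M] (x : M) {ι : Type*} (b : ι → G) :
    ∃ s : ι → Cₛ^∞⟮𝓡 n; G, W⟯, ∀ᶠ y in 𝓝 x, ∀ i,
      s i y = (trivializationAt G W x).symmL ℝ y (b i) := by
  have hu := (trivializationAt G W x).open_baseSet
  obtain ⟨ψ, hψ, hψ'⟩ := exists_bump (n := n) x
    (hu.mem_nhds (FiberBundle.mem_baseSet_trivializationAt' x))
  refine ⟨fun i ↦ ⟨fun y ↦ ψ y • (trivializationAt G W x).symmL ℝ y (b i),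
    ContMDiffOn.smul_section_of_tsupport ψ.contMDiff.contMDiffOn hu hψ'
      (contMDiffOn_symmL_const G W x (b i))⟩, ?_⟩
  filter_upwards [hψ] with y hy i
  change ψ y • (trivializationAt G W x).symmL ℝ y (b i) = _
  rw [hy, one_smul]

lemma exists_section_eq [T2Space M] (x : M) (v : W x) : ∃ s : Cₛ^∞⟮𝓡 n; G, W⟯, s x = v := by
  obtain ⟨s, hs⟩ := exists_frame_extension (n := n) G W x
    (fun _ : Unit ↦ (trivializationAt G W x).continuousLinearMapAt ℝ x v)
  refine ⟨s (), ?_⟩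
  rw [hs.self_of_nhds ()]
  exact Trivialization.symmL_continuousLinearMapAt _
    (FiberBundle.mem_baseSet_trivializationAt' x) v

lemma contMDiffOn_coord (x : M) (l : G →L[ℝ] ℝ) (s : Cₛ^∞⟮𝓡 n; G, W⟯) :
    ContMDiffOn (𝓡 n) 𝓘(ℝ, ℝ) ∞
      (fun y ↦ l ((trivializationAt G W x).continuousLinearMapAt ℝ y (s y)))
      (trivializationAt G W x).baseSet := by
  have h : ContMDiffOn (𝓡 n) 𝓘(ℝ, G) ∞
      (fun y ↦ (trivializationAt G W x ⟨y, s y⟩).2) (trivializationAt G W x).baseSet :=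
    (Trivialization.contMDiffOn_section_baseSet_iff _).1 s.contMDiff.contMDiffOn
  exact (l.contMDiff.comp_contMDiffOn h).congr fun y hy ↦
    congrArg l (Trivialization.continuousLinearMapAt_apply_of_mem (R := ℝ) _ hy _)

/-- A smooth section that vanishes at `x` is a combination of smooth sections whose coefficients
vanish at `x`. -/
lemma exists_eq_sum_of_apply_eq_zero [T2Space M] (x : M) (s : Cₛ^∞⟮𝓡 n; G, W⟯) (hs : s x = 0) :
    ∃ (f : Option (Fin (Module.finrank ℝ G)) → C^∞⟮𝓡 n, M; 𝓘(ℝ, ℝ), ℝ⟯)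
      (t : Option (Fin (Module.finrank ℝ G)) → Cₛ^∞⟮𝓡 n; G, W⟯),
      (∀ i, f i x = 0) ∧ s = ∑ i, mulSec (f i) (t i) := by
  set e := trivializationAt G W x
  have hu := e.open_baseSet
  obtain ⟨ψ, hψ, hψ'⟩ := exists_bump (n := n) x
    (hu.mem_nhds (FiberBundle.mem_baseSet_trivializationAt' x))
  have hc : ∀ α, ContMDiff (𝓡 n) 𝓘(ℝ, ℝ) ∞ fun y ↦
      ψ y • LinearMap.toContinuousLinearMap ((Module.finBasis ℝ G).coord α)
        (e.continuousLinearMapAt ℝ y (s y)) := fun α ↦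
    contMDiff_of_tsupport fun y hy ↦
      ψ.contMDiff.contMDiffAt.smul ((contMDiffOn_coord x _ s).contMDiffAt
        (hu.mem_nhds (hψ' (tsupport_smul_subset_left _ _ hy))))
  -- The decomposition is `s = (1 - ψ²) s + ∑ (ψ s^α)(ψ a_α)`. One factor `ψ` makes the coefficients
  -- global and the other makes the frame global, which is why the square appears.
  refine ⟨fun i ↦ i.elim ⟨fun y ↦ 1 - ψ y * ψ y, contMDiff_const.sub
      (ψ.contMDiff.mul ψ.contMDiff)⟩ fun α ↦ ⟨_, hc α⟩,
    fun i ↦ i.elim s fun α ↦ ⟨fun y ↦ ψ y • e.symmL ℝ y (Module.finBasis ℝ G α),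
    ContMDiffOn.smul_section_of_tsupport ψ.contMDiff.contMDiffOn hu hψ'
      (contMDiffOn_symmL_const G W x _)⟩, ?_, ?_⟩
  · rintro (_ | α)
    · change 1 - ψ x * ψ x = 0
      rw [hψ.self_of_nhds]; norm_num
    · change ψ x • (Module.finBasis ℝ G).repr (e.continuousLinearMapAt ℝ x (s x)) α = 0
      rw [hs]; simp
  · ext y
    rw [Fintype.sum_option]
    have hsum : ((∑ i, mulSec (W := W) (G := G) (⟨_, hc i⟩ : C^∞⟮𝓡 n, M; 𝓘(ℝ, ℝ), ℝ⟯)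
        ⟨fun y ↦ ψ y • e.symmL ℝ y (Module.finBasis ℝ G i),
          ContMDiffOn.smul_section_of_tsupport ψ.contMDiff.contMDiffOn hu hψ'
            (contMDiffOn_symmL_const G W x _)⟩ : Cₛ^∞⟮𝓡 n; G, W⟯) y) = (ψ y * ψ y) • s y := by
      refine (sum_mulSec_apply _ _ y).trans ?_
      by_cases hy : y ∈ e.baseSet
      · conv_rhs => rw [← e.symmL_continuousLinearMapAt (R := ℝ) hy (s y),
          ← (Module.finBasis ℝ G).sum_repr (e.continuousLinearMapAt ℝ y (s y)), map_sum,
          Finset.smul_sum]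
        refine Finset.sum_congr rfl fun α _ ↦ ?_
        change (ψ y • (Module.finBasis ℝ G).repr (e.continuousLinearMapAt ℝ y (s y)) α) •
          ψ y • e.symmL ℝ y (Module.finBasis ℝ G α) = _
        rw [map_smul, smul_smul, smul_smul, smul_eq_mul]
        congr 1; ring
      · have : ψ y = 0 := image_eq_zero_of_notMem_tsupport fun h ↦ hy (hψ' h)
        rw [this, mul_zero, zero_smul]
        refine Finset.sum_eq_zero fun α _ ↦ ?_
        change (ψ y • (Module.finBasis ℝ G).repr (e.continuousLinearMapAt ℝ y (s y)) α) •
          ψ y • e.symmL ℝ y (Module.finBasis ℝ G α) = _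
        rw [this, zero_smul, zero_smul]
    refine Eq.trans ?_ (congrArg (fun z ↦ (1 - ψ y * ψ y) • s y + z) hsum).symm
    simp [sub_smul]

end Sections

/-! ### Sections of `L` and `L*` -/

section Dual

open Filter Topology

variable {n : ℕ} {M : Type*} [TopologicalSpace M] [ChartedSpace (EuclideanSpace ℝ (Fin n)) M]
  [IsManifold (𝓡 n) ∞ M]
variable {F : Type*} [NormedAddCommGroup F] [NormedSpace ℝ F] [FiniteDimensional ℝ F]
variable {L : M → Type*} [∀ x, AddCommGroup (L x)] [∀ x, Module ℝ (L x)]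
  [∀ x, TopologicalSpace (L x)] [TopologicalSpace (TotalSpace F L)]
  [∀ x, IsTopologicalAddGroup (L x)] [∀ x, ContinuousSMul ℝ (L x)]
  [FiberBundle F L] [VectorBundle ℝ F L] [ContMDiffVectorBundle ∞ F L (𝓡 n)]

lemma contMDiff_dual_apply (ξ : SecDual (n := n) F L) (s : SecL (n := n) F L) :
    ContMDiff (𝓡 n) 𝓘(ℝ, ℝ) ∞ fun x ↦ ξ x (s x) := by
  have h := ContMDiff.clm_bundle_apply (E₂ := fun _ : M ↦ ℝ) ξ.contMDiff s.contMDiff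
  intro x
  exact (contMDiffAt_section x).1 (h x)

/-- A family of covectors that is smooth on smooth sections is a smooth section of `L*`. -/
lemma exists_secDual [T2Space M] (ξ : ∀ x, L x →L[ℝ] ℝ)
    (hξ : ∀ s : SecL (n := n) F L, ContMDiff (𝓡 n) 𝓘(ℝ, ℝ) ∞ fun x ↦ ξ x (s x)) :
    ∃ ζ : SecDual (n := n) F L, ∀ x, ζ x = ξ x := by
  refine ⟨⟨ξ, fun x ↦ ?_⟩, fun x ↦ rfl⟩
  rw [contMDiffAt_hom_bundle]
  refine ⟨contMDiffAt_id, ?_⟩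
  -- Near `x`, the local representative of `ξ` is the combination of the coordinate functionals with
  -- coefficients `ξ(s_α)`, which are smooth by hypothesis.
  obtain ⟨s, hs⟩ := exists_frame_extension (n := n) F L x (Module.finBasis ℝ F)
  have h : ContMDiffAt (𝓡 n) 𝓘(ℝ, F →L[ℝ] ℝ) ∞ (fun y ↦ ∑ α, ξ y (s α y) •
      LinearMap.toContinuousLinearMap ((Module.finBasis ℝ F).coord α)) x :=
    ContMDiffAt.sum fun α _ ↦ (hξ (s α)).contMDiffAt.smul contMDiffAt_const
  refine h.congr_of_eventuallyEq ?_
  filter_upwards [hs] with y hy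
  refine ContinuousLinearMap.coe_injective ((Module.finBasis ℝ F).ext fun β ↦ ?_)
  simp [ContinuousLinearMap.inCoordinates, hy, Finsupp.single_apply]

lemma extL_apply [T2Space M] (x : M) (v : L x) : extL (n := n) F L x v x = v :=
  Classical.epsilon_spec (exists_section_eq (n := n) (G := F) x v)

lemma extDual_apply [T2Space M] (x : M) (ξ : L x →L[ℝ] ℝ) : extDual (n := n) F L x ξ x = ξ :=
  Classical.epsilon_spec (p := fun s : SecDual (n := n) F L ↦ s x = ξ)
    (exists_section_eq (n := n) (G := F →L[ℝ] ℝ) (W := fun x ↦ L x →L[ℝ] ℝ) x ξ)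

lemma sum_coframeL_smul_frameL (x : M) (v : L x) :
    ∑ α, coframeL F L x α v • frameL F L x α x = v := by
  have hx : x ∈ (trivializationAt F L x).baseSet := FiberBundle.mem_baseSet_trivializationAt' x
  conv_rhs => rw [← (trivializationAt F L x).symmL_continuousLinearMapAt (R := ℝ) hx v,
    ← (Module.finBasis ℝ F).sum_repr ((trivializationAt F L x).continuousLinearMapAt ℝ x v),
    map_sum]
  simp only [map_smul]
  rfl

lemma coframeL_frameL (x : M) (α β : Fin (Module.finrank ℝ F)) :
    coframeL F L x α (frameL F L x β x) = if β = α then 1 else 0 := by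
  have hx : x ∈ (trivializationAt F L x).baseSet := FiberBundle.mem_baseSet_trivializationAt' x
  simp [coframeL, frameL, Trivialization.continuousLinearMapAt_symmL _ hx, Finsupp.single_apply]

lemma finiteDimensional_fibre (F : Type*) [NormedAddCommGroup F] [NormedSpace ℝ F]
    [FiniteDimensional ℝ F] [TopologicalSpace (TotalSpace F L)]
    [FiberBundle F L] [VectorBundle ℝ F L] (x : M) : FiniteDimensional ℝ (L x) :=
  ((trivializationAt F L x).continuousLinearEquivAt ℝ x
    (FiberBundle.mem_baseSet_trivializationAt' x)).symm.toLinearEquiv.finiteDimensional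

lemma continuous_fibre (F : Type*) [NormedAddCommGroup F] [NormedSpace ℝ F]
    [FiniteDimensional ℝ F] [TopologicalSpace (TotalSpace F L)]
    [FiberBundle F L] [VectorBundle ℝ F L] (x : M) (l : L x →ₗ[ℝ] ℝ) : Continuous l := by
  set e := (trivializationAt F L x).continuousLinearEquivAt ℝ x
    (FiberBundle.mem_baseSet_trivializationAt' x)
  have h : Continuous (l ∘ₗ e.symm.toLinearMap) := LinearMap.continuous_of_finiteDimensional _
  convert h.comp e.continuous using 1
  ext v
  simp

end Dual

/-! ### Derivatives of functions along vector fields -/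

section DirDeriv

variable {n : ℕ} {M : Type*} [TopologicalSpace M] [ChartedSpace (EuclideanSpace ℝ (Fin n)) M]
  [IsManifold (𝓡 n) ∞ M]

lemma contMDiff_dirDeriv {f : M → ℝ} (hf : ContMDiff (𝓡 n) 𝓘(ℝ, ℝ) ∞ f)
    {X : ∀ x : M, TangentSpace (𝓡 n) x}
    (hX : ContMDiff (𝓡 n) (𝓡 n).tangent ∞ (fun x ↦ (⟨x, X x⟩ : TangentBundle (𝓡 n) M))) :
    ContMDiff (𝓡 n) 𝓘(ℝ, ℝ) ∞ fun x ↦ dirDeriv f x (X x) := by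
  have h := (hf.contMDiff_tangentMap (m := ∞) (by simp)).comp hX
  exact (contMDiff_snd_tangentBundle_modelSpace ℝ 𝓘(ℝ, ℝ)).comp h

lemma dirDeriv_add {f g : M → ℝ} {x : M} (hf : MDifferentiableAt (𝓡 n) 𝓘(ℝ, ℝ) f x)
    (hg : MDifferentiableAt (𝓡 n) 𝓘(ℝ, ℝ) g x) (v : TangentSpace (𝓡 n) x) :
    dirDeriv (fun y ↦ f y + g y) x v = dirDeriv f x v + dirDeriv g x v := by
  have := (hf.hasMFDerivAt.add hg.hasMFDerivAt).mfderiv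
  exact congrArg (fun l ↦ l v) this

lemma dirDeriv_mul {f g : M → ℝ} {x : M} (hf : MDifferentiableAt (𝓡 n) 𝓘(ℝ, ℝ) f x)
    (hg : MDifferentiableAt (𝓡 n) 𝓘(ℝ, ℝ) g x) (v : TangentSpace (𝓡 n) x) :
    dirDeriv (fun y ↦ f y * g y) x v = f x * dirDeriv g x v + dirDeriv f x v * g x := by
  have := (hf.hasMFDerivAt.mul hg.hasMFDerivAt).mfderiv
  refine (congrArg (fun l ↦ l v) this).trans ?_
  change f x * dirDeriv g x v + g x * dirDeriv f x v = _
  ring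

lemma dirDeriv_const (c : ℝ) (x : M) (v : TangentSpace (𝓡 n) x) :
    dirDeriv (fun _ ↦ c) x v = 0 := by
  have := mfderiv_const (I := 𝓡 n) (I' := 𝓘(ℝ, ℝ)) (c := c) (x := x)
  exact congrArg (fun l ↦ l v) this

lemma dirDeriv_congr {f g : M → ℝ} {x : M} (h : f =ᶠ[nhds x] g) (v : TangentSpace (𝓡 n) x) :
    dirDeriv f x v = dirDeriv g x v := by
  exact congrArg (fun l ↦ l v) (h.mfderiv_eq (I := 𝓡 n) (I' := 𝓘(ℝ, ℝ)))

lemma dirDeriv_map_add (f : M → ℝ) (x : M) (v w : TangentSpace (𝓡 n) x) :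
    dirDeriv f x (v + w) = dirDeriv f x v + dirDeriv f x w := map_add _ v w

lemma dirDeriv_map_smul (f : M → ℝ) (x : M) (c : ℝ) (v : TangentSpace (𝓡 n) x) :
    dirDeriv f x (c • v) = c * dirDeriv f x v := map_smul (mfderiv (𝓡 n) 𝓘(ℝ, ℝ) f x) c v

end DirDeriv

/-! ### Component-wise derivatives of curves -/

section Curve

open Filter Topology

variable {V W X : Type*} [AddCommGroup V] [Module ℝ V] [AddCommGroup W] [Module ℝ W]
  [AddCommGroup X] [Module ℝ X]

/-- The curve `f` has the component-wise derivative `v` at `0`. -/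
def HasCurveDeriv (f : ℝ → V) (v : V) : Prop :=
  ∀ l : Module.Dual ℝ V, HasDerivAt (fun t ↦ l (f t)) (l v) 0

namespace HasCurveDeriv

variable {f g : ℝ → V} {v w : V}

/-- Linear functionals on a real vector space separate points, so no topology is needed for the
value of `curveDeriv` to be determined. -/
lemma unique (hv : HasCurveDeriv f v) (hw : HasCurveDeriv f w) : v = w := by
  rw [← sub_eq_zero, ← Module.forall_dual_apply_eq_zero_iff ℝ]
  intro l
  rw [map_sub, (hv l).unique (hw l), sub_self]

lemma curveDeriv_eq (h : HasCurveDeriv f v) : curveDeriv f = v := by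
  have hex : ∃ v : V, ∀ l : Module.Dual ℝ V, HasDerivAt (fun t ↦ l (f t)) (l v) 0 := ⟨v, h⟩
  rw [curveDeriv, dif_pos hex]
  exact unique (f := f) hex.choose_spec h

lemma congr (h : HasCurveDeriv f v) (hfg : g =ᶠ[𝓝 0] f) : HasCurveDeriv g v := fun l ↦
  (h l).congr_of_eventuallyEq (hfg.mono fun _ ht ↦ congrArg l ht)

lemma add (hf : HasCurveDeriv f v) (hg : HasCurveDeriv g w) :
    HasCurveDeriv (fun t ↦ f t + g t) (v + w) := fun l ↦ by
  simp only [map_add]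
  exact (hf l).add (hg l)

lemma const_smul (c : ℝ) (hf : HasCurveDeriv f v) : HasCurveDeriv (fun t ↦ c • f t) (c • v) :=
  fun l ↦ by
    simp only [map_smul]
    exact (hf l).const_smul c

lemma const (v : V) : HasCurveDeriv (fun _ ↦ v) 0 := fun l ↦ by
  simpa only [map_zero] using hasDerivAt_const (0 : ℝ) (l v)

lemma smul_const {c : ℝ → ℝ} {c' : ℝ} (hc : HasDerivAt c c' 0) (v : V) :
    HasCurveDeriv (fun t ↦ c t • v) (c' • v) := fun l ↦ by
  simpa only [map_smul, smul_eq_mul] using hc.mul_const (l v)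

lemma sum {ι : Type*} {s : Finset ι} {f : ι → ℝ → V} {v : ι → V}
    (h : ∀ i ∈ s, HasCurveDeriv (f i) (v i)) :
    HasCurveDeriv (fun t ↦ ∑ i ∈ s, f i t) (∑ i ∈ s, v i) := fun l ↦ by
  simpa only [map_sum] using HasDerivAt.fun_sum fun i hi ↦ h i hi l

/-- Expanding only the first argument in a finite basis reduces the bilinear case to products of
scalar functions, because every `l ∘ B(b_i)` is again a linear functional. The second space may have
any dimension. -/
lemma map₂ [FiniteDimensional ℝ V] (B : V →ₗ[ℝ] W →ₗ[ℝ] X) {g : ℝ → W} {w : W}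
    (hf : HasCurveDeriv f v) (hg : HasCurveDeriv g w) :
    HasCurveDeriv (fun t ↦ B (f t) (g t)) (B v (g 0) + B (f 0) w) := fun l ↦ by
  set b := Module.finBasis ℝ V
  have key : ∀ (y : V) (z : W), l (B y z) = ∑ i, b.coord i y * (l ∘ₗ B (b i)) z := by
    intro y z
    conv_lhs => rw [← b.sum_repr y, map_sum, LinearMap.sum_apply, map_sum]
    simp only [map_smul, LinearMap.smul_apply, smul_eq_mul]
    rfl
  have h := HasDerivAt.fun_sum (u := Finset.univ) fun i _ ↦
    (hf (b.coord i)).mul (hg (l ∘ₗ B (b i)))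
  simp only [map_add, key, ← Finset.sum_add_distrib]
  exact h

end HasCurveDeriv

lemma curveDeriv_affine (a b : V) : curveDeriv (fun t : ℝ ↦ a + t • b) = b := by
  refine HasCurveDeriv.curveDeriv_eq ?_
  simpa using (HasCurveDeriv.const a).add (HasCurveDeriv.smul_const (hasDerivAt_id (0 : ℝ)) b)

end Curve

section Forms

open Filter Topology

variable {n : ℕ} {M : Type*} [TopologicalSpace M] [ChartedSpace (EuclideanSpace ℝ (Fin n)) M]
  [IsManifold (𝓡 n) ∞ M]
variable {F : Type*} [NormedAddCommGroup F] [NormedSpace ℝ F] [FiniteDimensional ℝ F]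
variable {L : M → Type*} [∀ x, AddCommGroup (L x)] [∀ x, Module ℝ (L x)]
  [∀ x, TopologicalSpace (L x)] [TopologicalSpace (TotalSpace F L)]
  [∀ x, IsTopologicalAddGroup (L x)] [∀ x, ContinuousSMul ℝ (L x)]
  [FiberBundle F L] [VectorBundle ℝ F L] [ContMDiffVectorBundle ∞ F L (𝓡 n)]

/-! ### Coordinate curves -/

lemma coordCurve_zero (x : M) (i : Fin n) : coordCurve x i 0 = x := by
  simp [coordCurve]

lemma continuousAt_coordCurve (x : M) (i : Fin n) :
    ContinuousAt (coordCurve (n := n) x i) 0 := by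
  refine ContinuousAt.comp (g := (extChartAt (𝓡 n) x).symm) ?_ (by fun_prop)
  simpa using continuousAt_extChartAt_symm (I := 𝓡 n) x

lemma tendsto_coordCurve (x : M) (i : Fin n) :
    Tendsto (coordCurve (n := n) x i) (𝓝 0) (𝓝 x) := by
  have := continuousAt_coordCurve (n := n) x i
  rwa [ContinuousAt, coordCurve_zero] at this

/-- In the chart around `x` the curve is a straight line and the manifold derivative at `x` is the
derivative of the chart expression, so the chain rule of calculus applies. -/
lemma hasDerivAt_comp_coordCurve {g : M → ℝ} {x : M}
    (hg : MDifferentiableAt (𝓡 n) 𝓘(ℝ, ℝ) g x) (i : Fin n) :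
    HasDerivAt (fun t ↦ g (coordCurve x i t)) (dirDeriv g x (coordVec x i)) 0 := by
  have h := hg.hasMFDerivAt.2
  simp only [writtenInExtChartAt, extChartAt_model_space_eq_id, PartialEquiv.refl_coe,
    Function.id_comp, modelWithCornersSelf_coe, Set.range_id] at h
  have hc : HasDerivAt (fun t : ℝ ↦ extChartAt (𝓡 n) x x +
      t • (EuclideanSpace.single i (1 : ℝ) : EuclideanSpace ℝ (Fin n)))
      (EuclideanSpace.single i (1 : ℝ)) 0 := by
    simpa using ((hasDerivAt_id (0 : ℝ)).smul_const
      (EuclideanSpace.single i (1 : ℝ) : EuclideanSpace ℝ (Fin n))).const_add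
        (extChartAt (𝓡 n) x x)
  have h' : HasFDerivAt (g ∘ (extChartAt (𝓡 n) x).symm) (mfderiv (𝓡 n) 𝓘(ℝ, ℝ) g x)
      (extChartAt (𝓡 n) x x + (0 : ℝ) •
        (EuclideanSpace.single i (1 : ℝ) : EuclideanSpace ℝ (Fin n))) := by
    rw [zero_smul, add_zero]; exact hasFDerivWithinAt_univ.1 h
  exact h'.comp_hasDerivAt (0 : ℝ) hc

lemma sum_coordForm_smul_coordVec (x : M) (v : TangentSpace (𝓡 n) x) :
    ∑ i, coordForm x i v • coordVec x i = v := by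
  have h := (EuclideanSpace.basisFun (Fin n) ℝ).sum_repr (v : EuclideanSpace ℝ (Fin n))
  simp only [EuclideanSpace.basisFun_apply] at h
  exact h

/-! ### Parallel transport along the local frame -/

lemma transL_frameL (x y : M) (α : Fin (Module.finrank ℝ F)) :
    transL F x x y (frameL F L x α x) = frameL F L x α y := by
  have hx : x ∈ (trivializationAt F L x).baseSet := FiberBundle.mem_baseSet_trivializationAt' x
  exact congrArg _ (Trivialization.continuousLinearMapAt_symmL (R := ℝ) _ hx _)

lemma transL_self (x : M) (v : L x) : transL F x x x v = v :=
  Trivialization.symmL_continuousLinearMapAt (R := ℝ) _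
    (FiberBundle.mem_baseSet_trivializationAt' x) v

lemma transL_transL (x : M) {y : M} (hy : y ∈ (trivializationAt F L x).baseSet) (v : L y) :
    transL F x x y (transL F x y x v) = v := by
  have hx : x ∈ (trivializationAt F L x).baseSet := FiberBundle.mem_baseSet_trivializationAt' x
  refine (congrArg _ (Trivialization.continuousLinearMapAt_symmL (R := ℝ) _ hx _)).trans ?_
  exact Trivialization.symmL_continuousLinearMapAt (R := ℝ) _ hy v

/-- Contraction is natural: both sides obey the same recursion for multiplication by a vector. It
lets interior products be moved through the transport of fibres. -/
lemma map_contractLeft {V V' : Type*} [AddCommGroup V] [Module ℝ V] [AddCommGroup V'] [Module ℝ V']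
    (f : V →ₗ[ℝ] V') (d : Module.Dual ℝ V') (a : ExteriorAlgebra ℝ V) :
    ExteriorAlgebra.map f
        (CliffordAlgebra.contractLeft (Q := (0 : QuadraticForm ℝ V)) (d ∘ₗ f) a)
      = CliffordAlgebra.contractLeft (Q := (0 : QuadraticForm ℝ V')) d
        (ExteriorAlgebra.map f a) := by
  induction a using CliffordAlgebra.left_induction with
  | algebraMap r =>
    simp only [CliffordAlgebra.contractLeft_algebraMap, AlgHom.commutes, map_zero]
  | add a b ha hb => simp only [map_add, ha, hb]
  | ι_mul a m ih =>
    have h1 : ExteriorAlgebra.map f (CliffordAlgebra.ι (0 : QuadraticForm ℝ V) m * a)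
        = CliffordAlgebra.ι (0 : QuadraticForm ℝ V') (f m) * ExteriorAlgebra.map f a := by
      rw [map_mul]; congr 1; exact ExteriorAlgebra.map_apply_ι f m
    rw [h1, CliffordAlgebra.contractLeft_ι_mul, CliffordAlgebra.contractLeft_ι_mul, map_sub,
      map_smul, map_mul, ih]
    congr 2
    exact ExteriorAlgebra.map_apply_ι f m

lemma transGr_contr (x y : M) (w : L x) (θ : GrE L y) :
    transGr F x y (contr (transL F x x y w) θ) = contr w (transGr F x y θ) :=
  map_contractLeft _ (vecDual w) θ

lemma evalForm_transGr (x y : M) {k : ℕ} (v : Fin k → L x) (θ : GrE L y) :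
    evalForm v (transGr F x y θ) = evalForm (fun i ↦ transL F x x y (v i)) θ := by
  induction k generalizing θ with
  | zero =>
    rw [evalForm_zero, evalForm_zero, transGr]
    have : (ExteriorAlgebra.algebraMapInv (R := ℝ) (M := Dbl L x)).comp (transGr F x y)
        = ExteriorAlgebra.algebraMapInv := by
      ext v <;> simp [transGr, ExteriorAlgebra.algebraMapInv]
    exact DFunLike.congr_fun this θ
  | succ k ih => rw [evalForm_succ, evalForm_succ, ← transGr_contr, ih]

lemma transGr_self (x : M) (θ : GrE L x) : transGr F x x θ = θ := by
  have : transGr F x x = AlgHom.id ℝ (GrE L x) := by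
    rw [transGr, ← ExteriorAlgebra.map_id]
    congr 1
    refine LinearMap.ext fun e ↦ Prod.ext (transL_self x e.1) ?_
    ext v
    exact congrArg e.2 (transL_self x v)
  rw [this]; rfl

lemma transGr_covec (x y : M) (ξ : L y →L[ℝ] ℝ) :
    transGr F x y (covec ξ) = covec (ξ.comp (transL F x x y)) := by
  refine (ExteriorAlgebra.map_apply_ι _ _).trans ?_
  simp only [covec, LinearMap.coe_comp, Function.comp_apply, LinearMap.inr_apply,
    LinearMap.prodMap_apply, map_zero]
  rfl

lemma transGr_mem (x y : M) {k : ℕ} {θ : GrE L y} (hθ : θ ∈ dualPower L k y) :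
    transGr F x y θ ∈ dualPower L k x := by
  refine dualPower_induction (p := fun θ ↦ transGr F x y θ ∈ dualPower L k x) ?_ ?_ ?_ ?_ hθ
  · simp
  · intro a b ha hb; rw [map_add]; exact add_mem ha hb
  · intro c a ha; rw [map_smul]; exact Submodule.smul_mem _ c ha
  · intro ξ
    rw [map_list_prod, List.map_ofFn, dualPower_eq_span]
    exact Submodule.subset_span ⟨fun i ↦ (ξ i).comp (transL F x x y), by
      simp [Function.comp_def, transGr_covec]⟩

/-! ### Forms -/

/-- The components of a smooth form with respect to smooth sections are smooth. -/
lemma contMDiff_evalForm {k : ℕ} {θ : SecGr L} (hθ : θ ∈ forms n F L k)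
    (s : Fin k → SecL (n := n) F L) :
    ContMDiff (𝓡 n) 𝓘(ℝ, ℝ) ∞ fun x ↦ evalForm (fun i ↦ s i x) (θ x) := hθ.2 s

lemma mdifferentiable_evalForm {k : ℕ} {θ : SecGr L} (hθ : θ ∈ forms n F L k)
    (s : Fin k → SecL (n := n) F L) (x : M) :
    MDifferentiableAt (𝓡 n) 𝓘(ℝ, ℝ) (fun x ↦ evalForm (fun i ↦ s i x) (θ x)) x :=
  (contMDiff_evalForm hθ s).contMDiffAt.mdifferentiableAt (by simp)

lemma allForms_induction {p : SecGr L → Prop} (mem : ∀ k, ∀ θ ∈ forms n F L k, p θ)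
    (add : ∀ θ θ', θ ∈ allForms n F L → θ' ∈ allForms n F L → p θ → p θ' → p (θ + θ'))
    {θ : SecGr L} (hθ : θ ∈ allForms n F L) : p θ := by
  refine (Submodule.iSup_induction' (forms n F L) (motive := fun θ _ ↦ p θ) mem
    (mem 0 0 (zero_mem _)) ?_ hθ)
  exact fun a b ha hb hpa hpb ↦ add a b ha hb hpa hpb

lemma mem_allForms {k : ℕ} {θ : SecGr L} (hθ : θ ∈ forms n F L k) : θ ∈ allForms n F L :=
  Submodule.mem_iSup_of_mem k hθ

/-- The interior product of a form with a section of `L`. -/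
def contrSec (s : SecL (n := n) F L) (θ : SecGr L) : SecGr L := fun x ↦ contr (s x) (θ x)

lemma contrSec_mem_forms (s : SecL (n := n) F L) {k : ℕ} {θ : SecGr L}
    (hθ : θ ∈ forms n F L (k + 1)) : contrSec s θ ∈ forms n F L k := by
  refine ⟨fun x ↦ contr_mem _ (hθ.1 x), fun t ↦ ?_⟩
  have h := contMDiff_evalForm hθ (Fin.cons s t)
  simp only [evalForm_succ, Fin.cons_zero, Fin.cons_succ] at h
  exact h

lemma contrSec_of_forms_zero (s : SecL (n := n) F L) {θ : SecGr L} (hθ : θ ∈ forms n F L 0) :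
    contrSec s θ = 0 :=
  funext fun x ↦ contr_eq_zero (hθ.1 x) _

lemma contrSec_mem_allForms (s : SecL (n := n) F L) {θ : SecGr L} (hθ : θ ∈ allForms n F L) :
    contrSec s θ ∈ allForms n F L := by
  refine allForms_induction (p := fun θ ↦ contrSec s θ ∈ allForms n F L) ?_ ?_ hθ
  · rintro (_ | k) θ hθ
    · rw [contrSec_of_forms_zero s hθ]; exact zero_mem _
    · exact mem_allForms (contrSec_mem_forms s hθ)
  · intro θ θ' _ _ h h'
    have : contrSec s (θ + θ') = contrSec s θ + contrSec s θ' := funext fun x ↦ map_add _ _ _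
    rw [this]; exact add_mem h h'

lemma intL_covecDual_of_mem_allForms {θ : SecGr L} (hθ : θ ∈ allForms n F L) {x : M}
    (ξ : L x →L[ℝ] ℝ) : intL (covecDual ξ) (θ x) = 0 := by
  refine allForms_induction (p := fun θ ↦ intL (covecDual ξ) (θ x) = 0) ?_ ?_ hθ
  · exact fun k θ hθ ↦ intL_covecDual_of_mem ξ (hθ.1 x)
  · intro θ θ' _ _ h h'; rw [Pi.add_apply, map_add, h, h', add_zero]

lemma finiteDimensional_grE (F : Type*) [NormedAddCommGroup F] [NormedSpace ℝ F]
    [FiniteDimensional ℝ F] [TopologicalSpace (TotalSpace F L)]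
    [FiberBundle F L] [VectorBundle ℝ F L] (x : M) : FiniteDimensional ℝ (GrE L x) := by
  have h1 := finiteDimensional_fibre (L := L) F x
  have h2 : FiniteDimensional ℝ (L x →L[ℝ] ℝ) :=
    FiniteDimensional.of_injective (ContinuousLinearMap.coeLM ℝ : (L x →L[ℝ] ℝ) →ₗ[ℝ] _)
      ContinuousLinearMap.coe_injective
  exact (Module.finBasis ℝ (Dbl L x)).ExteriorAlgebra.finiteDimensional_of_finite

/-! ### Partial derivatives of forms in a local frame -/

/-- The curve of the values of `θ` along a coordinate line, moved to the fibre at `x`. -/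
def transCurve (F : Type*) [NormedAddCommGroup F] [NormedSpace ℝ F]
    [TopologicalSpace (TotalSpace F L)] [FiberBundle F L] [VectorBundle ℝ F L]
    (θ : SecGr L) (x : M) (i : Fin n) (t : ℝ) : GrE L x :=
  transGr F x (coordCurve x i t) (θ (coordCurve x i t))

/-- The partial derivative of the components of `θ` in the local frame. -/
def partialGr (F : Type*) [NormedAddCommGroup F] [NormedSpace ℝ F]
    [TopologicalSpace (TotalSpace F L)] [FiberBundle F L] [VectorBundle ℝ F L]
    (θ : SecGr L) (x : M) (i : Fin n) : GrE L x := curveDeriv (transCurve F θ x i)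

lemma transCurve_zero (θ : SecGr L) (x : M) (i : Fin n) : transCurve F θ x i 0 = θ x := by
  have h : ∀ y : M, y = x → transGr F x y (θ y) = θ x := by
    rintro y rfl; exact transGr_self y (θ y)
  exact h _ (coordCurve_zero x i)

/-- Written in the coframe at `x`, the transported form has as coefficients its values on the local
frame. Near `x` these are values on global smooth sections, hence differentiable along the
coordinate line. -/
lemma exists_hasCurveDeriv_of_forms [T2Space M] {k : ℕ} {θ : SecGr L} (hθ : θ ∈ forms n F L k)
    (x : M) (i : Fin n) :
    ∃ v ∈ dualPower L k x, HasCurveDeriv (transCurve F θ x i) v := by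
  obtain ⟨s, hs⟩ := exists_frame_extension (n := n) F L x (Module.finBasis ℝ F)
  have hk : (k.factorial : ℝ) ≠ 0 := by exact_mod_cast k.factorial_ne_zero
  refine ⟨_, ?_, HasCurveDeriv.congr (HasCurveDeriv.const_smul (k.factorial : ℝ)⁻¹
    (HasCurveDeriv.sum (s := Finset.univ) fun (α : Fin k → Fin (Module.finrank ℝ F)) _ ↦
      HasCurveDeriv.smul_const (hasDerivAt_comp_coordCurve
        (mdifferentiable_evalForm hθ (fun j ↦ s (α j)) x) i)
        (List.ofFn fun j ↦ (covec (coframeL F L x (α j)) : GrE L x)).prod)) ?_⟩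
  · refine Submodule.smul_mem _ _ (Submodule.sum_mem _ fun α _ ↦ Submodule.smul_mem _ _ ?_)
    rw [dualPower_eq_span]
    exact Submodule.subset_span ⟨_, rfl⟩
  · filter_upwards [(tendsto_coordCurve (n := n) x i).eventually hs] with t ht
    rw [eq_inv_smul_iff₀ hk]
    change _ • transGr F x _ _ = _
    rw [← sum_evalForm_smul (sum_coframeL_smul_frameL (F := F) x)
      (transGr_mem x _ (hθ.1 _))]
    refine Finset.sum_congr rfl fun α _ ↦ ?_
    rw [evalForm_transGr]
    simp only [transL_frameL, ht]
    rfl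

lemma partialGr_mem [T2Space M] {k : ℕ} {θ : SecGr L} (hθ : θ ∈ forms n F L k)
    (x : M) (i : Fin n) : partialGr F θ x i ∈ dualPower L k x := by
  obtain ⟨v, hv, h⟩ := exists_hasCurveDeriv_of_forms hθ x i
  rw [partialGr, h.curveDeriv_eq]
  exact hv

lemma transCurve_add (θ θ' : SecGr L) (x : M) (i : Fin n) :
    transCurve F (θ + θ') x i = fun t ↦ transCurve F θ x i t + transCurve F θ' x i t :=
  funext fun _ ↦ map_add _ _ _

lemma transCurve_smul (c : ℝ) (θ : SecGr L) (x : M) (i : Fin n) :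
    transCurve F (c • θ) x i = fun t ↦ c • transCurve F θ x i t :=
  funext fun t ↦ map_smul (transGr F x (coordCurve x i t)) c _

lemma transCurve_mul (θ θ' : SecGr L) (x : M) (i : Fin n) :
    transCurve F (θ * θ') x i = fun t ↦ transCurve F θ x i t * transCurve F θ' x i t :=
  funext fun _ ↦ map_mul _ _ _

/-- `curveDeriv` has the default value zero when no derivative exists. For smooth forms the
derivative does exist, and the rules for sums and products then become available. -/
lemma hasCurveDeriv_partialGr [T2Space M] {θ : SecGr L} (hθ : θ ∈ allForms n F L)
    (x : M) (i : Fin n) : HasCurveDeriv (transCurve F θ x i) (partialGr F θ x i) := by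
  have : ∃ v, HasCurveDeriv (transCurve F θ x i) v := by
    refine allForms_induction (p := fun θ ↦ ∃ v, HasCurveDeriv (transCurve F θ x i) v) ?_ ?_ hθ
    · intro k θ hθ
      obtain ⟨v, -, h⟩ := exists_hasCurveDeriv_of_forms hθ x i
      exact ⟨v, h⟩
    · rintro θ θ' _ _ ⟨v, h⟩ ⟨v', h'⟩
      exact ⟨v + v', by rw [transCurve_add]; exact h.add h'⟩
  obtain ⟨v, h⟩ := this
  rw [partialGr, h.curveDeriv_eq]
  exact h

lemma partialGr_add [T2Space M] {θ θ' : SecGr L} (hθ : θ ∈ allForms n F L)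
    (hθ' : θ' ∈ allForms n F L) (x : M) (i : Fin n) :
    partialGr F (θ + θ') x i = partialGr F θ x i + partialGr F θ' x i := by
  refine HasCurveDeriv.curveDeriv_eq ?_
  rw [transCurve_add]
  exact (hasCurveDeriv_partialGr hθ x i).add (hasCurveDeriv_partialGr hθ' x i)

lemma partialGr_smul [T2Space M] (c : ℝ) {θ : SecGr L} (hθ : θ ∈ allForms n F L)
    (x : M) (i : Fin n) : partialGr F (c • θ) x i = c • partialGr F θ x i := by
  refine HasCurveDeriv.curveDeriv_eq ?_
  rw [transCurve_smul]
  exact (hasCurveDeriv_partialGr hθ x i).const_smul c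

lemma partialGr_mul [T2Space M] {θ θ' : SecGr L} (hθ : θ ∈ allForms n F L)
    (hθ' : θ' ∈ allForms n F L) (x : M) (i : Fin n) :
    partialGr F (θ * θ') x i = partialGr F θ x i * θ' x + θ x * partialGr F θ' x i := by
  have := finiteDimensional_grE (L := L) F x
  refine HasCurveDeriv.curveDeriv_eq ?_
  rw [transCurve_mul]
  simpa only [LinearMap.mul_apply', transCurve_zero] using
    (hasCurveDeriv_partialGr hθ x i).map₂ (LinearMap.mul ℝ (GrE L x))
      (hasCurveDeriv_partialGr hθ' x i)

/-! ### The covariant derivative of forms -/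

variable (cov : CovariantDerivative (𝓡 n) F L)

/-- The endomorphism `a_β ↦ ∇_v a_β` of the fibre of `L` at `x`. -/
def christoffel (x : M) (v : TangentSpace (𝓡 n) x) : L x →ₗ[ℝ] L x :=
  ∑ β, ((coframeL F L x β).toLinearMap).smulRight (cov (frameL F L x β) x v)

lemma christoffel_apply (x : M) (v : TangentSpace (𝓡 n) x) (w : L x) :
    christoffel cov x v w = ∑ β, coframeL F L x β w • cov (frameL F L x β) x v := by
  simp [christoffel]

lemma christoffel_frameL (x : M) (v : TangentSpace (𝓡 n) x) (β : Fin (Module.finrank ℝ F)) :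
    christoffel cov x v (frameL F L x β x) = cov (frameL F L x β) x v := by
  simp [christoffel_apply, coframeL_frameL]

/-- The derivation of the forms that belongs to an endomorphism of the fibre of `L`. -/
def derivL (F : Type*) [NormedAddCommGroup F] [NormedSpace ℝ F] [FiniteDimensional ℝ F]
    [TopologicalSpace (TotalSpace F L)] [FiberBundle F L] [VectorBundle ℝ F L] {x : M}
    (B : L x →ₗ[ℝ] L x) (θ : GrE L x) : GrE L x :=
  deriv (fun α ↦ frameL F L x α x) (fun α ↦ coframeL F L x α) B θ

/-- The covariant derivative of a form in the direction of a tangent vector. -/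
def covGr (θ : SecGr L) (x : M) (v : TangentSpace (𝓡 n) x) : GrE L x :=
  ∑ i, coordForm x i v • dQ cov (pull n θ) i x 0

lemma dQ_pull_eq (θ : SecGr L) (i : Fin n) (x : M) (p : TangentSpace (𝓡 n) x →L[ℝ] ℝ) :
    dQ cov (pull n θ) i x p = dQ cov (pull n θ) i x 0 := rfl

/-- Only the indices belonging to the `a^α` contribute to the Christoffel sum, since the other
contractions kill forms on `L`. The induced connection on `L*` is minus the transpose, which
produces the minus sign. -/
lemma dQ_pull {θ : SecGr L} (hθ : θ ∈ allForms n F L) (i : Fin n) (x : M)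
    (p : TangentSpace (𝓡 n) x →L[ℝ] ℝ) :
    dQ cov (pull n θ) i x p = partialGr F θ x i
      - derivL F (christoffel cov x (coordVec x i)) (θ x) := by
  rw [sub_eq_add_neg]
  refine congrArg₂ (· + ·) rfl ?_
  have h1 : ∀ α, intL (covecDual (coframeL F L x α)) (pull n θ x p) = 0 := fun α ↦
    intL_covecDual_of_mem_allForms hθ _
  rw [Fintype.sum_sum_type]
  simp only [coframeE, Sum.elim_inl, Sum.elim_inr, h1, mul_zero, Finset.sum_const_zero, zero_add,
    intL_vecDual, covFrame, inducedE, covec_apply, derivL, deriv, map_neg, map_sum, map_smul,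
    neg_mul, Finset.sum_neg_distrib, Finset.sum_mul, smul_mul_assoc, christoffel_frameL]
  rw [Finset.sum_comm]
  congr 1
  refine Finset.sum_congr rfl fun β _ ↦ ?_
  conv_rhs => rw [← sum_coframeL_smul_frameL (F := F) x (cov (frameL F L x β) x (coordVec x i))]
  simp only [map_sum, map_smul, LinearMap.sum_apply, LinearMap.smul_apply, Finset.mul_sum,
    mul_smul_comm]
  rfl

lemma derivL_smul {x : M} (c : ℝ) (B : L x →ₗ[ℝ] L x) (θ : GrE L x) :
    derivL F B (c • θ) = c • derivL F B θ := by
  simp [derivL, deriv, Finset.smul_sum]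

lemma derivL_add {x : M} (B : L x →ₗ[ℝ] L x) (θ θ' : GrE L x) :
    derivL F B (θ + θ') = derivL F B θ + derivL F B θ' := by
  simp [derivL, deriv, mul_add, Finset.sum_add_distrib]

lemma derivL_mul {x : M} (B : L x →ₗ[ℝ] L x) (θ θ' : GrE L x) :
    derivL F B (θ * θ') = derivL F B θ * θ' + θ * derivL F B θ' := by
  simp only [derivL, deriv, Finset.sum_mul, Finset.mul_sum, ← Finset.sum_add_distrib]
  exact Finset.sum_congr rfl fun α _ ↦ ι_mul_contractLeft_mul _ _ _ _

/-- Linearity of the connection in the tangent vector lets the coordinate components be summed,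
although the Christoffel endomorphism itself depends on the chosen frame. -/
lemma sum_coordForm_smul_derivL (x : M) (v : TangentSpace (𝓡 n) x) (θ : GrE L x) :
    ∑ i, coordForm x i v • derivL F (christoffel cov x (coordVec x i)) θ
      = derivL F (christoffel cov x v) θ := by
  simp only [derivL, deriv, Finset.smul_sum]
  rw [Finset.sum_comm]
  refine Finset.sum_congr rfl fun α _ ↦ ?_
  have h : cov (frameL F L x α) x v
      = ∑ i, coordForm x i v • cov (frameL F L x α) x (coordVec x i) := by
    conv_lhs => rw [← sum_coordForm_smul_coordVec x v, map_sum]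
    simp only [map_smul]
  simp only [christoffel_frameL]
  rw [h, map_sum, LinearMap.sum_apply, Finset.mul_sum]
  simp only [map_smul, LinearMap.smul_apply, mul_smul_comm]

lemma covGr_eq {θ : SecGr L} (hθ : θ ∈ allForms n F L) (x : M) (v : TangentSpace (𝓡 n) x) :
    covGr cov θ x v = ∑ i, coordForm x i v • partialGr F θ x i
      - derivL F (christoffel cov x v) (θ x) := by
  simp only [covGr, dQ_pull cov hθ, smul_sub, Finset.sum_sub_distrib, sum_coordForm_smul_derivL]

lemma covGr_map_add (θ : SecGr L) (x : M) (v w : TangentSpace (𝓡 n) x) :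
    covGr cov θ x (v + w) = covGr cov θ x v + covGr cov θ x w := by
  simp only [covGr, map_add, add_smul, Finset.sum_add_distrib]

lemma covGr_map_smul (θ : SecGr L) (x : M) (c : ℝ) (v : TangentSpace (𝓡 n) x) :
    covGr cov θ x (c • v) = c • covGr cov θ x v := by
  simp only [covGr, map_smul, smul_assoc, Finset.smul_sum]

lemma covGr_add [T2Space M] {θ θ' : SecGr L} (hθ : θ ∈ allForms n F L)
    (hθ' : θ' ∈ allForms n F L) (x : M) (v : TangentSpace (𝓡 n) x) :
    covGr cov (θ + θ') x v = covGr cov θ x v + covGr cov θ' x v := by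
  simp only [covGr_eq cov (add_mem hθ hθ'), covGr_eq cov hθ, covGr_eq cov hθ',
    partialGr_add hθ hθ', smul_add, Finset.sum_add_distrib, Pi.add_apply, derivL_add]
  abel

lemma covGr_smul [T2Space M] (c : ℝ) {θ : SecGr L} (hθ : θ ∈ allForms n F L)
    (x : M) (v : TangentSpace (𝓡 n) x) :
    covGr cov (c • θ) x v = c • covGr cov θ x v := by
  simp only [covGr_eq cov (Submodule.smul_mem _ c hθ), covGr_eq cov hθ, partialGr_smul c hθ,
    Pi.smul_apply, derivL_smul, smul_sub, Finset.smul_sum, smul_comm c]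

lemma covGr_mul [T2Space M] {θ θ' : SecGr L} (hθ : θ ∈ allForms n F L)
    (hθ' : θ' ∈ allForms n F L) (h : θ * θ' ∈ allForms n F L)
    (x : M) (v : TangentSpace (𝓡 n) x) :
    covGr cov (θ * θ') x v = covGr cov θ x v * θ' x + θ x * covGr cov θ' x v := by
  simp only [covGr_eq cov h, covGr_eq cov hθ, covGr_eq cov hθ', partialGr_mul hθ hθ', smul_add,
    Finset.sum_add_distrib, Pi.mul_apply, derivL_mul, sub_mul, mul_sub, Finset.sum_mul,
    Finset.mul_sum, smul_mul_assoc, mul_smul_comm]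
  abel

lemma covGr_mem [T2Space M] {k : ℕ} {θ : SecGr L} (hθ : θ ∈ forms n F L k) (x : M)
    (v : TangentSpace (𝓡 n) x) : covGr cov θ x v ∈ dualPower L k x := by
  rw [covGr_eq cov (mem_allForms hθ)]
  exact sub_mem (Submodule.sum_mem _ fun i _ ↦ Submodule.smul_mem _ _ (partialGr_mem hθ x i))
    (deriv_mem _ _ _ (hθ.1 x))

end Forms

/-! ### Compatibility of the covariant derivatives of sections and of forms -/

section CovariantDerivative

open Filter Topology

variable {n : ℕ} {M : Type*} [TopologicalSpace M] [ChartedSpace (EuclideanSpace ℝ (Fin n)) M]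
  [IsManifold (𝓡 n) ∞ M]
variable {F : Type*} [NormedAddCommGroup F] [NormedSpace ℝ F] [FiniteDimensional ℝ F]
variable {L : M → Type*} [∀ x, AddCommGroup (L x)] [∀ x, Module ℝ (L x)]
  [∀ x, TopologicalSpace (L x)] [TopologicalSpace (TotalSpace F L)]
  [∀ x, IsTopologicalAddGroup (L x)] [∀ x, ContinuousSMul ℝ (L x)]
  [FiberBundle F L] [VectorBundle ℝ F L] [ContMDiffVectorBundle ∞ F L (𝓡 n)]

variable (cov : CovariantDerivative (𝓡 n) F L)

lemma cov_mulSec (f : C^∞⟮𝓡 n, M; 𝓘(ℝ, ℝ), ℝ⟯) (s : SecL (n := n) F L) (x : M)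
    (v : TangentSpace (𝓡 n) x) :
    cov (mulSec f s) x v = f x • cov s x v + dirDeriv f x v • s x := by
  have h := cov.isCovariantDerivativeOnUniv.leibniz (x := x) (g := f) (σ := s)
    s.mdifferentiableAt (f.contMDiff.contMDiffAt.mdifferentiableAt (by simp))
  exact congrArg (fun l ↦ l v) h

lemma cov_add_section (s t : SecL (n := n) F L) (x : M) (v : TangentSpace (𝓡 n) x) :
    cov (s + t : SecL (n := n) F L) x v = cov s x v + cov t x v := by
  have h := cov.isCovariantDerivativeOnUniv.add (x := x) (σ := s) (σ' := t)
    s.mdifferentiableAt t.mdifferentiableAt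
  exact congrArg (fun l ↦ l v) h

lemma cov_smul_section (c : ℝ) (s : SecL (n := n) F L) (x : M) (v : TangentSpace (𝓡 n) x) :
    cov (c • s : SecL (n := n) F L) x v = c • cov s x v := by
  have h := cov_mulSec cov ⟨fun _ ↦ c, contMDiff_const⟩ s x v
  refine h.trans ?_
  change c • _ + dirDeriv (fun _ ↦ c) x v • _ = _
  rw [dirDeriv_const, zero_smul, add_zero]

/-- The coefficients of a section in the local frame around `x`. -/
def frameCoeff (s : SecL (n := n) F L) (x : M) (α : Fin (Module.finrank ℝ F)) (y : M) : ℝ :=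
  LinearMap.toContinuousLinearMap ((Module.finBasis ℝ F).coord α)
    ((trivializationAt F L x).continuousLinearMapAt ℝ y (s y))

lemma frameCoeff_self (s : SecL (n := n) F L) (x : M) (α : Fin (Module.finrank ℝ F)) :
    frameCoeff s x α x = coframeL F L x α (s x) := rfl

lemma mdifferentiableAt_frameCoeff (s : SecL (n := n) F L) (x : M)
    (α : Fin (Module.finrank ℝ F)) :
    MDifferentiableAt (𝓡 n) 𝓘(ℝ, ℝ) (frameCoeff s x α) x :=
  ((contMDiffOn_coord x _ s).contMDiffAt ((trivializationAt F L x).open_baseSet.mem_nhds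
    (FiberBundle.mem_baseSet_trivializationAt' x))).mdifferentiableAt (by simp)

lemma sum_frameCoeff_smul (s : SecL (n := n) F L) (x : M) {y : M}
    (hy : y ∈ (trivializationAt F L x).baseSet) :
    ∑ α, frameCoeff s x α y • frameL F L x α y = s y := by
  conv_rhs => rw [← (trivializationAt F L x).symmL_continuousLinearMapAt (R := ℝ) hy (s y),
    ← (Module.finBasis ℝ F).sum_repr ((trivializationAt F L x).continuousLinearMapAt ℝ y (s y)),
    map_sum]
  simp only [map_smul]
  rfl

lemma transL_section (s : SecL (n := n) F L) (x y : M) :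
    transL F x y x (s y) = ∑ α, frameCoeff s x α y • frameL F L x α x := by
  refine (congrArg ((trivializationAt F L x).symmL ℝ x) ((Module.finBasis ℝ F).sum_repr
    ((trivializationAt F L x).continuousLinearMapAt ℝ y (s y)))).symm.trans ?_
  rw [map_sum]
  simp only [map_smul]
  rfl

lemma mdifferentiableAt_frameL (x : M) (α : Fin (Module.finrank ℝ F)) :
    MDifferentiableAt (𝓡 n) ((𝓡 n).prod 𝓘(ℝ, F))
      (fun y ↦ TotalSpace.mk' F y (frameL F L x α y)) x :=
  ((contMDiffOn_symmL_const F L x _).contMDiffAt ((trivializationAt F L x).open_baseSet.mem_nhds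
    (FiberBundle.mem_baseSet_trivializationAt' x))).mdifferentiableAt (by simp)

/-- The sum rule for a connection requires differentiable summands, so the differentiability of the
partial sums is carried along in the induction. -/
lemma cov_sum {ι : Type*} (t : Finset ι) (f : ι → M → ℝ) (σ : ι → ∀ x, L x) (x : M)
    (hf : ∀ i, MDifferentiableAt (𝓡 n) 𝓘(ℝ, ℝ) (f i) x)
    (hσ : ∀ i, MDifferentiableAt (𝓡 n) ((𝓡 n).prod 𝓘(ℝ, F))
      (fun y ↦ TotalSpace.mk' F y (σ i y)) x) (v : TangentSpace (𝓡 n) x) :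
    cov (∑ i ∈ t, f i • σ i) x v
      = ∑ i ∈ t, (f i x • cov (σ i) x v + dirDeriv (f i) x v • σ i x)
    ∧ MDifferentiableAt (𝓡 n) ((𝓡 n).prod 𝓘(ℝ, F))
      (fun y ↦ TotalSpace.mk' F y ((∑ i ∈ t, f i • σ i) y)) x := by
  classical
  induction t using Finset.induction_on with
  | empty =>
    simp only [Finset.sum_empty]
    exact ⟨by rw [cov.zero]; rfl, mdifferentiable_zeroSection ..⟩
  | insert a t ha ih =>
    simp only [Finset.sum_insert ha]
    have h1 := MDifferentiableAt.smul_section (hf a) (hσ a)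
    refine ⟨?_, mdifferentiableAt_add_section h1 ih.2⟩
    rw [cov.isCovariantDerivativeOnUniv.add h1 ih.2,
      cov.isCovariantDerivativeOnUniv.leibniz (hσ a) (hf a), add_apply, ih.1]
    rfl

/-- Near `x` the section is a combination of the frame, and a covariant derivative depends only on
the germ. The Leibniz rule then separates the derivatives of the coefficients from the Christoffel
part. -/
lemma cov_eq [T2Space M] (s : SecL (n := n) F L) (x : M) (v : TangentSpace (𝓡 n) x) :
    cov s x v = ∑ α, dirDeriv (frameCoeff s x α) x v • frameL F L x α x
      + christoffel cov x v (s x) := by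
  have h := cov_sum cov Finset.univ (fun α ↦ frameCoeff s x α) (fun α ↦ frameL F L x α) x
    (mdifferentiableAt_frameCoeff s x) (mdifferentiableAt_frameL x) v
  have he : ∀ᶠ y in 𝓝 x, s y = (∑ α, frameCoeff s x α • frameL F L x α) y := by
    filter_upwards [(trivializationAt F L x).open_baseSet.mem_nhds
      (FiberBundle.mem_baseSet_trivializationAt' x)] with y hy
    rw [Finset.sum_apply]
    exact (sum_frameCoeff_smul s x hy).symm
  rw [cov.isCovariantDerivativeOnUniv.congr_of_eventuallyEq s.mdifferentiableAt h.2
    Filter.univ_mem he, h.1, Finset.sum_add_distrib, add_comm, christoffel_apply]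
  simp only [frameCoeff_self]

/-- In the local trivialization contraction is one fixed bilinear map, so this is the product rule
for the transported section and the transported form. -/
lemma partialGr_contrSec [T2Space M] (s : SecL (n := n) F L) {θ : SecGr L}
    (hθ : θ ∈ allForms n F L) (x : M) (i : Fin n) :
    partialGr F (contrSec s θ) x i
      = contr (∑ α, dirDeriv (frameCoeff s x α) x (coordVec x i) • frameL F L x α x) (θ x)
        + contr (s x) (partialGr F θ x i) := by
  have := finiteDimensional_fibre (L := L) F x
  have h1 : HasCurveDeriv
      (fun t ↦ transL F x (coordCurve x i t) x (s (coordCurve x i t)))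
      (∑ α, dirDeriv (frameCoeff s x α) x (coordVec x i) • frameL F L x α x) := by
    simp only [transL_section]
    exact HasCurveDeriv.sum fun α _ ↦ HasCurveDeriv.smul_const
      (hasDerivAt_comp_coordCurve (mdifferentiableAt_frameCoeff s x α) i) _
  have h2 : transL F x (coordCurve x i 0) x (s (coordCurve x i 0)) = s x := by
    have h : ∀ y : M, y = x → transL F x y x (s y) = s x := by
      rintro y rfl; exact transL_self y (s y)
    exact h _ (coordCurve_zero x i)
  refine HasCurveDeriv.curveDeriv_eq (HasCurveDeriv.congr (h1.map₂ contr
    (hasCurveDeriv_partialGr hθ x i) |> fun h ↦ ?_) (?_ : _ =ᶠ[𝓝 0] fun t ↦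
      contr (transL F x (coordCurve x i t) x (s (coordCurve x i t))) (transCurve F θ x i t)))
  · rw [h2, transCurve_zero] at h
    exact h
  · filter_upwards [(tendsto_coordCurve (n := n) x i).eventually
      ((trivializationAt F L x).open_baseSet.mem_nhds
        (FiberBundle.mem_baseSet_trivializationAt' x))] with t ht
    change _ = contr _ (transGr F x (coordCurve x i t) _)
    rw [← transGr_contr, transL_transL x ht]
    rfl

/-- The covariant derivative is compatible with interior products. -/
lemma contr_covGr [T2Space M] (s : SecL (n := n) F L) {θ : SecGr L} (hθ : θ ∈ allForms n F L)
    (x : M) (v : TangentSpace (𝓡 n) x) :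
    contr (s x) (covGr cov θ x v) = covGr cov (contrSec s θ) x v - contr (cov s x v) (θ x) := by
  rw [covGr_eq cov hθ, covGr_eq cov (contrSec_mem_allForms s hθ), cov_eq]
  have h1 : ∑ i, coordForm x i v • contr
      (∑ α, dirDeriv (frameCoeff s x α) x (coordVec x i) • frameL F L x α x) (θ x)
      = contr (∑ α, dirDeriv (frameCoeff s x α) x v • frameL F L x α x) (θ x) := by
    have h : ∀ α, dirDeriv (frameCoeff s x α) x v
        = ∑ i, coordForm x i v * dirDeriv (frameCoeff s x α) x (coordVec x i) := by
      intro α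
      conv_lhs => rw [dirDeriv, ← sum_coordForm_smul_coordVec x v, map_sum]
      simp only [map_smul]
      rfl
    simp only [h, Finset.sum_smul, map_sum, map_smul, LinearMap.sum_apply, LinearMap.smul_apply,
      Finset.smul_sum, smul_smul]
    rw [Finset.sum_comm]
  simp only [partialGr_contrSec s hθ, smul_add, Finset.sum_add_distrib]
  rw [h1]
  -- The commutator of `i_s` with the Christoffel derivation supplies the Christoffel part of `∇_v
  -- s`; the derivatives of the coefficients of `s` supply the rest.
  simp only [map_sub, derivL, contr_deriv (sum_coframeL_smul_frameL x), map_add,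
    LinearMap.add_apply]
  rw [map_sum (contr (s x))]
  simp only [map_smul, contrSec]
  abel

/-- The value of the covariant derivative of a form on sections of `L`. -/
lemma evalForm_covGr [T2Space M] {k : ℕ} {θ : SecGr L} (hθ : θ ∈ forms n F L k)
    (s : Fin k → SecL (n := n) F L) (x : M) (v : TangentSpace (𝓡 n) x) :
    evalForm (fun i ↦ s i x) (covGr cov θ x v)
      = dirDeriv (fun y ↦ evalForm (fun i ↦ s i y) (θ y)) x v
        - ∑ m, evalForm (Function.update (fun i ↦ s i x) m (cov (s m) x v)) (θ x) := by
  induction k generalizing θ with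
  | zero =>
    have h0 := mdifferentiable_evalForm hθ s x
    -- In degree zero the form is a scalar multiple of the unit, and transport fixes the unit, so
    -- its partial derivatives are those of a function.
    have hp : ∀ i : Fin n, partialGr F θ x i = algebraMap ℝ (GrE L x)
        (dirDeriv (fun y ↦ evalForm (fun i ↦ s i y) (θ y)) x (coordVec x i)) := by
      intro i
      refine HasCurveDeriv.curveDeriv_eq ?_
      rw [Algebra.algebraMap_eq_smul_one]
      refine HasCurveDeriv.congr
        (HasCurveDeriv.smul_const (hasDerivAt_comp_coordCurve h0 i) (1 : GrE L x))
        (Filter.Eventually.of_forall fun t ↦ ?_)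
      obtain ⟨r, hr⟩ := mem_dualPower_zero (hθ.1 (coordCurve x i t))
      simp only [transCurve, evalForm_zero]
      rw [hr, ExteriorAlgebra.algebraMap_leftInverse _ r, AlgHom.commutes,
        Algebra.algebraMap_eq_smul_one]
    have hd : derivL F (christoffel cov x v) (θ x) = 0 := by
      simp [derivL, deriv, contr_eq_zero (hθ.1 x)]
    rw [covGr_eq cov (mem_allForms hθ), hd, sub_zero, evalForm_zero]
    simp only [hp, map_sum, map_smul, ExteriorAlgebra.algebraMap_leftInverse _ _,
      Finset.univ_eq_empty, Finset.sum_empty, sub_zero]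
    conv_rhs => rw [dirDeriv, ← sum_coordForm_smul_coordVec x v, map_sum]
    simp only [map_smul]
    rfl
  | succ k ih =>
    rw [evalForm_succ, contr_covGr cov (s 0) (mem_allForms hθ), map_sub,
      ih (contrSec_mem_forms (s 0) hθ), Fin.sum_univ_succ, evalForm_update_zero]
    simp only [evalForm_update_succ, evalForm_succ (fun i ↦ s i _)]
    simp only [contrSec]
    ring

end CovariantDerivative

section Torsion

variable {n : ℕ} {M : Type*} [TopologicalSpace M] [ChartedSpace (EuclideanSpace ℝ (Fin n)) M]
  [IsManifold (𝓡 n) ∞ M]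
variable {F : Type*} [NormedAddCommGroup F] [NormedSpace ℝ F] [FiniteDimensional ℝ F]
variable {L : M → Type*} [∀ x, AddCommGroup (L x)] [∀ x, Module ℝ (L x)]
  [∀ x, TopologicalSpace (L x)] [TopologicalSpace (TotalSpace F L)]
  [∀ x, IsTopologicalAddGroup (L x)] [∀ x, ContinuousSMul ℝ (L x)]
  [FiberBundle F L] [VectorBundle ℝ F L] [ContMDiffVectorBundle ∞ F L (𝓡 n)]

/-! ### Sections of `L ⊕ L*` -/

/-- The product of a smooth function and a section of `L ⊕ L*`. -/
def mulE (f : C^∞⟮𝓡 n, M; 𝓘(ℝ, ℝ), ℝ⟯) (e : SecE (n := n) F L) : SecE (n := n) F L :=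
  (mulSec f e.1, mulSec f e.2)

/-- A section of `L ⊕ L*` with the value `u` at `x`. -/
def extE (F : Type*) [NormedAddCommGroup F] [NormedSpace ℝ F] [FiniteDimensional ℝ F]
    [TopologicalSpace (TotalSpace F L)] [FiberBundle F L] [VectorBundle ℝ F L]
    (x : M) (u : Dbl L x) : SecE (n := n) F L := (extL F L x u.1, extDual F L x u.2)

lemma valE_extE [T2Space M] (x : M) (u : Dbl L x) : valE (extE (n := n) F x u) x = u :=
  Prod.ext (extL_apply x u.1) (extDual_apply x u.2)

lemma valE_add (e e' : SecE (n := n) F L) (x : M) : valE (e + e') x = valE e x + valE e' x := rfl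

lemma valE_sub (e e' : SecE (n := n) F L) (x : M) : valE (e - e') x = valE e x - valE e' x := rfl

lemma valE_smul (c : ℝ) (e : SecE (n := n) F L) (x : M) : valE (c • e) x = c • valE e x := rfl

lemma valE_mulE (f : C^∞⟮𝓡 n, M; 𝓘(ℝ, ℝ), ℝ⟯) (e : SecE (n := n) F L) (x : M) :
    valE (mulE f e) x = f x • valE e x := rfl

lemma pairE_comm (e e' : SecE (n := n) F L) (x : M) : pairE e e' x = pairE e' e x :=
  add_comm _ _

lemma pairE_add_right (e e' e'' : SecE (n := n) F L) (x : M) :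
    pairE e (e' + e'') x = pairE e e' x + pairE e e'' x := by
  simp only [pairE, pairing, valE_add, Prod.fst_add, Prod.snd_add, map_add, add_apply]
  ring

lemma pairE_add_left (e e' e'' : SecE (n := n) F L) (x : M) :
    pairE (e + e') e'' x = pairE e e'' x + pairE e' e'' x := by
  rw [pairE_comm, pairE_add_right, pairE_comm e'', pairE_comm e'']

lemma pairE_mulE_right (f : C^∞⟮𝓡 n, M; 𝓘(ℝ, ℝ), ℝ⟯) (e e' : SecE (n := n) F L) (x : M) :
    pairE e (mulE f e') x = f x * pairE e e' x := by
  simp only [pairE, pairing, valE_mulE, Prod.smul_fst, Prod.smul_snd, map_smul, smul_apply,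
    smul_eq_mul]
  ring

lemma mdifferentiableAt_dual_apply (ξ : SecDual (n := n) F L) (s : SecL (n := n) F L) (x : M) :
    MDifferentiableAt (𝓡 n) 𝓘(ℝ, ℝ) (fun y ↦ ξ y (s y)) x :=
  (contMDiff_dual_apply ξ s).contMDiffAt.mdifferentiableAt (by simp)

/-- A section vanishing at `x` is a combination of sections with coefficients vanishing at `x`;
linearity over the functions then forces the value to be zero. -/
lemma eq_zero_of_tensorial [T2Space M] {x : M} (Φ : SecE (n := n) F L →+ ℝ)
    (hΦ : ∀ (f : C^∞⟮𝓡 n, M; 𝓘(ℝ, ℝ), ℝ⟯) e, Φ (mulE f e) = f x * Φ e)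
    {e : SecE (n := n) F L} (he : valE e x = 0) : Φ e = 0 := by
  obtain ⟨f, t, hf, hs⟩ := exists_eq_sum_of_apply_eq_zero x e.1 (congrArg Prod.fst he)
  obtain ⟨g, ζ, hg, hξ⟩ := exists_eq_sum_of_apply_eq_zero x e.2 (congrArg Prod.snd he)
  have h : e = ∑ i, mulE (f i) (t i, 0) + ∑ i, mulE (g i) (0, ζ i) := by
    have h0 : ∀ f : C^∞⟮𝓡 n, M; 𝓘(ℝ, ℝ), ℝ⟯, mulSec f (0 : SecL (n := n) F L) = 0 :=
      fun f ↦ ContMDiffSection.ext fun y ↦ smul_zero _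
    have h0' : ∀ f : C^∞⟮𝓡 n, M; 𝓘(ℝ, ℝ), ℝ⟯, mulSec f (0 : SecDual (n := n) F L) = 0 :=
      fun f ↦ ContMDiffSection.ext fun y ↦ smul_zero _
    refine Prod.ext ?_ ?_
    · simp [Prod.fst_sum, mulE, hs, h0]
    · simp [Prod.snd_sum, mulE, hξ, h0']
  rw [h, map_add, map_sum, map_sum]
  simp [hΦ, hf, hg]

/-! ### The induced connection and the torsion -/

variable (C : CourantAlgebroid n F L) (cov : CovariantDerivative (𝓡 n) F L)

lemma CourantAlgebroid.pairE_bracket_swap (e₁ e₂ e₃ : SecE (n := n) F L) (x : M) :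
    pairE (C.bracket e₁ e₂) e₃ x + pairE (C.bracket e₂ e₁) e₃ x
      = dirDeriv (pairE e₁ e₂) x (C.anchor x (valE e₃ x)) := by
  rw [← C.symm, pairE_add_left]

lemma CourantAlgebroid.pairE_bracket_add (e₁ e₂ e₃ : SecE (n := n) F L) (x : M) :
    pairE (C.bracket e₁ e₂) e₃ x + pairE (C.bracket e₁ e₃) e₂ x
      = dirDeriv (pairE e₂ e₃) x (C.anchor x (valE e₁ x)) := by
  rw [C.invariant, pairE_comm e₂]

/-- The terms with the connection cancel in pairs: the connection on `L*` is dual to the one on `L`,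
so the induced connection is metric. -/
lemma hCov_add_hCov (x : M) (v : TangentSpace (𝓡 n) x) (e e' : SecE (n := n) F L) :
    hCov cov x v e e' + hCov cov x v e' e = dirDeriv (pairE e e') x v := by
  have : dirDeriv (pairE e e') x v = _ :=
    dirDeriv_add (mdifferentiableAt_dual_apply e.2 e'.1 x)
      (mdifferentiableAt_dual_apply e'.2 e.1 x) v
  rw [this, hCov, hCov]
  ring

lemma hCov_add_right (x : M) (v : TangentSpace (𝓡 n) x) (e e' e'' : SecE (n := n) F L) :
    hCov cov x v e (e' + e'') = hCov cov x v e e' + hCov cov x v e e'' := by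
  have h : dirDeriv (fun y ↦ e.2 y ((e' + e'').1 y)) x v = _ :=
    (dirDeriv_congr (.of_forall fun y ↦ map_add (e.2 y) (e'.1 y) (e''.1 y)) v).trans
      (dirDeriv_add (mdifferentiableAt_dual_apply e.2 e'.1 x)
        (mdifferentiableAt_dual_apply e.2 e''.1 x) v)
  have h' : (e' + e'').2 x (cov e.1 x v) = e'.2 x (cov e.1 x v) + e''.2 x (cov e.1 x v) := rfl
  rw [hCov, hCov, hCov, h, h', Prod.fst_add, cov_add_section, map_add]
  ring

lemma hCov_mulE_right (x : M) (v : TangentSpace (𝓡 n) x) (f : C^∞⟮𝓡 n, M; 𝓘(ℝ, ℝ), ℝ⟯)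
    (e e' : SecE (n := n) F L) :
    hCov cov x v e (mulE f e') = f x * hCov cov x v e e' := by
  have h : dirDeriv (fun y ↦ e.2 y ((mulE f e').1 y)) x v = _ :=
    (dirDeriv_congr (.of_forall fun y ↦ map_smul (e.2 y) (f y) (e'.1 y)) v).trans
      (dirDeriv_mul (f.contMDiff.contMDiffAt.mdifferentiableAt (by simp))
        (mdifferentiableAt_dual_apply e.2 e'.1 x) v)
  have h' : (mulE f e').2 x (cov e.1 x v) = f x * e'.2 x (cov e.1 x v) := rfl
  have h'' : cov (mulE f e').1 x v = _ := cov_mulSec cov f e'.1 x v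
  rw [hCov, hCov, h, h', h'', map_add, map_smul, map_smul, smul_eq_mul, smul_eq_mul]
  ring

lemma hCov_map_add (x : M) (v w : TangentSpace (𝓡 n) x) (e e' : SecE (n := n) F L) :
    hCov cov x (v + w) e e' = hCov cov x v e e' + hCov cov x w e e' := by
  simp only [hCov, dirDeriv_map_add, map_add]
  ring

lemma hCov_map_smul (x : M) (c : ℝ) (v : TangentSpace (𝓡 n) x) (e e' : SecE (n := n) F L) :
    hCov cov x (c • v) e e' = c * hCov cov x v e e' := by
  simp only [hCov, dirDeriv_map_smul, map_smul, smul_eq_mul]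
  ring

/-- The symmetric part of the bracket is `𝒟 h(e₁, e₂)`. Paired with `e₃` it is cancelled by the
correction term `h(∇_{ρ(e₃)} e₁, e₂)`, because the connection is metric. -/
lemma torsion_swap_left (e₁ e₂ e₃ : SecE (n := n) F L) (x : M) :
    torsion C cov e₂ e₁ e₃ x = -torsion C cov e₁ e₂ e₃ x := by
  have h1 := C.pairE_bracket_swap e₁ e₂ e₃ x
  have h2 := hCov_add_hCov cov x (C.anchor x (valE e₃ x)) e₁ e₂
  simp only [torsion]
  linarith

/-- Both the bracket and the metric connection differentiate `h(e₂, e₃)` along `ρ(e₁)` in the same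
way, so their difference is skew. -/
lemma torsion_swap_right (e₁ e₂ e₃ : SecE (n := n) F L) (x : M) :
    torsion C cov e₁ e₃ e₂ x = -torsion C cov e₁ e₂ e₃ x := by
  have h1 := C.pairE_bracket_add e₁ e₂ e₃ x
  have h2 := hCov_add_hCov cov x (C.anchor x (valE e₁ x)) e₂ e₃
  simp only [torsion]
  linarith

lemma torsion_add_right (e₁ e₂ e₃ e₃' : SecE (n := n) F L) (x : M) :
    torsion C cov e₁ e₂ (e₃ + e₃') x = torsion C cov e₁ e₂ e₃ x + torsion C cov e₁ e₂ e₃' x := by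
  simp only [torsion, hCov_add_right, pairE_add_right, valE_add, map_add, hCov_map_add]
  ring

lemma torsion_mulE_right (f : C^∞⟮𝓡 n, M; 𝓘(ℝ, ℝ), ℝ⟯) (e₁ e₂ e₃ : SecE (n := n) F L) (x : M) :
    torsion C cov e₁ e₂ (mulE f e₃) x = f x * torsion C cov e₁ e₂ e₃ x := by
  simp only [torsion, hCov_mulE_right, pairE_mulE_right, valE_mulE, map_smul, hCov_map_smul]
  ring

/-- The third argument is nowhere inside a bracket and is differentiated only in `h(∇ e, e₃)`, which
is tensorial in it; so locality is clear in this slot. Skewness carries it to the other two. -/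
lemma torsion_congr_right [T2Space M] (e₁ e₂ : SecE (n := n) F L) {e₃ e₃' : SecE (n := n) F L}
    {x : M} (h : valE e₃ x = valE e₃' x) :
    torsion C cov e₁ e₂ e₃ x = torsion C cov e₁ e₂ e₃' x := by
  have := eq_zero_of_tensorial (x := x)
    (AddMonoidHom.mk' (fun e ↦ torsion C cov e₁ e₂ e x)
      fun e e' ↦ torsion_add_right C cov e₁ e₂ e e' x)
    (fun f e ↦ torsion_mulE_right C cov f e₁ e₂ e x) (e := e₃ - e₃')
    (by rw [valE_sub, h, sub_self])
  rw [map_sub, sub_eq_zero] at this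
  exact this

lemma torsion_congr [T2Space M] {e₁ e₁' e₂ e₂' e₃ e₃' : SecE (n := n) F L} {x : M}
    (h₁ : valE e₁ x = valE e₁' x) (h₂ : valE e₂ x = valE e₂' x) (h₃ : valE e₃ x = valE e₃' x) :
    torsion C cov e₁ e₂ e₃ x = torsion C cov e₁' e₂' e₃' x := by
  have k₁ := torsion_congr_right C cov e₂' e₃' h₁
  have k₂ := torsion_congr_right C cov e₁ e₃' h₂
  have k₃ := torsion_congr_right C cov e₁ e₂ h₃
  linarith [torsion_swap_right C cov e₁ e₂ e₃' x, torsion_swap_right C cov e₁ e₂' e₃' x,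
    torsion_swap_right C cov e₂' e₁ e₃' x, torsion_swap_right C cov e₂' e₁' e₃' x,
    torsion_swap_left C cov e₁ e₂' e₃' x, torsion_swap_left C cov e₁' e₂' e₃' x]

lemma torsion_extE [T2Space M] (e₁ e₂ e₃ : SecE (n := n) F L) (x : M) :
    torsion C cov (extE F x (valE e₁ x)) (extE F x (valE e₂ x)) (extE F x (valE e₃ x)) x
      = torsion C cov e₁ e₂ e₃ x :=
  torsion_congr C cov (valE_extE x _) (valE_extE x _) (valE_extE x _)

/-! ### The torsion as a skew trilinear form on a fibre -/

/-- The torsion tensor on the fibre at `x`. -/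
def tens (x : M) (u v w : Dbl L x) : ℝ :=
  torsion C cov (extE F x u) (extE F x v) (extE F x w) x

lemma tens_swap_left (x : M) (u v w : Dbl L x) : tens C cov x v u w = -tens C cov x u v w :=
  torsion_swap_left C cov _ _ _ x

lemma tens_swap_right (x : M) (u v w : Dbl L x) : tens C cov x u w v = -tens C cov x u v w :=
  torsion_swap_right C cov _ _ _ x

lemma tens_swap_outer (x : M) (u v w : Dbl L x) : tens C cov x w v u = -tens C cov x u v w := by
  rw [tens_swap_left, tens_swap_right, tens_swap_left, neg_neg]

variable [T2Space M]

lemma tens_add_right (x : M) (u v w w' : Dbl L x) :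
    tens C cov x u v (w + w') = tens C cov x u v w + tens C cov x u v w' := by
  rw [tens, tens, tens, ← torsion_add_right]
  exact torsion_congr_right C cov _ _ (by simp only [valE_add, valE_extE])

lemma tens_smul_right (x : M) (c : ℝ) (u v w : Dbl L x) :
    tens C cov x u v (c • w) = c * tens C cov x u v w := by
  obtain ⟨f, hf⟩ : ∃ f : C^∞⟮𝓡 n, M; 𝓘(ℝ, ℝ), ℝ⟯, ∀ y, f y = c :=
    ⟨⟨fun _ ↦ c, contMDiff_const⟩, fun _ ↦ rfl⟩
  rw [← hf x]
  refine (torsion_congr_right C cov _ _ ?_).trans (torsion_mulE_right C cov f _ _ _ x)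
  rw [valE_extE, valE_mulE, valE_extE]

/-- The torsion tensor on the fibre at `x`, as a trilinear map. -/
def tensL (x : M) : Dbl L x →ₗ[ℝ] Dbl L x →ₗ[ℝ] Dbl L x →ₗ[ℝ] ℝ :=
  LinearMap.mk₂ ℝ
    (fun u v ↦
      { toFun := tens C cov x u v
        map_add' := tens_add_right C cov x u v
        map_smul' := fun c w ↦ tens_smul_right C cov x c u v w })
    (fun u u' v ↦ LinearMap.ext fun w ↦ by
      change tens C cov x (u + u') v w = tens C cov x u v w + tens C cov x u' v w
      rw [tens_swap_outer, tens_swap_outer (u := w) (w := u), tens_swap_outer (u := w) (w := u'),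
        tens_add_right]
      ring)
    (fun c u v ↦ LinearMap.ext fun w ↦ by
      change tens C cov x (c • u) v w = c * tens C cov x u v w
      rw [tens_swap_outer, tens_swap_outer (u := w) (w := u), tens_smul_right]
      ring)
    (fun u v v' ↦ LinearMap.ext fun w ↦ by
      change tens C cov x u (v + v') w = tens C cov x u v w + tens C cov x u v' w
      rw [tens_swap_right, tens_swap_right (v := w) (w := v), tens_swap_right (v := w) (w := v'),
        tens_add_right]
      ring)
    (fun c u v ↦ LinearMap.ext fun w ↦ by
      change tens C cov x u (c • v) w = c * tens C cov x u v w
      rw [tens_swap_right, tens_swap_right (v := w) (w := v), tens_smul_right]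
      ring)

lemma tensL_swap_left (x : M) (u v w : Dbl L x) : tensL C cov x v u w = -tensL C cov x u v w :=
  tens_swap_left C cov x u v w

lemma tensL_swap_right (x : M) (u v w : Dbl L x) : tensL C cov x u w v = -tensL C cov x u v w :=
  tens_swap_right C cov x u v w

lemma torsion_eq (e₁ e₂ e₃ : SecE (n := n) F L) (x : M) :
    torsion C cov e₁ e₂ e₃ x = tensL C cov x (valE e₁ x) (valE e₂ x) (valE e₃ x) :=
  (torsion_extE C cov e₁ e₂ e₃ x).symm

end Torsion

section Koszul

variable {n : ℕ} {M : Type*} [TopologicalSpace M] [ChartedSpace (EuclideanSpace ℝ (Fin n)) M]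
  [IsManifold (𝓡 n) ∞ M]
variable {F : Type*} [NormedAddCommGroup F] [NormedSpace ℝ F] [FiniteDimensional ℝ F]
variable {L : M → Type*} [∀ x, AddCommGroup (L x)] [∀ x, Module ℝ (L x)]
  [∀ x, TopologicalSpace (L x)] [TopologicalSpace (TotalSpace F L)]
  [∀ x, IsTopologicalAddGroup (L x)] [∀ x, ContinuousSMul ℝ (L x)]
  [FiberBundle F L] [VectorBundle ℝ F L] [ContMDiffVectorBundle ∞ F L (𝓡 n)]

/-! ### First order operators on forms and the Koszul formula -/

variable (cov : CovariantDerivative (𝓡 n) F L)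

/-- The operator of degree one on forms that is determined by an anchor map `r : L → TM` and a
vector valued two-form `τ` on `L`, at the point `x`. -/
def koszulOp {x : M} (r : L x →ₗ[ℝ] TangentSpace (𝓡 n) x) (τ : L x →ₗ[ℝ] L x →ₗ[ℝ] L x)
    (θ : SecGr L) : GrE L x :=
  ∑ α, covec (coframeL F L x α) * covGr cov θ x (r (frameL F L x α x))
    + derivTwo (fun α ↦ frameL F L x α x) (fun α ↦ coframeL F L x α) τ (θ x)

/-- The bracket of sections of `L` whose torsion is `τ`, at the point `x`. -/
def covBracket {x : M} (r : L x →ₗ[ℝ] TangentSpace (𝓡 n) x) (τ : L x →ₗ[ℝ] L x →ₗ[ℝ] L x)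
    (s t : SecL (n := n) F L) : L x :=
  cov t x (r (s x)) - cov s x (r (t x)) - τ (s x) (t x)

lemma koszulOp_mem [T2Space M] {x : M} (r : L x →ₗ[ℝ] TangentSpace (𝓡 n) x)
    (τ : L x →ₗ[ℝ] L x →ₗ[ℝ] L x) {k : ℕ} {θ : SecGr L} (hθ : θ ∈ forms n F L k) :
    koszulOp cov r τ θ ∈ dualPower L (k + 1) x :=
  add_mem (Submodule.sum_mem _ fun _ _ ↦ covec_mul_mem _ (covGr_mem cov hθ _ _))
    (derivTwo_mem _ _ _ (hθ.1 x))

lemma koszulOp_zero [T2Space M] {x : M} (r : L x →ₗ[ℝ] TangentSpace (𝓡 n) x)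
    (τ : L x →ₗ[ℝ] L x →ₗ[ℝ] L x) : koszulOp cov r τ (0 : SecGr L) = 0 := by
  have h : ∀ v, covGr cov (0 : SecGr L) x v = 0 := fun v ↦ by
    simpa using covGr_smul cov 0 (zero_mem (allForms n F L)) x v
  simp [koszulOp, h, derivTwo, deriv]

/-- The derivation `s ↦ ∇_{r v} s` as an endomorphism in `v`. -/
def covAlong {x : M} (r : L x →ₗ[ℝ] TangentSpace (𝓡 n) x) (s : SecL (n := n) F L) :
    L x →ₗ[ℝ] L x :=
  (cov s x).toLinearMap ∘ₗ r

/-- A Cartan formula: the interior product of `koszulOp`. -/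
lemma contr_koszulOp [T2Space M] {x : M} (r : L x →ₗ[ℝ] TangentSpace (𝓡 n) x)
    (τ : L x →ₗ[ℝ] L x →ₗ[ℝ] L x) (hτ : ∀ v w, τ v w = -τ w v) {θ : SecGr L}
    (hθ : θ ∈ allForms n F L) (s : SecL (n := n) F L) :
    contr (s x) (koszulOp cov r τ θ) = covGr cov θ x (r (s x))
      + derivL F (covAlong cov r s) (θ x) + derivL F (τ (s x)) (θ x)
      - koszulOp cov r τ (contrSec s θ) := by
  have h1 : ∑ α, coframeL F L x α (s x) • covGr cov θ x (r (frameL F L x α x))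
      = covGr cov θ x (r (s x)) := by
    conv_rhs => rw [← sum_coframeL_smul_frameL (F := F) x (s x)]
    let G : TangentSpace (𝓡 n) x →ₗ[ℝ] GrE L x :=
      ⟨⟨covGr cov θ x, covGr_map_add cov θ x⟩, covGr_map_smul cov θ x⟩
    change _ = (G ∘ₗ r) (∑ α, coframeL F L x α (s x) • frameL F L x α x)
    rw [map_sum]
    simp only [map_smul]
    rfl
  simp only [koszulOp, map_add, map_sum, contr_covec_mul, contr_covGr cov s hθ,
    Finset.sum_sub_distrib, h1, mul_sub,
    contr_derivTwo (sum_coframeL_smul_frameL (F := F) x) τ hτ, contrSec]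
  simp only [derivL, deriv, covAlong]
  simp only [LinearMap.comp_apply, ContinuousLinearMap.coe_coe]
  abel

lemma sum_Iio_succ {k : ℕ} (j : Fin k) (f : Fin (k + 1) → ℝ) :
    ∑ i ∈ Finset.Iio j.succ, f i = f 0 + ∑ i ∈ Finset.Iio j, f i.succ := by
  have h : ∀ {m : ℕ} (j : Fin m), Finset.Iio j = Finset.univ.filter (· < j) := fun j ↦ by
    ext; simp
  rw [h, h, Finset.sum_filter, Finset.sum_filter, Fin.sum_univ_succ]
  simp [Fin.succ_lt_succ_iff]

/-- Induction on the degree with the Cartan formula: contracting with `s 0` gives the terms in which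
`s 0` is differentiated along or bracketed, and minus the formula in one degree less gives all the
others. -/
lemma evalForm_koszulOp [T2Space M] {x : M} (r : L x →ₗ[ℝ] TangentSpace (𝓡 n) x)
    (τ : L x →ₗ[ℝ] L x →ₗ[ℝ] L x) (hτ : ∀ v w, τ v w = -τ w v) {k : ℕ} {θ : SecGr L}
    (hθ : θ ∈ forms n F L k) (s : Fin (k + 1) → SecL (n := n) F L) :
    evalForm (fun i ↦ s i x) (koszulOp cov r τ θ)
      = ∑ i : Fin (k + 1), (-1 : ℝ) ^ (i : ℕ) *
          dirDeriv (fun y ↦ evalForm (fun m ↦ s (i.succAbove m) y) (θ y)) x (r (s i x))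
        + ∑ j : Fin (k + 1), ∑ i ∈ Finset.Iio j, (-1 : ℝ) ^ (j : ℕ) *
          evalForm (fun m ↦ Function.update (fun l ↦ s l x) i (covBracket cov r τ (s i) (s j))
            (j.succAbove m)) (θ x) := by
  induction k generalizing θ with
  | zero =>
    rw [evalForm_succ, contr_koszulOp cov r τ hτ (mem_allForms hθ),
      contrSec_of_forms_zero _ hθ, koszulOp_zero, sub_zero]
    have h : ∀ B : L x →ₗ[ℝ] L x, derivL F B (θ x) = 0 := fun B ↦ by
      simp [derivL, deriv, contr_eq_zero (hθ.1 x)]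
    rw [h, h, add_zero, add_zero, evalForm_covGr cov hθ (fun i ↦ s i.succ)]
    simp
    rfl
  | succ k ih =>
    rw [evalForm_succ, contr_koszulOp cov r τ hτ (mem_allForms hθ), map_sub, map_add, map_add,
      evalForm_covGr cov hθ (fun i ↦ s i.succ), ih (contrSec_mem_forms _ hθ)]
    simp only [derivL, evalForm_deriv (sum_coframeL_smul_frameL (F := F) x)]
    rw [Fin.sum_univ_succ (n := k + 1), Fin.sum_univ_succ (n := k + 1)]
    -- These are the brackets with `s 0`. Moving the bracket from slot `0` to the slot of its
    -- partner costs `(-1)^j`, which turns the sign `(-1)^(j+1)` into a plain minus sign.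
    have h0 : ∀ j : Fin (k + 1),
        (-1 : ℝ) ^ (j.succ : ℕ) * evalForm (fun m ↦ Function.update (fun l ↦ s l x) 0
          (covBracket cov r τ (s 0) (s j.succ)) (j.succ.succAbove m)) (θ x)
        = -evalForm (Function.update (fun l : Fin (k + 1) ↦ s l.succ x) j
          (covBracket cov r τ (s 0) (s j.succ))) (θ x) := by
      intro j
      rw [evalForm_succ]
      simp only [Fin.succ_succAbove_zero, Function.update_self, Fin.succ_succAbove_succ,
        Function.update_of_ne (Fin.succ_ne_zero _)]
      rw [evalForm_succAbove_contr (fun l : Fin (k + 1) ↦ s l.succ x), Fin.val_succ, pow_succ]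
      have h : (-1 : ℝ) ^ (j : ℕ) * (-1) ^ (j : ℕ) = 1 := by rw [← mul_pow]; simp
      linear_combination (-evalForm (Function.update (fun l : Fin (k + 1) ↦ s l.succ x) j
          (covBracket cov r τ (s 0) (s j.succ))) (θ x)) * h
    -- Brackets and derivatives not involving `s 0` come from the lower degree; the shift of the
    -- index by one accounts for the minus sign in the Cartan formula.
    have h1 : ∀ j i : Fin (k + 1),
        (-1 : ℝ) ^ (j.succ : ℕ) * evalForm (fun m ↦ Function.update (fun l ↦ s l x) i.succ
          (covBracket cov r τ (s i.succ) (s j.succ)) (j.succ.succAbove m)) (θ x)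
        = -((-1 : ℝ) ^ (j : ℕ) * evalForm (fun m ↦ Function.update (fun l : Fin (k + 1) ↦ s l.succ x) i
          (covBracket cov r τ (s i.succ) (s j.succ)) (j.succAbove m)) (contrSec (s 0) θ x)) := by
      intro j i
      rw [evalForm_succ]
      simp only [Fin.succ_succAbove_zero, Function.update_of_ne (Fin.succ_ne_zero i).symm,
        Fin.succ_succAbove_succ, contrSec]
      rw [Fin.val_succ, pow_succ, mul_neg_one, neg_mul]
      refine congrArg (fun z : Fin k → L x ↦ -(_ * evalForm z (contr (s 0 x) (θ x))))
        (funext fun m ↦ ?_)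
      by_cases h : j.succAbove m = i
      · rw [h]; simp
      · rw [Function.update_of_ne h, Function.update_of_ne ((Fin.succ_injective _).ne h)]
    have h2 : ∀ i : Fin (k + 1), (-1 : ℝ) ^ (i.succ : ℕ) *
        dirDeriv (fun y ↦ evalForm (fun m ↦ s (i.succ.succAbove m) y) (θ y)) x (r (s i.succ x))
        = -((-1 : ℝ) ^ (i : ℕ) * dirDeriv (fun y ↦ evalForm (fun m ↦ s (i.succAbove m).succ y)
          (contrSec (s 0) θ y)) x (r (s i.succ x))) := by
      intro i
      simp only [evalForm_succ (fun m ↦ s (i.succ.succAbove m) _), Fin.succ_succAbove_zero,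
        Fin.succ_succAbove_succ, contrSec]
      rw [Fin.val_succ, pow_succ, mul_neg_one, neg_mul]
    have hI : Finset.Iio (0 : Fin (k + 1 + 1)) = ∅ := by ext i; simp
    simp only [sum_Iio_succ, h0, h1, h2, Finset.sum_neg_distrib, Finset.sum_add_distrib, hI,
      Finset.sum_empty, zero_add]
    -- The brackets with `s 0` split into the three sums that the Cartan formula gave: the
    -- correction in `∇_{r(s 0)} θ`, the derivation by `∇ (s 0)`, and the derivation by the torsion.
    simp only [covBracket, evalForm_update_sub, Finset.sum_sub_distrib]
    simp [covAlong]
    ring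

end Koszul

section Graph

variable {n : ℕ} {M : Type*} [TopologicalSpace M] [ChartedSpace (EuclideanSpace ℝ (Fin n)) M]
  [IsManifold (𝓡 n) ∞ M]
variable {F : Type*} [NormedAddCommGroup F] [NormedSpace ℝ F] [FiniteDimensional ℝ F]
variable {L : M → Type*} [∀ x, AddCommGroup (L x)] [∀ x, Module ℝ (L x)]
  [∀ x, TopologicalSpace (L x)] [TopologicalSpace (TotalSpace F L)]
  [∀ x, IsTopologicalAddGroup (L x)] [∀ x, ContinuousSMul ℝ (L x)]
  [FiberBundle F L] [VectorBundle ℝ F L] [ContMDiffVectorBundle ∞ F L (𝓡 n)]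

/-! ### Two-forms as maps `L → L*` -/

lemma mem_dualPower_one {x : M} {ω₁ : GrE L x} (h : ω₁ ∈ dualPower L 1 x) :
    ∃ ξ : L x →L[ℝ] ℝ, ω₁ = covec ξ := by
  refine dualPower_succ_induction (p := fun θ ↦ ∃ ξ : L x →L[ℝ] ℝ, θ = covec ξ) ⟨0, by simp⟩ ?_ ?_ h
  · rintro _ _ ⟨ξ, rfl⟩ ⟨ζ, rfl⟩; exact ⟨ξ + ζ, by simp⟩
  · intro ξ a ha
    obtain ⟨r, rfl⟩ := mem_dualPower_zero ha
    exact ⟨r • ξ, by rw [map_smul, ← Algebra.commutes, Algebra.smul_def]⟩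

/-- The bilinear form on `L` defined by a two-form. -/
def bilin {x : M} (ψ : GrE L x) : L x →ₗ[ℝ] L x →ₗ[ℝ] ℝ :=
  LinearMap.mk₂ ℝ (fun v w ↦ ExteriorAlgebra.algebraMapInv (contr w (contr v ψ)))
    (fun _ _ _ ↦ by simp) (fun _ _ _ ↦ by simp) (fun _ _ _ ↦ by simp) (fun _ _ _ ↦ by simp)

lemma evalForm_two {x : M} (v : Fin 2 → L x) (ψ : GrE L x) :
    evalForm v ψ = bilin ψ (v 0) (v 1) := by
  rw [evalForm_succ, evalForm_succ]
  rfl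

lemma bilin_swap {x : M} (ψ : GrE L x) (v w : L x) : bilin ψ w v = -bilin ψ v w := by
  change ExteriorAlgebra.algebraMapInv (contr v (contr w ψ)) = _
  rw [contr_anticomm, map_neg]
  rfl

lemma bilin_smul {x : M} (c : ℝ) (ψ : GrE L x) (v w : L x) :
    bilin (c • ψ) v w = c * bilin ψ v w := by
  simp [bilin]

/-- The map `v ↦ i_v ψ` from `L` to `L*` defined by a two-form `ψ`. -/
def flat (F : Type*) [NormedAddCommGroup F] [NormedSpace ℝ F]
    [FiniteDimensional ℝ F] [TopologicalSpace (TotalSpace F L)]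
    [FiberBundle F L] [VectorBundle ℝ F L] {x : M} (ψ : GrE L x) : L x →ₗ[ℝ] L x →L[ℝ] ℝ where
  toFun v := ⟨bilin ψ v, continuous_fibre F x _⟩
  map_add' v w := by ext; simp
  map_smul' c v := by ext; simp

lemma flat_apply {x : M} (ψ : GrE L x) (v w : L x) : flat F ψ v w = bilin ψ v w := rfl

lemma contr_eq_covec_flat {x : M} {ψ : GrE L x} (hψ : ψ ∈ dualPower L 2 x) (v : L x) :
    contr v ψ = covec (flat F ψ v) := by
  obtain ⟨ξ, hξ⟩ := mem_dualPower_one (contr_mem v hψ)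
  rw [hξ]
  congr 1
  ext w
  change _ = ExteriorAlgebra.algebraMapInv (contr w (contr v ψ))
  rw [hξ, contr_covec, ExteriorAlgebra.algebraMap_leftInverse]

/-! ### The graph of a two-form -/

section Graph

variable [T2Space M] {η : SecGr L}

lemma exists_secFlat (hη : η ∈ forms n F L 2) (s : SecL (n := n) F L) :
    ∃ ζ : SecDual (n := n) F L, ∀ x, ζ x = flat F (η x) (s x) := by
  refine exists_secDual _ fun t ↦ ?_
  have h := contMDiff_evalForm hη ![s, t]
  simp only [evalForm_two] at h
  exact h

/-- The section `i_s η` of `L*`. -/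
def secFlat (hη : η ∈ forms n F L 2) (s : SecL (n := n) F L) : SecDual (n := n) F L :=
  (exists_secFlat hη s).choose

lemma secFlat_apply (hη : η ∈ forms n F L 2) (s : SecL (n := n) F L) (x : M) :
    secFlat hη s x = flat F (η x) (s x) := (exists_secFlat hη s).choose_spec x

/-- The section of the graph of `η` over a section of `L`. -/
def graphSec (hη : η ∈ forms n F L 2) (s : SecL (n := n) F L) : SecE (n := n) F L :=
  (s, secFlat hη s)

/-- The graph of `η`, as a map from `L` to `L ⊕ L*`. -/
def graphMap (F : Type*) [NormedAddCommGroup F] [NormedSpace ℝ F]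
    [FiniteDimensional ℝ F] [TopologicalSpace (TotalSpace F L)]
    [FiberBundle F L] [VectorBundle ℝ F L] {x : M} (ψ : GrE L x) : L x →ₗ[ℝ] Dbl L x :=
  LinearMap.id.prod (flat F ψ)

lemma valE_graphSec (hη : η ∈ forms n F L 2) (s : SecL (n := n) F L) (x : M) :
    valE (graphSec hη s) x = graphMap F (η x) (s x) :=
  Prod.ext rfl (secFlat_apply hη s x)

/-- The graph is isotropic because the two-form is skew. This removes all derivative terms when the
Courant axioms are applied to sections of the graph. -/
lemma pairE_graphSec (hη : η ∈ forms n F L 2) (s t : SecL (n := n) F L) :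
    pairE (graphSec hη s) (graphSec hη t) = 0 := by
  ext x
  change secFlat hη s x (t x) + secFlat hη t x (s x) = 0
  rw [secFlat_apply, secFlat_apply, flat_apply, flat_apply, bilin_swap]
  ring

variable (C : CourantAlgebroid n F L) (cov : CovariantDerivative (𝓡 n) F L)

/-- The anchor of the graph of `η`. -/
def graphAnchor (η : SecGr L) (x : M) : L x →ₗ[ℝ] TangentSpace (𝓡 n) x :=
  C.anchor x ∘ₗ graphMap F (η x)

/-- The torsion, with values in `L`, of the bracket on the graph of `η`. -/
def graphTorsion (η : SecGr L) (x : M) : L x →ₗ[ℝ] L x →ₗ[ℝ] L x :=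
  ∑ δ, ((tensL C cov x (0, coframeL F L x δ)).compl₁₂ (graphMap F (η x)) (graphMap F (η x))
    - bilin (covGr cov η x (C.anchor x (0, coframeL F L x δ)))).compr₂
      (LinearMap.toSpanSingleton ℝ (L x) (frameL F L x δ x))

lemma graphTorsion_apply (η : SecGr L) (x : M) (v w : L x) :
    graphTorsion C cov η x v w =
      ∑ δ, (tensL C cov x (graphMap F (η x) v) (graphMap F (η x) w) (0, coframeL F L x δ)
        - bilin (covGr cov η x (C.anchor x (0, coframeL F L x δ))) v w) • frameL F L x δ x := by
  simp only [graphTorsion, LinearMap.sum_apply]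
  refine Finset.sum_congr rfl fun δ _ ↦ ?_
  rw [tensL_swap_right C cov x _ (0, coframeL F L x δ), ← tensL_swap_left]
  rfl

lemma graphTorsion_swap (η : SecGr L) (x : M) (v w : L x) :
    graphTorsion C cov η x v w = -graphTorsion C cov η x w v := by
  rw [graphTorsion_apply, graphTorsion_apply, ← Finset.sum_neg_distrib]
  refine Finset.sum_congr rfl fun δ _ ↦ ?_
  rw [tensL_swap_left, bilin_swap, ← neg_smul]
  ring_nf

/-- Each `hCov` applied to two graph sections has three terms, and they match the three terms of
`∇η` evaluated on the two base sections. -/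
lemma bilin_covGr (hη : η ∈ forms n F L 2) (s t : SecL (n := n) F L) (x : M)
    (v : TangentSpace (𝓡 n) x) :
    bilin (covGr cov η x v) (s x) (t x) = hCov cov x v (graphSec hη s) (graphSec hη t) := by
  have h := evalForm_covGr cov hη ![s, t] x v
  simp only [evalForm_two, Fin.sum_univ_two] at h
  refine h.trans ?_
  simp [hCov, graphSec, secFlat_apply, flat_apply]
  rw [bilin_swap (η x) (t x)]
  ring

/-- The `L`-component of the Courant bracket on the graph of `η`. -/
lemma covBracket_graph (hη : η ∈ forms n F L 2) (s t : SecL (n := n) F L) (x : M) :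
    covBracket cov (graphAnchor C η x) (graphTorsion C cov η x) s t
      = (C.bracket (graphSec hη s) (graphSec hη t)).1 x := by
  have key : graphTorsion C cov η x (s x) (t x)
      = cov t x (graphAnchor C η x (s x)) - cov s x (graphAnchor C η x (t x))
        - (C.bracket (graphSec hη s) (graphSec hη t)).1 x := by
    rw [graphTorsion_apply]
    conv_rhs => rw [← sum_coframeL_smul_frameL (F := F) x (_ - _ - _)]
    refine Finset.sum_congr rfl fun δ _ ↦ ?_
    congr 1
    -- Pairing with `a^δ` extracts the `L`-component. Besides `∇_{ρ(g_s)} t - ∇_{ρ(g_t)} s - [g_s,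
    -- g_t]`, the torsion contains `h(∇_{ρ(a^δ)} g_s, g_t)`, which is the `∇η` term subtracted in
    -- `graphTorsion`.
    have h := torsion_eq C cov (graphSec hη s) (graphSec hη t)
      (0, extDual F L x (coframeL F L x δ)) x
    have hζ : valE ((0, extDual F L x (coframeL F L x δ)) : SecE (n := n) F L) x
        = (0, coframeL F L x δ) := Prod.ext rfl (extDual_apply x _)
    have hcov : ∀ v, ∀ u : SecL (n := n) F L,
        hCov cov x v (graphSec hη u) (0, extDual F L x (coframeL F L x δ))
          = coframeL F L x δ (cov u x v) := by
      intro v u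
      have h1 : dirDeriv (fun y ↦ secFlat hη u y ((0 : SecL (n := n) F L) y)) x v = 0 :=
        (dirDeriv_congr (.of_forall fun y ↦ map_zero (secFlat hη u y)) v).trans
          (dirDeriv_const 0 x v)
      have h2 : cov (0 : SecL (n := n) F L) x v = 0 := by simp
      change dirDeriv (fun y ↦ secFlat hη u y ((0 : SecL (n := n) F L) y)) x v
        - secFlat hη u x (cov (0 : SecL (n := n) F L) x v)
        + extDual F L x (coframeL F L x δ) x (cov u x v) = _
      rw [h1, h2, extDual_apply, map_zero]
      ring
    have hpair : ∀ e : SecE (n := n) F L,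
        pairE e (0, extDual F L x (coframeL F L x δ)) x = coframeL F L x δ (e.1 x) := by
      intro e
      change e.2 x 0 + extDual F L x (coframeL F L x δ) x (e.1 x) = _
      rw [extDual_apply, map_zero, zero_add]
    rw [torsion, hcov, hcov, hpair, hζ, valE_graphSec, valE_graphSec] at h
    rw [← h, bilin_covGr cov hη, map_sub, map_sub]
    simp only [graphAnchor, LinearMap.comp_apply]
    ring
  rw [covBracket, key]
  abel

end Graph

end Graph

section RightContraction

/-! ### Interior products from the right -/

variable {M : Type*} {L : M → Type*} [∀ x, AddCommGroup (L x)] [∀ x, Module ℝ (L x)]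
  [∀ x, TopologicalSpace (L x)] {x : M}

lemma intR_mul_ι (d : Module.Dual ℝ (Dbl L x)) (a : GrE L x) (m : Dbl L x) :
    intR d (a * ExteriorAlgebra.ι ℝ m) = d m • a - intR d a * ExteriorAlgebra.ι ℝ m :=
  CliffordAlgebra.contractRight_mul_ι (Q := (0 : QuadraticForm ℝ (Dbl L x))) (d := d) m a

/-- The two contractions differ only by a sign depending on the degree. All rules for the right
contraction are reduced to the left one through the parity automorphism. -/
lemma intR_eq (d : Module.Dual ℝ (Dbl L x)) (a : GrE L x) :
    intR d a = CliffordAlgebra.involute (intL d a) := by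
  induction a using CliffordAlgebra.right_induction with
  | algebraMap r =>
    rw [intL_algebraMap, map_zero]
    exact CliffordAlgebra.contractRight_algebraMap (Q := (0 : QuadraticForm ℝ (Dbl L x))) d r
  | add a b ha hb =>
    rw [map_add, map_add, ← ha, ← hb]
    exact LinearMap.map_add₂ _ _ _ _
  | mul_ι m a ha =>
    refine (intR_mul_ι d a m).trans ?_
    have h1 : intL d (CliffordAlgebra.ι (0 : QuadraticForm ℝ (Dbl L x)) m)
        = algebraMap ℝ _ (d m) := CliffordAlgebra.contractLeft_ι _ _ _
    rw [intL_mul, map_add, map_mul, ← ha, map_mul, CliffordAlgebra.involute_involute, h1,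
      AlgHom.commutes, CliffordAlgebra.involute_ι, ← Algebra.commutes, ← Algebra.smul_def]
    rw [mul_neg, sub_eq_neg_add]

lemma intR_add (d : Module.Dual ℝ (Dbl L x)) (a b : GrE L x) :
    intR d (a + b) = intR d a + intR d b := by
  simp only [intR_eq, map_add]

lemma intR_neg (d : Module.Dual ℝ (Dbl L x)) (a : GrE L x) : intR d (-a) = -intR d a := by
  simp only [intR_eq, map_neg]

lemma intR_smul (d : Module.Dual ℝ (Dbl L x)) (c : ℝ) (a : GrE L x) :
    intR d (c • a) = c • intR d a := by
  simp only [intR_eq, map_smul]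

lemma intR_sum (d : Module.Dual ℝ (Dbl L x)) {ι : Type*} (s : Finset ι) (a : ι → GrE L x) :
    intR d (∑ i ∈ s, a i) = ∑ i ∈ s, intR d (a i) := by
  simp only [intR_eq, map_sum]

variable [∀ x, IsTopologicalAddGroup (L x)] [∀ x, ContinuousSMul ℝ (L x)]

lemma intR_covecDual_mul_covec (ξ ζ : L x →L[ℝ] ℝ) (a : GrE L x) :
    intR (covecDual ξ) (a * covec ζ) = -(intR (covecDual ξ) a * covec ζ) := by
  refine (intR_mul_ι _ a ((0, ζ) : Dbl L x)).trans ?_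
  have : covecDual ξ ((0, ζ) : Dbl L x) = 0 := map_zero ξ
  rw [this, zero_smul, zero_sub]
  rfl

lemma intR_covecDual_mul_vec (ξ : L x →L[ℝ] ℝ) (v : L x) (a : GrE L x) :
    intR (covecDual ξ) (a * vec v) = ξ v • a - intR (covecDual ξ) a * vec v :=
  intR_mul_ι _ a ((v, 0) : Dbl L x)

lemma intR_covecDual_of_mem {k : ℕ} (ξ : L x →L[ℝ] ℝ) {θ : GrE L x} (hθ : θ ∈ dualPower L k x) :
    intR (covecDual ξ) θ = 0 := by
  rw [intR_eq, intL_covecDual_of_mem ξ hθ, map_zero]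

lemma intR_covecDual_covec (ξ ζ : L x →L[ℝ] ℝ) : intR (covecDual ξ) (covec ζ : GrE L x) = 0 :=
  intR_covecDual_of_mem ξ (covec_mem ζ)

lemma intR_covecDual_vec (ξ : L x →L[ℝ] ℝ) (v : L x) :
    intR (covecDual ξ) (vec v : GrE L x) = ξ v • 1 := by
  have h := intR_covecDual_mul_vec ξ v 1
  rwa [one_mul, intR_covecDual_of_mem ξ one_mem_dualPower, zero_mul, sub_zero] at h

lemma intL_covecDual_vec_mul (ξ : L x →L[ℝ] ℝ) (v : L x) (a : GrE L x) :
    intL (covecDual ξ) (vec v * a) = ξ v • a - vec v * intL (covecDual ξ) a :=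
  CliffordAlgebra.contractLeft_ι_mul (d := covecDual ξ) ((v, 0) : Dbl L x) a

lemma intL_covecDual_covec (ξ ζ : L x →L[ℝ] ℝ) : intL (covecDual ξ) (covec ζ : GrE L x) = 0 :=
  intL_covecDual_of_mem ξ (covec_mem ζ)

lemma intL_covecDual_vec (ξ : L x →L[ℝ] ℝ) (v : L x) :
    intL (covecDual ξ) (vec v : GrE L x) = ξ v • 1 :=
  (CliffordAlgebra.contractLeft_ι (0 : QuadraticForm ℝ (Dbl L x)) (covecDual ξ)
    ((v, 0) : Dbl L x)).trans (Algebra.algebraMap_eq_smul_one _)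

section Frame

variable {ι : Type*} [Fintype ι] [DecidableEq ι] {a : ι → L x} {b : ι → L x →L[ℝ] ℝ}

lemma intR_sum_covec_covec_vec (h : ∀ α β, b α (a β) = if β = α then 1 else 0)
    (c : ι → ι → ι → ℝ) (δ : ι) :
    intR (covecDual (b δ)) ((1 / 2 : ℝ) • ∑ α, ∑ β, ∑ γ, c α β γ •
        (covec (b α) * covec (b β) * vec (a γ)) : GrE L x)
      = (1 / 2 : ℝ) • ∑ α, ∑ β, c α β δ • (covec (b α) * covec (b β)) := by
  simp [intR_smul, intR_sum, intR_covecDual_mul_vec, intR_covecDual_mul_covec,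
    intR_covecDual_covec, h]

/-- The two vector slots contribute equally by skewness of `c`, which cancels the factor one half.
-/
lemma intL_sum_vec_vec_covec (h : ∀ α β, b α (a β) = if β = α then 1 else 0)
    (c : ι → ι → ι → ℝ) (hc : ∀ α β γ, c β α γ = -c α β γ) (δ : ι) :
    intL (covecDual (b δ)) ((1 / 2 : ℝ) • ∑ α, ∑ β, ∑ γ, c α β γ •
        (vec (a α) * vec (a β) * covec (b γ)) : GrE L x)
      = ∑ β, ∑ γ, c δ β γ • (vec (a β) * covec (b γ)) := by
  simp only [map_smul, map_sum, mul_assoc, intL_covecDual_vec_mul, intL_covecDual_covec, h,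
    smul_sub, Finset.sum_sub_distrib, ite_smul, one_smul, zero_smul, smul_ite, smul_zero,
    mul_zero, sub_zero, mul_ite, Finset.sum_ite_irrel, Finset.sum_const_zero, Finset.sum_ite_eq',
    Finset.mem_univ, if_true]
  have : ∑ α, ∑ γ, c α δ γ • (vec (a α) * covec (b γ) : GrE L x)
      = -∑ β, ∑ γ, c δ β γ • (vec (a β) * covec (b γ)) := by
    simp only [← Finset.sum_neg_distrib, ← neg_smul, hc δ]
  rw [this]
  module

lemma intR_sum_vec_vec (h : ∀ α β, b α (a β) = if β = α then 1 else 0)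
    (c : ι → ι → ℝ) (hc : ∀ α β, c β α = -c α β) (δ : ι) :
    intR (covecDual (b δ)) ((1 / 2 : ℝ) • ∑ α, ∑ β, c α β • (vec (a α) * vec (a β)) : GrE L x)
      = ∑ α, c α δ • vec (a α) := by
  simp only [intR_smul, intR_sum, intR_covecDual_mul_vec, intR_covecDual_vec, h,
    smul_sub, Finset.sum_sub_distrib, ite_smul, one_smul, zero_smul, smul_ite, smul_zero,
    ite_mul, one_mul, zero_mul, Finset.sum_ite_irrel, Finset.sum_const_zero, Finset.sum_ite_eq',
    Finset.mem_univ, if_true]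
  have : ∑ β, c δ β • (vec (a β) : GrE L x) = -∑ α, c α δ • vec (a α) := by
    simp only [← Finset.sum_neg_distrib, ← neg_smul, hc _ δ]
  rw [this]
  module

/-- All three slots contribute equally by skewness, and three sixths make one half. -/
lemma intR_sum_vec_vec_vec (h : ∀ α β, b α (a β) = if β = α then 1 else 0)
    (c : ι → ι → ι → ℝ) (hc : ∀ α β γ, c β α γ = -c α β γ) (hc' : ∀ α β γ, c α γ β = -c α β γ)
    (δ : ι) :
    intR (covecDual (b δ)) ((1 / 6 : ℝ) • ∑ α, ∑ β, ∑ γ, c α β γ •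
        (vec (a α) * vec (a β) * vec (a γ)) : GrE L x)
      = (1 / 2 : ℝ) • ∑ α, ∑ β, c α β δ • (vec (a α) * vec (a β)) := by
  simp only [intR_smul, intR_sum, intR_covecDual_mul_vec, intR_covecDual_vec, h, sub_mul,
    smul_sub, Finset.sum_sub_distrib, ite_smul, one_smul, zero_smul, smul_ite, smul_zero,
    ite_mul, one_mul, zero_mul, Finset.sum_ite_irrel, Finset.sum_const_zero, Finset.sum_ite_eq',
    Finset.mem_univ, if_true]
  have h1 : ∑ α, ∑ β, c α δ β • (vec (a α) * vec (a β) : GrE L x)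
      = -∑ α, ∑ β, c α β δ • (vec (a α) * vec (a β)) := by
    simp only [← Finset.sum_neg_distrib, ← neg_smul]
    exact Finset.sum_congr rfl fun α _ ↦ Finset.sum_congr rfl fun β _ ↦ by rw [hc']
  have h2 : ∑ α, ∑ β, c δ α β • (vec (a α) * vec (a β) : GrE L x)
      = ∑ α, ∑ β, c α β δ • (vec (a α) * vec (a β)) :=
    Finset.sum_congr rfl fun α _ ↦ Finset.sum_congr rfl fun β _ ↦ by rw [hc, hc', neg_neg]
  rw [h1, h2]
  module

end Frame

end RightContraction

section Rothstein

variable {n : ℕ} {M : Type*} [TopologicalSpace M] [ChartedSpace (EuclideanSpace ℝ (Fin n)) M]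
  [IsManifold (𝓡 n) ∞ M]
variable {F : Type*} [NormedAddCommGroup F] [NormedSpace ℝ F] [FiniteDimensional ℝ F]
variable {L : M → Type*} [∀ x, AddCommGroup (L x)] [∀ x, Module ℝ (L x)]
  [∀ x, TopologicalSpace (L x)] [TopologicalSpace (TotalSpace F L)]
  [∀ x, IsTopologicalAddGroup (L x)] [∀ x, ContinuousSMul ℝ (L x)]
  [FiberBundle F L] [VectorBundle ℝ F L] [ContMDiffVectorBundle ∞ F L (𝓡 n)]

/-! ### Rothstein-Poisson brackets with forms -/

variable (cov : CovariantDerivative (𝓡 n) F L)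

lemma dP_pull (θ : SecGr L) (i : Fin n) (x : M) (p : TangentSpace (𝓡 n) x →L[ℝ] ℝ) :
    dP (pull n θ) i x p = 0 :=
  (HasCurveDeriv.const (θ x)).curveDeriv_eq

section Affine

variable {ι : Type*} [Fintype ι] {Φ : SecPull n L} {x : M} {K : GrE L x}
  {w : ι → TangentSpace (𝓡 n) x} {g : ι → GrE L x}

lemma dP_of_affine (hΦ : ∀ q, Φ x q = K + ∑ α, q (w α) • g α) (i : Fin n)
    (p : TangentSpace (𝓡 n) x →L[ℝ] ℝ) :
    dP Φ i x p = ∑ α, coordForm x i (w α) • g α := by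
  have h : (fun t : ℝ ↦ Φ x (p + t • coordForm x i))
      = fun t ↦ Φ x p + t • ∑ α, coordForm x i (w α) • g α := by
    funext t
    rw [hΦ, hΦ, add_assoc, Finset.smul_sum, ← Finset.sum_add_distrib]
    refine congrArg (K + ·) (Finset.sum_congr rfl fun α _ ↦ ?_)
    rw [smul_smul, ← add_smul]
    rfl
  rw [dP, h, curveDeriv_affine]

/-- A pulled back form has no momentum derivative, so neither the curvature term nor `∇Φ` occurs,
and of the metric term only the contractions of the form with vectors of `L` survive. It therefore
suffices that `Φ` is affine in the momenta over the single point `x`. -/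
lemma roth_pull_right {θ : SecGr L} (hθ : θ ∈ allForms n F L)
    (hΦ : ∀ q, Φ x q = K + ∑ α, q (w α) • g α) (p : TangentSpace (𝓡 n) x →L[ℝ] ℝ) :
    roth cov Φ (pull n θ) x p = -∑ α, g α * covGr cov θ x (w α)
      + ∑ δ, intR (covecDual (coframeL F L x δ)) (Φ x p)
        * contr (frameL F L x δ x) (θ x) := by
  have h1 : ∀ α, intL (covecDual (coframeL F L x α)) (pull n θ x p) = 0 := fun α ↦
    intL_covecDual_of_mem_allForms hθ _
  simp only [roth, dP_pull, mul_zero, zero_sub, Finset.sum_const_zero, smul_zero, sub_zero,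
    dP_of_affine hΦ, Fintype.sum_sum_type, coframeE, Sum.swap_inl, Sum.swap_inr, Sum.elim_inl,
    Sum.elim_inr, h1, add_zero, intL_vecDual, Finset.sum_neg_distrib, covGr, Finset.mul_sum,
    mul_smul_comm, Finset.sum_mul, smul_mul_assoc, dQ_pull_eq cov θ _ x p]
  rw [Finset.sum_comm]
  rfl

lemma roth_pull_left {k : ℕ} {θ : SecGr L} (hθ : θ ∈ forms n F L k)
    (hΦ : ∀ q, Φ x q = K + ∑ α, q (w α) • g α) (p : TangentSpace (𝓡 n) x →L[ℝ] ℝ) :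
    roth cov (pull n θ) Φ x p = ∑ α, covGr cov θ x (w α) * g α
      + ∑ δ, CliffordAlgebra.involute (contr (frameL F L x δ x) (θ x))
        * intL (covecDual (coframeL F L x δ)) (Φ x p) := by
  have h1 : ∀ α, intR (covecDual (coframeL F L x α)) (pull n θ x p) = 0 := fun α ↦
    intR_covecDual_of_mem _ (hθ.1 x)
  simp only [roth, dP_pull, mul_zero, zero_mul, sub_zero, Finset.sum_const_zero, smul_zero,
    dP_of_affine hΦ, Fintype.sum_sum_type, coframeE, Sum.swap_inl, Sum.swap_inr, Sum.elim_inl,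
    Sum.elim_inr, h1, zero_add, intR_eq (vecDual _), intL_vecDual, covGr, Finset.mul_sum,
    mul_smul_comm, Finset.sum_mul, smul_mul_assoc, dQ_pull_eq cov θ _ x p]
  rw [Finset.sum_comm]
  rfl

end Affine

variable (C : CourantAlgebroid n F L) [T2Space M]

lemma muElt_apply (x : M) (q : TangentSpace (𝓡 n) x →L[ℝ] ℝ) :
    muElt C cov x q = (1 / 2 : ℝ) • ∑ α, ∑ β, ∑ γ,
        tensL C cov x (frameL F L x α x, 0) (frameL F L x β x, 0) (0, coframeL F L x γ) •
          (covec (coframeL F L x α) * covec (coframeL F L x β) * vec (frameL F L x γ x))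
      + ∑ α, q (C.anchor x (frameL F L x α x, 0)) • -covec (coframeL F L x α) := by
  simp only [smul_neg, Finset.sum_neg_distrib]
  exact add_comm _ _

lemma roth_muElt {θ : SecGr L} (hθ : θ ∈ allForms n F L) (x : M)
    (p : TangentSpace (𝓡 n) x →L[ℝ] ℝ) :
    roth cov (muElt C cov) (pull n θ) x p
      = ∑ α, covec (coframeL F L x α) * covGr cov θ x (C.anchor x (frameL F L x α x, 0))
      + ∑ δ, ((1 / 2 : ℝ) • ∑ α, ∑ β,
          tensL C cov x (frameL F L x α x, 0) (frameL F L x β x, 0) (0, coframeL F L x δ) •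
            (covec (coframeL F L x α) * covec (coframeL F L x β)))
        * contr (frameL F L x δ x) (θ x) := by
  rw [roth_pull_right cov hθ (fun q ↦ muElt_apply cov C x q) p]
  simp only [neg_mul, Finset.sum_neg_distrib, neg_neg]
  congr 1
  refine Finset.sum_congr rfl fun δ _ ↦ ?_
  congr 1
  simp only [muElt_apply, intR_add, intR_sum_covec_covec_vec (coframeL_frameL (F := F) x)
    (fun α β γ ↦ tensL C cov x (frameL F L x α x, 0) (frameL F L x β x, 0) (0, coframeL F L x γ)),
    intR_sum, intR_smul, intR_neg, intR_covecDual_covec, neg_zero, smul_zero,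
    Finset.sum_const_zero, add_zero]

lemma gammaElt_apply (x : M) (q : TangentSpace (𝓡 n) x →L[ℝ] ℝ) :
    gammaElt C cov x q = (1 / 2 : ℝ) • ∑ α, ∑ β, ∑ γ,
        tensL C cov x (0, coframeL F L x α) (0, coframeL F L x β) (frameL F L x γ x, 0) •
          (vec (frameL F L x α x) * vec (frameL F L x β x) * covec (coframeL F L x γ))
      + ∑ α, q (C.anchor x (0, coframeL F L x α)) • -vec (frameL F L x α x) := by
  simp only [smul_neg, Finset.sum_neg_distrib]
  exact add_comm _ _

/-- The result is again affine in the momenta, with `ρ(a^δ)` now attached to `i_{a_δ} η`. This is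
the form needed for taking a further bracket with a form. -/
lemma roth_gammaElt {η : SecGr L} (hη : η ∈ forms n F L 2) (x : M)
    (p : TangentSpace (𝓡 n) x →L[ℝ] ℝ) :
    roth cov (pull n η) (gammaElt C cov) x p
      = (-∑ α, covGr cov η x (C.anchor x (0, coframeL F L x α)) * vec (frameL F L x α x)
        - ∑ δ, covec (flat F (η x) (frameL F L x δ x)) * ∑ β, ∑ γ,
          tensL C cov x (0, coframeL F L x δ) (0, coframeL F L x β) (frameL F L x γ x, 0) •
            (vec (frameL F L x β x) * covec (coframeL F L x γ)))
      + ∑ δ, p (C.anchor x (0, coframeL F L x δ)) • covec (flat F (η x) (frameL F L x δ x)) := by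
  rw [roth_pull_left cov hη (fun q ↦ gammaElt_apply cov C x q) p, gammaElt_apply]
  have h1 : ∀ ξ : L x →L[ℝ] ℝ, CliffordAlgebra.involute (covec ξ : GrE L x) = -covec ξ :=
    fun ξ ↦ CliffordAlgebra.involute_ι _
  simp only [contr_eq_covec_flat (F := F) (hη.1 x), h1, map_add,
    intL_sum_vec_vec_covec (coframeL_frameL (F := F) x)
    (fun α β γ ↦ tensL C cov x (0, coframeL F L x α) (0, coframeL F L x β) (frameL F L x γ x, 0))
    (fun α β γ ↦ tensL_swap_left C cov x _ _ _)]
  simp only [map_sum, map_smul, map_neg, intL_covecDual_vec, coframeL_frameL, ite_smul, one_smul,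
    zero_smul, mul_neg, Finset.sum_neg_distrib, smul_neg, smul_ite, smul_zero, mul_add,
    Finset.sum_add_distrib, neg_mul, neg_neg, Finset.sum_ite_eq', Finset.mem_univ, if_true,
    Finset.mul_sum, mul_smul_comm, mul_one]
  abel

end Rothstein

section Brackets

variable {n : ℕ} {M : Type*} [TopologicalSpace M] [ChartedSpace (EuclideanSpace ℝ (Fin n)) M]
  [IsManifold (𝓡 n) ∞ M]
variable {F : Type*} [NormedAddCommGroup F] [NormedSpace ℝ F] [FiniteDimensional ℝ F]
variable {L : M → Type*} [∀ x, AddCommGroup (L x)] [∀ x, Module ℝ (L x)]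
  [∀ x, TopologicalSpace (L x)] [TopologicalSpace (TotalSpace F L)]
  [∀ x, IsTopologicalAddGroup (L x)] [∀ x, ContinuousSMul ℝ (L x)]
  [FiberBundle F L] [VectorBundle ℝ F L] [ContMDiffVectorBundle ∞ F L (𝓡 n)]

/-! ### The derived brackets and the twisted differential as first order operators -/

variable (cov : CovariantDerivative (𝓡 n) F L) (C : CourantAlgebroid n F L) [T2Space M]

lemma gammaBracket_apply {η : SecGr L} (hη : η ∈ forms n F L 2) {θ : SecGr L}
    (hθ : θ ∈ allForms n F L) (x : M) (p : TangentSpace (𝓡 n) x →L[ℝ] ℝ) :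
    gammaBracket C cov (pull n η) (pull n θ) x p
      = -∑ δ, covec (flat F (η x) (frameL F L x δ x))
          * covGr cov θ x (C.anchor x (0, coframeL F L x δ))
        + ∑ ε, (-covGr cov η x (C.anchor x (0, coframeL F L x ε))
          + ∑ δ, ∑ γ, tensL C cov x (0, coframeL F L x δ) (0, coframeL F L x ε)
              (frameL F L x γ x, 0) •
            (covec (flat F (η x) (frameL F L x δ x)) * covec (coframeL F L x γ)))
          * contr (frameL F L x ε x) (θ x) := by
  rw [gammaBracket, roth_pull_right cov hθ (fun q ↦ roth_gammaElt cov C hη x q) p, roth_gammaElt cov C hη]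
  congr 1
  refine Finset.sum_congr rfl fun ε _ ↦ ?_
  congr 1
  have h : ∀ (ξ : L x →L[ℝ] ℝ) v, intR (covecDual ξ) (covGr cov η x v) = 0 :=
    fun ξ v ↦ intR_covecDual_of_mem ξ (covGr_mem cov hη x v)
  simp only [intR_add, sub_eq_add_neg, intR_neg, intR_sum, intR_smul, intR_covecDual_mul_vec, h,
    intR_covecDual_covec, coframeL_frameL, Finset.mul_sum, mul_smul_comm, ← mul_assoc,
    intR_covecDual_mul_covec, zero_mul, smul_zero, add_zero, neg_zero, ite_smul, one_smul, zero_smul,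
    Finset.sum_ite_eq', Finset.mem_univ, if_true, Finset.sum_const_zero, ite_mul, smul_ite,
    smul_neg, Finset.sum_neg_distrib, neg_neg, Finset.sum_ite_irrel]

lemma roth_pull_right_of_const {Φ : SecPull n L} {x : M} {K : GrE L x} (hΦ : ∀ q, Φ x q = K)
    {θ : SecGr L} (hθ : θ ∈ allForms n F L) (p : TangentSpace (𝓡 n) x →L[ℝ] ℝ) :
    roth cov Φ (pull n θ) x p = ∑ δ, intR (covecDual (coframeL F L x δ)) K
        * contr (frameL F L x δ x) (θ x) := by
  rw [roth_pull_right cov hθ (K := K) (w := fun i : Fin 0 ↦ i.elim0) (g := fun i ↦ i.elim0)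
    (fun q ↦ by simp [hΦ]) p]
  simp [hΦ]

/-- No momenta occur in `φ`, so every bracket reduces to the pairing term: each of the first two
replaces one vector of `φ` by a contraction of `η`, and the last one contracts `θ` with the
remaining vector. -/
lemma phiBracket_apply {η : SecGr L} (hη : η ∈ forms n F L 2) {θ : SecGr L}
    (hθ : θ ∈ allForms n F L) (x : M) (p : TangentSpace (𝓡 n) x →L[ℝ] ℝ) :
    phiBracket C cov (pull n η) (pull n η) (pull n θ) x p
      = ∑ κ, (-∑ ε, ∑ δ, tensL C cov x (0, coframeL F L x κ) (0, coframeL F L x ε)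
              (0, coframeL F L x δ) •
            (covec (flat F (η x) (frameL F L x δ x)) * covec (flat F (η x) (frameL F L x ε x))))
          * contr (frameL F L x κ x) (θ x) := by
  have h1 : ∀ q, roth cov (phiElt C cov) (pull n η) x q = _ := fun q ↦
    roth_pull_right_of_const cov (fun q ↦ rfl) (mem_allForms hη) q
  have hT := fun α β γ : Fin (Module.finrank ℝ F) ↦ tensL_swap_left C cov x
    (0, coframeL F L x α) (0, coframeL F L x β) (0, coframeL F L x γ)
  have hT' := fun α β γ : Fin (Module.finrank ℝ F) ↦ tensL_swap_right C cov x
    (0, coframeL F L x α) (0, coframeL F L x β) (0, coframeL F L x γ)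
  have h2 := fun δ ↦ intR_sum_vec_vec_vec (coframeL_frameL (F := F) (L := L) x)
    (fun α β γ ↦ tensL C cov x (0, coframeL F L x α) (0, coframeL F L x β) (0, coframeL F L x γ))
    hT hT' δ
  have h3 := fun ε δ ↦ intR_sum_vec_vec (coframeL_frameL (F := F) (L := L) x)
    (fun α β ↦ tensL C cov x (0, coframeL F L x α) (0, coframeL F L x β) (0, coframeL F L x δ))
    (fun α β ↦ hT α β δ) ε
  replace h1 : ∀ q, roth cov (phiElt C cov) (pull n η) x q
      = ∑ δ, ((1 / 2 : ℝ) • ∑ α, ∑ β, tensL C cov x (0, coframeL F L x α) (0, coframeL F L x β)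
          (0, coframeL F L x δ) • (vec (frameL F L x α x) * vec (frameL F L x β x)))
        * covec (flat F (η x) (frameL F L x δ x)) := by
    intro q
    rw [h1]
    refine Finset.sum_congr rfl fun δ _ ↦ ?_
    rw [← h2, contr_eq_covec_flat (F := F) (hη.1 x)]
    rfl
  have h4 : ∀ q, roth cov (roth cov (phiElt C cov) (pull n η)) (pull n η) x q
      = -∑ ε, ∑ δ, ∑ α, tensL C cov x (0, coframeL F L x α) (0, coframeL F L x ε)
          (0, coframeL F L x δ) • (vec (frameL F L x α x)
            * (covec (flat F (η x) (frameL F L x δ x))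
              * covec (flat F (η x) (frameL F L x ε x)))) := by
    intro q
    rw [roth_pull_right_of_const cov h1 (mem_allForms hη), ← Finset.sum_neg_distrib]
    refine Finset.sum_congr rfl fun ε _ ↦ ?_
    rw [intR_sum]
    simp only [intR_covecDual_mul_covec, h3, contr_eq_covec_flat (F := F) (hη.1 x)]
    simp only [Finset.sum_neg_distrib, neg_mul, Finset.sum_mul, smul_mul_assoc, mul_assoc]
  rw [phiBracket, roth_pull_right_of_const cov h4 hθ]
  refine Finset.sum_congr rfl fun κ _ ↦ ?_
  congr 1
  simp only [intR_neg, intR_sum, intR_smul, ← mul_assoc, intR_covecDual_mul_covec,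
    intR_covecDual_vec, coframeL_frameL, neg_mul, neg_neg, ite_mul, one_mul, zero_mul, ite_smul,
    one_smul, zero_smul, smul_ite, smul_zero, Finset.sum_ite_eq', Finset.mem_univ, if_true]

end Brackets

section TwistedDifferential

variable {n : ℕ} {M : Type*} [TopologicalSpace M] [ChartedSpace (EuclideanSpace ℝ (Fin n)) M]
  [IsManifold (𝓡 n) ∞ M]
variable {F : Type*} [NormedAddCommGroup F] [NormedSpace ℝ F] [FiniteDimensional ℝ F]
variable {L : M → Type*} [∀ x, AddCommGroup (L x)] [∀ x, Module ℝ (L x)]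
  [∀ x, TopologicalSpace (L x)] [TopologicalSpace (TotalSpace F L)]
  [∀ x, IsTopologicalAddGroup (L x)] [∀ x, ContinuousSMul ℝ (L x)]
  [FiberBundle F L] [VectorBundle ℝ F L] [ContMDiffVectorBundle ∞ F L (𝓡 n)]

/-! ### The twisted differential -/

lemma bilin_add {x : M} (ψ ψ' : GrE L x) (v w : L x) :
    bilin (ψ + ψ') v w = bilin ψ v w + bilin ψ' v w := by
  simp [bilin]

lemma bilin_neg {x : M} (ψ : GrE L x) (v w : L x) : bilin (-ψ) v w = -bilin ψ v w := by
  simp [bilin]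

lemma bilin_sum {x : M} {ι : Type*} (s : Finset ι) (ψ : ι → GrE L x) (v w : L x) :
    bilin (∑ i ∈ s, ψ i) v w = ∑ i ∈ s, bilin (ψ i) v w := by
  simp [bilin]

lemma bilin_covec_mul_covec {x : M} (ξ ζ : L x →L[ℝ] ℝ) (v w : L x) :
    bilin (covec ξ * covec ζ) v w = ξ v * ζ w - ζ v * ξ w := by
  change ExteriorAlgebra.algebraMapInv (contr w (contr v (covec ξ * covec ζ))) = _
  rw [contr_covec_mul, contr_covec, ← Algebra.commutes, ← Algebra.smul_def, map_sub, map_smul,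
    map_smul, contr_covec, contr_covec, map_sub, map_smul, map_smul,
    ExteriorAlgebra.algebraMap_leftInverse, ExteriorAlgebra.algebraMap_leftInverse,
    smul_eq_mul, smul_eq_mul]

lemma covec_mul_covec_mem {x : M} (ξ ζ : L x →L[ℝ] ℝ) :
    (covec ξ * covec ζ : GrE L x) ∈ dualPower L 2 x :=
  covec_mul_mem ξ (covec_mem ζ)

lemma sum_apply_smul_coframeL (x : M) (ξ : L x →L[ℝ] ℝ) :
    ∑ α, ξ (frameL F L x α x) • coframeL F L x α = ξ := by
  ext v
  conv_rhs => rw [← sum_coframeL_smul_frameL (F := F) x v]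
  simp [mul_comm]

/-- A skew bilinear form is recovered from its components: the wedge of two covectors evaluates to
two terms, equal after summation, and the half compensates for this. -/
lemma bilin_half_sum {x : M} (B : L x →ₗ[ℝ] L x →ₗ[ℝ] ℝ) (hB : ∀ v w, B v w = -B w v)
    (v w : L x) :
    bilin ((1 / 2 : ℝ) • ∑ α, ∑ β, B (frameL F L x α x) (frameL F L x β x) •
      (covec (coframeL F L x α) * covec (coframeL F L x β)) : GrE L x) v w = B v w := by
  have h : ∀ v w, ∑ α, ∑ β, B (frameL F L x α x) (frameL F L x β x) *
      (coframeL F L x α v * coframeL F L x β w) = B v w := by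
    intro v w
    conv_rhs => rw [← sum_coframeL_smul_frameL (F := F) x v, ← sum_coframeL_smul_frameL (F := F) x w]
    simp only [map_sum, map_smul, LinearMap.sum_apply, LinearMap.smul_apply, smul_eq_mul,
      Finset.mul_sum]
    rw [Finset.sum_comm]
    exact Finset.sum_congr rfl fun α _ ↦ Finset.sum_congr rfl fun β _ ↦ by ring
  simp only [bilin_smul, bilin_sum, bilin_covec_mul_covec, mul_sub, Finset.sum_sub_distrib]
  have h' : ∑ α, ∑ β, B (frameL F L x α x) (frameL F L x β x) *
      (coframeL F L x β v * coframeL F L x α w) = B w v := by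
    rw [← h w v]
    exact Finset.sum_congr rfl fun α _ ↦ Finset.sum_congr rfl fun β _ ↦ by ring
  rw [h, h', hB w v]
  ring

variable (cov : CovariantDerivative (𝓡 n) F L) (C : CourantAlgebroid n F L)

/-- Expanding `i_{a_δ} ψ` in the coframe and transposing the matrix of `ψ` moves the flat map to the
argument of the anchor; the sign is the skewness of `ψ`. -/
lemma sum_flat_covGr (ψ : ∀ x, GrE L x) (θ : SecGr L) (x : M) :
    ∑ δ, covec (flat F (ψ x) (frameL F L x δ x))
        * covGr cov θ x (C.anchor x (0, coframeL F L x δ))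
      = -∑ α, covec (coframeL F L x α)
        * covGr cov θ x (C.anchor x (0, flat F (ψ x) (frameL F L x α x))) := by
  let G : (L x →L[ℝ] ℝ) →ₗ[ℝ] GrE L x :=
    ⟨⟨covGr cov θ x, covGr_map_add cov θ x⟩, covGr_map_smul cov θ x⟩
      ∘ₗ C.anchor x ∘ₗ LinearMap.inr ℝ _ _
  have h1 : ∀ ξ, covGr cov θ x (C.anchor x (0, ξ)) = G ξ := fun _ ↦ rfl
  have h2 : ∀ α, G (flat F (ψ x) (frameL F L x α x))
      = ∑ δ, bilin (ψ x) (frameL F L x α x) (frameL F L x δ x) • G (coframeL F L x δ) := by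
    intro α
    conv_lhs => rw [← sum_apply_smul_coframeL (F := F) x (flat F (ψ x) (frameL F L x α x)), map_sum]
    simp only [map_smul, flat_apply]
  have h3 : ∀ δ, covec (flat F (ψ x) (frameL F L x δ x))
      = ∑ α, bilin (ψ x) (frameL F L x δ x) (frameL F L x α x) • covec (coframeL F L x α) := by
    intro δ
    conv_lhs => rw [← sum_apply_smul_coframeL (F := F) x (flat F (ψ x) (frameL F L x δ x)), map_sum]
    simp only [map_smul, flat_apply]
  simp only [h1, h2, h3, Finset.sum_mul, Finset.mul_sum, ← Finset.sum_neg_distrib]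
  rw [Finset.sum_comm]
  refine Finset.sum_congr rfl fun α _ ↦ Finset.sum_congr rfl fun δ _ ↦ ?_
  rw [bilin_swap, smul_mul_assoc, mul_smul_comm, neg_smul]

lemma derivTwo_sum_smul {x : M} {ι : Type*} [Fintype ι] {a : ι → L x} {b : ι → L x →L[ℝ] ℝ}
    (τ : L x →ₗ[ℝ] L x →ₗ[ℝ] L x) (t : ι → L x → L x → ℝ) (h : ∀ v w, τ v w = ∑ κ, t κ v w • a κ)
    (θ : GrE L x) :
    derivTwo a b τ θ = ∑ κ, ((1 / 2 : ℝ) • ∑ α, ∑ β, t κ (a α) (a β) •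
      (covec (b α) * covec (b β))) * contr (a κ) θ := by
  simp only [derivTwo, deriv, h, map_sum, map_smul, LinearMap.sum_apply, LinearMap.smul_apply,
    Finset.mul_sum, mul_smul_comm, Finset.sum_mul, smul_mul_assoc, ← Finset.smul_sum, mul_assoc]
  congr 1
  rw [Finset.sum_comm' (t' := Finset.univ) (s' := fun _ ↦ Finset.univ) (by simp)]
  conv_rhs => rw [Finset.sum_comm]
  rw [Finset.sum_comm]
  refine Finset.sum_congr rfl fun α _ ↦ ?_
  rw [Finset.sum_comm]

variable [T2Space M]

/-- The two-form components of the twisted differential. -/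
lemma graphTorsion_component {η : SecGr L} (hη : η ∈ forms n F L 2) (x : M)
    (κ : Fin (Module.finrank ℝ F)) :
    (1 / 2 : ℝ) • ∑ α, ∑ β,
        (tensL C cov x (graphMap F (η x) (frameL F L x α x)) (graphMap F (η x) (frameL F L x β x))
            (0, coframeL F L x κ)
          - bilin (covGr cov η x (C.anchor x (0, coframeL F L x κ)))
            (frameL F L x α x) (frameL F L x β x)) •
          (covec (coframeL F L x α) * covec (coframeL F L x β))
      = (1 / 2 : ℝ) • ∑ α, ∑ β,
          tensL C cov x (frameL F L x α x, 0) (frameL F L x β x, 0) (0, coframeL F L x κ) •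
            (covec (coframeL F L x α) * covec (coframeL F L x β))
        + (-covGr cov η x (C.anchor x (0, coframeL F L x κ))
          + ∑ δ, ∑ γ, tensL C cov x (0, coframeL F L x δ) (0, coframeL F L x κ)
              (frameL F L x γ x, 0) •
            (covec (flat F (η x) (frameL F L x δ x)) * covec (coframeL F L x γ)))
        + (1 / 2 : ℝ) • (-∑ ε, ∑ δ, tensL C cov x (0, coframeL F L x κ) (0, coframeL F L x ε)
              (0, coframeL F L x δ) •
            (covec (flat F (η x) (frameL F L x δ x))
              * covec (flat F (η x) (frameL F L x ε x)))) := by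
  have hm := fun ξ ζ : L x →L[ℝ] ℝ ↦ covec_mul_covec_mem ξ ζ
  refine eq_of_evalForm_eq (sum_coframeL_smul_frameL (F := F) x) (k := 2) ?_ ?_ fun v ↦ ?_
  · exact Submodule.smul_mem _ _ (Submodule.sum_mem _ fun _ _ ↦ Submodule.sum_mem _ fun _ _ ↦
      Submodule.smul_mem _ _ (hm _ _))
  · refine add_mem (add_mem ?_ (add_mem (neg_mem (covGr_mem cov hη x _)) ?_))
      (Submodule.smul_mem _ _ (neg_mem ?_))
    · exact Submodule.smul_mem _ _ (Submodule.sum_mem _ fun _ _ ↦ Submodule.sum_mem _ fun _ _ ↦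
        Submodule.smul_mem _ _ (hm _ _))
    · exact Submodule.sum_mem _ fun _ _ ↦ Submodule.sum_mem _ fun _ _ ↦
        Submodule.smul_mem _ _ (hm _ _)
    · exact Submodule.sum_mem _ fun _ _ ↦ Submodule.sum_mem _ fun _ _ ↦
        Submodule.smul_mem _ _ (hm _ _)
  rw [evalForm_two, evalForm_two]
  generalize v 0 = X
  generalize v 1 = Y
  set T := tensL C cov x with hT
  set k : Dbl L x := (0, coframeL F L x κ) with hk
  let iL : L x →ₗ[ℝ] Dbl L x := LinearMap.inl ℝ _ _
  let iR : (L x →L[ℝ] ℝ) →ₗ[ℝ] Dbl L x := LinearMap.inr ℝ _ _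
  have hL : ∀ Z, iL Z = (Z, 0) := fun _ ↦ rfl
  have hR : ∀ ξ, iR ξ = (0, ξ) := fun _ ↦ rfl
  have e1 := bilin_half_sum (F := F) ((T k).compl₁₂ (graphMap F (η x)) (graphMap F (η x))
    - bilin (covGr cov η x (C.anchor x k))) (fun v w ↦ by
      simp only [LinearMap.sub_apply, LinearMap.compl₁₂_apply]
      rw [bilin_swap, tensL_swap_right]; ring) X Y
  have e2 := bilin_half_sum (F := F) ((T k).compl₁₂ iL iL) (fun v w ↦ by
      simp only [LinearMap.compl₁₂_apply]
      rw [tensL_swap_right]) X Y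
  -- Skewness in neighbouring arguments makes the torsion invariant under cyclic permutations.
  have cyc : ∀ u v, T u v k = T k u v := fun u v ↦ by
    rw [tensL_swap_right C cov x u k v, tensL_swap_left C cov x k u v, neg_neg]
  have f1 : ∀ Z : L x, ∑ δ, flat F (η x) (frameL F L x δ x) Z • coframeL F L x δ
      = -flat F (η x) Z := fun Z ↦ by
    conv_rhs => rw [← sum_apply_smul_coframeL (F := F) x (flat F (η x) Z), ← Finset.sum_neg_distrib]
    refine Finset.sum_congr rfl fun δ _ ↦ ?_
    rw [flat_apply, flat_apply, bilin_swap]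
    ext w
    exact neg_mul _ _
  have f2 : ∀ Z : L x, flat F (η x) Z
      = -∑ δ, flat F (η x) (frameL F L x δ x) Z • coframeL F L x δ := fun Z ↦ by rw [f1, neg_neg]
  have e3 : ∀ X Y : L x, ∑ δ, ∑ γ, T (0, coframeL F L x δ) k (frameL F L x γ x, 0) *
      (flat F (η x) (frameL F L x δ x) X * coframeL F L x γ Y)
      = -T (iR (flat F (η x) X)) k (iL Y) := by
    intro X Y
    conv_rhs => rw [f2 X, ← sum_coframeL_smul_frameL (F := F) x Y]
    simp only [map_sum, map_smul, LinearMap.sum_apply, LinearMap.smul_apply, smul_eq_mul,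
      Finset.mul_sum, map_neg, LinearMap.neg_apply, mul_neg, Finset.sum_neg_distrib, neg_neg]
    rw [Finset.sum_comm]
    refine Finset.sum_congr rfl fun α _ ↦ Finset.sum_congr rfl fun β _ ↦ ?_
    rw [hL, hR]
    ring
  have e4 : ∀ X Y : L x, ∑ ε, ∑ δ, T k (0, coframeL F L x ε) (0, coframeL F L x δ) *
      (flat F (η x) (frameL F L x δ x) X * flat F (η x) (frameL F L x ε x) Y)
      = T k (iR (flat F (η x) Y)) (iR (flat F (η x) X)) := by
    intro X Y
    conv_rhs => rw [f2 X, f2 Y]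
    simp only [map_sum, map_smul, LinearMap.sum_apply, LinearMap.smul_apply, smul_eq_mul,
      Finset.mul_sum, map_neg, LinearMap.neg_apply, mul_neg, Finset.sum_neg_distrib, neg_neg]
    rw [Finset.sum_comm]
    refine Finset.sum_congr rfl fun α _ ↦ Finset.sum_congr rfl fun β _ ↦ ?_
    rw [hR, hR]
    ring
  have e5 : ∀ Z : L x, graphMap F (η x) Z = iL Z + iR (flat F (η x) Z) := fun Z ↦ by
    simp [graphMap, iL, iR]
  simp only [LinearMap.sub_apply, LinearMap.compl₁₂_apply] at e1 e2
  simp only [cyc]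
  rw [bilin_add, bilin_add, bilin_add, bilin_neg, bilin_smul _ (-_), bilin_neg, e1]
  refine Eq.trans ?_ (congrArg (fun z ↦ z + _ + _) e2.symm)
  simp only [bilin_sum, bilin_smul, bilin_covec_mul_covec, mul_sub, Finset.sum_sub_distrib, e4]
  have e3' : ∑ δ, ∑ γ, T (0, coframeL F L x δ) k (frameL F L x γ x, 0) *
      (coframeL F L x γ X * flat F (η x) (frameL F L x δ x) Y)
      = -T (iR (flat F (η x) Y)) k (iL X) := by
    rw [← e3]
    exact Finset.sum_congr rfl fun α _ ↦ Finset.sum_congr rfl fun β _ ↦ by ring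
  have e4' : ∑ ε, ∑ δ, T k (0, coframeL F L x ε) (0, coframeL F L x δ) *
      (flat F (η x) (frameL F L x ε x) X * flat F (η x) (frameL F L x δ x) Y)
      = T k (iR (flat F (η x) X)) (iR (flat F (η x) Y)) := by
    rw [← e4]
    exact Finset.sum_congr rfl fun α _ ↦ Finset.sum_congr rfl fun β _ ↦ by ring
  rw [e3, e3', e4', e5, e5]
  -- Expanding `T(k, g_X, g_Y)` with `g = inl + inr ∘ flat` gives four terms: the one without `η`
  -- belongs to `μ`, the two linear ones to `γ`, and the quadratic one to `φ`.
  simp only [map_add, LinearMap.add_apply]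
  rw [tensL_swap_left C cov x k (iR (flat F (η x) X)) (iL Y),
    tensL_swap_left C cov x k (iR (flat F (η x) Y)) (iL X),
    tensL_swap_right C cov x k (iR (flat F (η x) X)) (iR (flat F (η x) Y)),
    tensL_swap_right C cov x k (iL X) (iR (flat F (η x) Y))]
  ring

/-- The derivative terms of `μ` and `γ` combine to the anchor `ρ(a_α) + ρ(i_{a_α} η)` of the graph,
and the algebraic terms of all three elements combine to its torsion. -/
lemma dEta_pull {η : SecGr L} (hη : η ∈ forms n F L 2) {θ : SecGr L} (hθ : θ ∈ allForms n F L) :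
    dEta C cov η (pull n θ)
      = pull n fun x ↦ koszulOp cov (graphAnchor C η x) (graphTorsion C cov η x) θ := by
  funext x p
  have h1 := gammaBracket_apply cov C hη hθ x p
  have h2 := phiBracket_apply cov C hη hθ x p
  rw [gammaBracket] at h1
  rw [phiBracket] at h2
  change roth cov (muElt C cov) (pull n θ) x p
    + roth cov (roth cov (pull n η) (gammaElt C cov)) (pull n θ) x p
    + (1 / 2 : ℝ) • roth cov (roth cov (roth cov (phiElt C cov) (pull n η)) (pull n η))
      (pull n θ) x p = koszulOp cov (graphAnchor C η x) (graphTorsion C cov η x) θ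
  rw [h1, h2, roth_muElt cov C hθ, sum_flat_covGr, neg_neg, koszulOp,
    derivTwo_sum_smul _ _ (graphTorsion_apply C cov η x)]
  simp only [graphTorsion_component cov C hη, add_mul, Finset.sum_add_distrib, smul_mul_assoc,
    ← Finset.smul_sum]
  have h3 : ∀ α, covGr cov θ x (graphAnchor C η x (frameL F L x α x))
      = covGr cov θ x (C.anchor x (frameL F L x α x, 0))
        + covGr cov θ x (C.anchor x (0, flat F (η x) (frameL F L x α x))) := by
    intro α
    rw [← covGr_map_add, ← map_add]
    simp [graphAnchor, graphMap]
  simp only [h3, mul_add, Finset.sum_add_distrib]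
  abel

end TwistedDifferential

section Derivation

variable {n : ℕ} {M : Type*} [TopologicalSpace M] [ChartedSpace (EuclideanSpace ℝ (Fin n)) M]
  [IsManifold (𝓡 n) ∞ M]
variable {F : Type*} [NormedAddCommGroup F] [NormedSpace ℝ F] [FiniteDimensional ℝ F]
variable {L : M → Type*} [∀ x, AddCommGroup (L x)] [∀ x, Module ℝ (L x)]
  [∀ x, TopologicalSpace (L x)] [TopologicalSpace (TotalSpace F L)]
  [∀ x, IsTopologicalAddGroup (L x)] [∀ x, ContinuousSMul ℝ (L x)]
  [FiberBundle F L] [VectorBundle ℝ F L] [ContMDiffVectorBundle ∞ F L (𝓡 n)]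

/-! ### Products of forms -/

/-- Contraction with the first section is a graded derivation, so the claim descends to products of
smaller total degree. The case distinctions remove contractions of functions. -/
lemma contMDiff_evalForm_mul {N k l : ℕ} (hN : k + l = N) {θ θ' : SecGr L}
    (hθ : θ ∈ forms n F L k) (hθ' : θ' ∈ forms n F L l) (s : Fin N → SecL (n := n) F L) :
    ContMDiff (𝓡 n) 𝓘(ℝ, ℝ) ∞ fun x ↦ evalForm (fun i ↦ s i x) (θ x * θ' x) := by
  induction N generalizing k l θ θ' with
  | zero =>
    obtain ⟨rfl, rfl⟩ := Nat.add_eq_zero_iff.1 hN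
    simp only [evalForm_zero, map_mul]
    exact (contMDiff_evalForm hθ s).mul (contMDiff_evalForm hθ' s)
  | succ N ih =>
    have h : ∀ x, contr (s 0 x) (θ x * θ' x) = contrSec (s 0) θ x * θ' x
        + (-1 : ℝ) ^ k • (θ x * contrSec (s 0) θ' x) := fun x ↦ by
      rw [← intL_vecDual, intL_mul, involute_of_mem (hθ.1 x), smul_mul_assoc]
      rfl
    simp only [evalForm_succ, h, map_add, map_smul, smul_eq_mul]
    refine ContMDiff.add ?_ (ContMDiff.mul contMDiff_const ?_)
    · cases k with
      | zero =>
        simp only [contrSec_of_forms_zero _ hθ, Pi.zero_apply, zero_mul, map_zero]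
        exact contMDiff_const
      | succ k => exact ih (by omega) (contrSec_mem_forms _ hθ) hθ' _
    · cases l with
      | zero =>
        simp only [contrSec_of_forms_zero _ hθ', Pi.zero_apply, mul_zero, map_zero]
        exact contMDiff_const
      | succ l => exact ih (by omega) hθ (contrSec_mem_forms _ hθ') _

lemma mul_mem_allForms {k : ℕ} {θ θ' : SecGr L} (hθ : θ ∈ forms n F L k)
    (hθ' : θ' ∈ allForms n F L) : θ * θ' ∈ allForms n F L := by
  refine allForms_induction (p := fun θ' ↦ θ * θ' ∈ allForms n F L) ?_ ?_ hθ'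
  · intro l θ' hθ'
    exact mem_allForms (k := k + l) ⟨fun x ↦ dualPower_mul_mem (hθ.1 x) (hθ'.1 x),
      fun s ↦ contMDiff_evalForm_mul rfl hθ hθ' s⟩
  · intro a b _ _ ha hb
    rw [mul_add]
    exact add_mem ha hb

/-! ### The derivation property -/

section Derivation

variable (cov : CovariantDerivative (𝓡 n) F L) [T2Space M] {x : M}
  (r : L x →ₗ[ℝ] TangentSpace (𝓡 n) x) (τ : L x →ₗ[ℝ] L x →ₗ[ℝ] L x)

lemma koszulOp_eq (θ : SecGr L) :
    koszulOp cov r τ θ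
      = ∑ α, covec (coframeL F L x α) * covGr cov θ x (r (frameL F L x α x))
        + (1 / 2 : ℝ) • ∑ α, covec (coframeL F L x α) *
          derivL F (τ (frameL F L x α x)) (θ x) := rfl

lemma koszulOp_add {θ θ' : SecGr L} (hθ : θ ∈ allForms n F L) (hθ' : θ' ∈ allForms n F L) :
    koszulOp cov r τ (θ + θ') = koszulOp cov r τ θ + koszulOp cov r τ θ' := by
  simp only [koszulOp_eq, covGr_add cov hθ hθ', Pi.add_apply, derivL_add, mul_add,
    Finset.sum_add_distrib, smul_add]
  abel

lemma koszulOp_smul (c : ℝ) {θ : SecGr L} (hθ : θ ∈ allForms n F L) :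
    koszulOp cov r τ (c • θ) = c • koszulOp cov r τ θ := by
  simp only [koszulOp_eq, covGr_smul cov c hθ, Pi.smul_apply, derivL_smul, mul_smul_comm,
    ← Finset.smul_sum, smul_add, smul_comm c]

/-- Covariant derivative and `derivL` are even derivations; moving the covector in front past `θ`
produces the sign. -/
lemma koszulOp_mul {k : ℕ} {θ θ' : SecGr L} (hθ : θ ∈ forms n F L k)
    (hθ' : θ' ∈ allForms n F L) :
    koszulOp cov r τ (θ * θ')
      = koszulOp cov r τ θ * θ' x + (-1 : ℝ) ^ k • (θ x * koszulOp cov r τ θ') := by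
  have h : ∀ (ξ : L x →L[ℝ] ℝ) (A : GrE L x),
      covec ξ * (θ x * A) = (-1 : ℝ) ^ k • (θ x * (covec ξ * A)) := fun ξ A ↦ by
    rw [← mul_assoc, covec_mul, involute_of_mem (hθ.1 x), smul_mul_assoc, smul_mul_assoc, mul_assoc]
  simp only [koszulOp_eq, covGr_mul cov (mem_allForms hθ) hθ' (mul_mem_allForms hθ hθ'),
    Pi.mul_apply, derivL_mul, mul_add, h, Finset.sum_add_distrib, add_mul, Finset.sum_mul,
    ← mul_assoc, smul_mul_assoc, Finset.mul_sum, smul_add, ← Finset.smul_sum, mul_smul_comm,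
    smul_comm ((-1 : ℝ) ^ k)]
  simp only [Finset.smul_sum]
  abel

end Derivation

/-! ### The twisted differential in terms of the Courant bracket -/

section Values

variable [T2Space M] (cov : CovariantDerivative (𝓡 n) F L) (C : CourantAlgebroid n F L)
  {η : SecGr L}

/-- The twisted differential of a form on `L`. -/
def twistedD (η θ : SecGr L) : SecGr L := fun x ↦
  koszulOp cov (graphAnchor C η x) (graphTorsion C cov η x) θ

/-- The Koszul formula for `koszulOp` becomes one in terms of the Courant algebroid alone, since the
bracket built from connection and torsion is the `L`-component of the bracket of graph sections. -/
lemma evalForm_twistedD (hη : η ∈ forms n F L 2) {k : ℕ} {θ : SecGr L}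
    (hθ : θ ∈ forms n F L k) (s : Fin (k + 1) → SecL (n := n) F L) (x : M) :
    evalForm (fun i ↦ s i x) (twistedD cov C η θ x)
      = ∑ i : Fin (k + 1), (-1 : ℝ) ^ (i : ℕ) *
          dirDeriv (fun y ↦ evalForm (fun m ↦ s (i.succAbove m) y) (θ y)) x
            (C.anchor x (valE (graphSec hη (s i)) x))
        + ∑ j : Fin (k + 1), ∑ i ∈ Finset.Iio j, (-1 : ℝ) ^ (j : ℕ) *
          evalForm (fun m ↦ Function.update s i
            (C.bracket (graphSec hη (s i)) (graphSec hη (s j))).1 (j.succAbove m) x) (θ x) := by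
  rw [twistedD, evalForm_koszulOp cov _ _ (graphTorsion_swap C cov η x) hθ s]
  have h : ∀ (i : Fin (k + 1)) (u : SecL (n := n) F L) m,
      Function.update (fun l ↦ s l x) i (u x) m = Function.update s i u m x := by
    intro i u m
    by_cases hm : m = i
    · subst hm; simp
    · simp [Function.update_of_ne hm]
  simp only [covBracket_graph C cov hη, h, valE_graphSec]
  rfl

/-- Smoothness is read off from the Koszul formula: the anchor is smooth and the Courant bracket has
smooth sections as values. -/
lemma twistedD_mem (hη : η ∈ forms n F L 2) {k : ℕ} {θ : SecGr L} (hθ : θ ∈ forms n F L k) :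
    twistedD cov C η θ ∈ forms n F L (k + 1) := by
  refine ⟨fun x ↦ koszulOp_mem cov _ _ hθ, fun s ↦ ?_⟩
  simp only [evalForm_twistedD cov C hη hθ]
  refine ContMDiff.add (ContMDiff.sum fun i _ ↦ ContMDiff.mul contMDiff_const ?_)
    (ContMDiff.sum fun j _ ↦ ContMDiff.sum fun i _ ↦ ContMDiff.mul contMDiff_const ?_)
  · exact contMDiff_dirDeriv (contMDiff_evalForm hθ fun m ↦ s (i.succAbove m))
      (C.smooth_anchor (graphSec hη (s i)))
  · exact contMDiff_evalForm hθ fun m ↦ Function.update s i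
      (C.bracket (graphSec hη (s i)) (graphSec hη (s j))).1 (j.succAbove m)

lemma dEta_pull_eq (hη : η ∈ forms n F L 2) {θ : SecGr L} (hθ : θ ∈ allForms n F L) :
    dEta C cov η (pull n θ) = pull n (twistedD cov C η θ) :=
  dEta_pull cov C hη hθ

/-! ### Scaling the two-form, and comparison with the Lie algebroid differential -/

lemma flat_smul {x : M} (c : ℝ) (ψ : GrE L x) (v : L x) : flat F (c • ψ) v = c • flat F ψ v := by
  ext w
  exact bilin_smul c ψ v w

lemma gammaBracket_smul (t : ℝ) (hη : η ∈ forms n F L 2) {θ : SecGr L}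
    (hθ : θ ∈ allForms n F L) :
    gammaBracket C cov (pull n (t • η)) (pull n θ)
      = t • gammaBracket C cov (pull n η) (pull n θ) := by
  funext x p
  refine (gammaBracket_apply cov C (Submodule.smul_mem _ t hη) hθ x p).trans
    (Eq.trans ?_ (congrArg (t • ·) (gammaBracket_apply cov C hη hθ x p)).symm)
  simp only [Pi.smul_apply, flat_smul, map_smul, covGr_smul cov t (mem_allForms hη),
    smul_mul_assoc, smul_comm _ t, ← Finset.smul_sum, ← smul_neg, ← smul_add]

lemma phiBracket_smul (t : ℝ) (hη : η ∈ forms n F L 2) {θ : SecGr L}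
    (hθ : θ ∈ allForms n F L) :
    phiBracket C cov (pull n (t • η)) (pull n (t • η)) (pull n θ)
      = (t * t) • phiBracket C cov (pull n η) (pull n η) (pull n θ) := by
  funext x p
  refine (phiBracket_apply cov C (Submodule.smul_mem _ t hη) hθ x p).trans
    (Eq.trans ?_ (congrArg ((t * t) • ·) (phiBracket_apply cov C hη hθ x p)).symm)
  simp only [Pi.smul_apply, flat_smul, map_smul, mul_smul_comm, mul_smul,
    smul_mul_assoc, smul_comm _ t, ← Finset.smul_sum, ← smul_neg]

lemma dEta_smul_pull (t : ℝ) (hη : η ∈ forms n F L 2) {θ : SecGr L} (hθ : θ ∈ allForms n F L) :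
    dEta C cov (t • η) (pull n θ) = roth cov (muElt C cov) (pull n θ)
      + t • gammaBracket C cov (pull n η) (pull n θ)
      + (t * t / 2) • phiBracket C cov (pull n η) (pull n η) (pull n θ) := by
  have h1 := gammaBracket_smul cov C t hη hθ
  have h2 := phiBracket_smul cov C t hη hθ
  rw [gammaBracket] at h1
  rw [phiBracket] at h2
  rw [dEta, h1, h2, smul_smul]
  congr 2
  ring

lemma secFlat_zero (s : SecL (n := n) F L) : secFlat (zero_mem (forms n F L 2)) s = 0 := by
  refine ContMDiffSection.ext fun x ↦ ?_
  rw [secFlat_apply]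
  ext v
  simp [flat_apply, bilin]

/-- For `η = 0` the graph is `L` itself and both sides have the same Koszul values on the frame. The
expansion in the coframe explains the factorial in the definition of `dL`. -/
lemma twistedD_zero {k : ℕ} {θ : SecGr L} (hθ : θ ∈ forms n F L k) :
    twistedD cov C 0 θ = dL C k θ := by
  funext x
  have h0 : (((k + 1).factorial : ℕ) : ℝ) ≠ 0 := by exact_mod_cast (k + 1).factorial_ne_zero
  have h := sum_evalForm_smul (sum_coframeL_smul_frameL (F := F) x)
    ((twistedD_mem cov C (zero_mem (forms n F L 2)) hθ).1 x)
  rw [dL, eq_inv_smul_iff₀ h0, ← h]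
  refine Finset.sum_congr rfl fun α _ ↦ ?_
  have h1 := evalForm_twistedD cov C (zero_mem (forms n F L 2)) hθ
    (fun m ↦ extL F L x (frameL F L x (α m) x)) x
  simp only [extL_apply, graphSec, secFlat_zero] at h1
  rw [h1, ExteriorAlgebra.ιMulti_apply]
  congr 1

/-- At `t = 0` only the bracket with `μ` is left of the polynomial `d_{tη}`. -/
lemma pull_dL {k : ℕ} {θ : SecGr L} (hθ : θ ∈ forms n F L k) :
    pull n (dL C k θ) = roth cov (muElt C cov) (pull n θ) := by
  have h := dEta_smul_pull cov C 0 (zero_mem (forms n F L 2)) (mem_allForms hθ)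
  rw [smul_zero, dEta_pull_eq cov C (zero_mem _) (mem_allForms hθ), twistedD_zero cov C hθ] at h
  simpa using h

end Values

end Derivation

section MaurerCartan

variable {n : ℕ} {M : Type*} [TopologicalSpace M] [ChartedSpace (EuclideanSpace ℝ (Fin n)) M]
  [IsManifold (𝓡 n) ∞ M]
variable {F : Type*} [NormedAddCommGroup F] [NormedSpace ℝ F] [FiniteDimensional ℝ F]
variable {L : M → Type*} [∀ x, AddCommGroup (L x)] [∀ x, Module ℝ (L x)]
  [∀ x, TopologicalSpace (L x)] [TopologicalSpace (TotalSpace F L)]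
  [∀ x, IsTopologicalAddGroup (L x)] [∀ x, ContinuousSMul ℝ (L x)]
  [FiberBundle F L] [VectorBundle ℝ F L] [ContMDiffVectorBundle ∞ F L (𝓡 n)]

/-! ### The Maurer-Cartan expression -/

variable [T2Space M] (cov : CovariantDerivative (𝓡 n) F L) (C : CourantAlgebroid n F L)
  {η : SecGr L}

lemma evalForm_three (v : ∀ _ : Fin 3, SecL (n := n) F L) (θ : SecGr L) (x : M) :
    evalForm (fun i ↦ v i x) (θ x) = evalForm ![v 0 x, v 1 x, v 2 x] (θ x) := by
  congr 2
  ext i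
  fin_cases i <;> rfl

/-- The twisted differential of a two-form. -/
lemma evalForm_twistedD_two (hη : η ∈ forms n F L 2) {θ : SecGr L} (hθ : θ ∈ forms n F L 2)
    (s₀ s₁ s₂ : SecL (n := n) F L) (x : M) :
    evalForm ![s₀ x, s₁ x, s₂ x] (twistedD cov C η θ x)
      = dirDeriv (fun y ↦ bilin (θ y) (s₁ y) (s₂ y)) x (C.anchor x (valE (graphSec hη s₀) x))
        - dirDeriv (fun y ↦ bilin (θ y) (s₀ y) (s₂ y)) x (C.anchor x (valE (graphSec hη s₁) x))
        + dirDeriv (fun y ↦ bilin (θ y) (s₀ y) (s₁ y)) x (C.anchor x (valE (graphSec hη s₂) x))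
        - bilin (θ x) ((C.bracket (graphSec hη s₀) (graphSec hη s₁)).1 x) (s₂ x)
        + bilin (θ x) ((C.bracket (graphSec hη s₀) (graphSec hη s₂)).1 x) (s₁ x)
        + bilin (θ x) (s₀ x) ((C.bracket (graphSec hη s₁) (graphSec hη s₂)).1 x) := by
  have h := evalForm_twistedD cov C hη hθ ![s₀, s₁, s₂] x
  rw [evalForm_three] at h
  refine h.trans ?_
  have h0 : Finset.Iio (0 : Fin 3) = ∅ := by decide
  have h1 : Finset.Iio (1 : Fin 3) = {0} := by decide
  have h2 : Finset.Iio (2 : Fin 3) = {0, 1} := by decide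
  have a00 : (0 : Fin 3).succAbove (0 : Fin 2) = 1 := by decide
  have a01 : (0 : Fin 3).succAbove (1 : Fin 2) = 2 := by decide
  have a10 : (1 : Fin 3).succAbove (0 : Fin 2) = 0 := by decide
  have a11 : (1 : Fin 3).succAbove (1 : Fin 2) = 2 := by decide
  have a20 : (2 : Fin 3).succAbove (0 : Fin 2) = 0 := by decide
  have a21 : (2 : Fin 3).succAbove (1 : Fin 2) = 1 := by decide
  rw [Fin.sum_univ_three, Fin.sum_univ_three]
  simp only [evalForm_two, h0, h1, h2, Finset.sum_empty, Finset.sum_singleton,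
    Finset.sum_pair (show (0 : Fin 3) ≠ 1 by decide), a00, a01, a10, a11, a20, a21]
  simp
  ring

/-- The twisted differential of a three-form. -/
lemma evalForm_twistedD_three (hη : η ∈ forms n F L 2) {θ : SecGr L} (hθ : θ ∈ forms n F L 3)
    (s : Fin 4 → SecL (n := n) F L) (x : M) :
    evalForm (fun i ↦ s i x) (twistedD cov C η θ x)
      = dirDeriv (fun y ↦ evalForm ![s 1 y, s 2 y, s 3 y] (θ y)) x
          (C.anchor x (valE (graphSec hη (s 0)) x))
        - dirDeriv (fun y ↦ evalForm ![s 0 y, s 2 y, s 3 y] (θ y)) x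
          (C.anchor x (valE (graphSec hη (s 1)) x))
        + dirDeriv (fun y ↦ evalForm ![s 0 y, s 1 y, s 3 y] (θ y)) x
          (C.anchor x (valE (graphSec hη (s 2)) x))
        - dirDeriv (fun y ↦ evalForm ![s 0 y, s 1 y, s 2 y] (θ y)) x
          (C.anchor x (valE (graphSec hη (s 3)) x))
        - evalForm ![(C.bracket (graphSec hη (s 0)) (graphSec hη (s 1))).1 x, s 2 x, s 3 x] (θ x)
        + evalForm ![(C.bracket (graphSec hη (s 0)) (graphSec hη (s 2))).1 x, s 1 x, s 3 x] (θ x)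
        + evalForm ![s 0 x, (C.bracket (graphSec hη (s 1)) (graphSec hη (s 2))).1 x, s 3 x] (θ x)
        - evalForm ![(C.bracket (graphSec hη (s 0)) (graphSec hη (s 3))).1 x, s 1 x, s 2 x] (θ x)
        - evalForm ![s 0 x, (C.bracket (graphSec hη (s 1)) (graphSec hη (s 3))).1 x, s 2 x] (θ x)
        - evalForm ![s 0 x, s 1 x, (C.bracket (graphSec hη (s 2)) (graphSec hη (s 3))).1 x]
          (θ x) := by
  refine (evalForm_twistedD cov C hη hθ s x).trans ?_
  have h0 : Finset.Iio (0 : Fin 4) = ∅ := by decide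
  have h1 : Finset.Iio (1 : Fin 4) = {0} := by decide
  have h2 : Finset.Iio (2 : Fin 4) = {0, 1} := by decide
  have h3 : Finset.Iio (3 : Fin 4) = {0, 1, 2} := by decide
  have s3 : ∀ f : Fin 4 → ℝ, ∑ i ∈ {0, 1, 2}, f i = f 0 + f 1 + f 2 := fun f ↦ by
    rw [Finset.sum_insert (by decide), Finset.sum_pair (by decide), add_assoc]
  have e : ∀ (j : Fin 4) (t : Fin 4 → SecL (n := n) F L) (y : M),
      evalForm (fun m ↦ t (j.succAbove m) y) (θ y)
        = evalForm ![t (j.succAbove 0) y, t (j.succAbove 1) y, t (j.succAbove 2) y] (θ y) :=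
    fun j t y ↦ evalForm_three (fun m ↦ t (j.succAbove m)) θ y
  have a00 : (0 : Fin 4).succAbove (0 : Fin 3) = 1 := by decide
  have a01 : (0 : Fin 4).succAbove (1 : Fin 3) = 2 := by decide
  have a02 : (0 : Fin 4).succAbove (2 : Fin 3) = 3 := by decide
  have a10 : (1 : Fin 4).succAbove (0 : Fin 3) = 0 := by decide
  have a11 : (1 : Fin 4).succAbove (1 : Fin 3) = 2 := by decide
  have a12 : (1 : Fin 4).succAbove (2 : Fin 3) = 3 := by decide
  have a20 : (2 : Fin 4).succAbove (0 : Fin 3) = 0 := by decide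
  have a21 : (2 : Fin 4).succAbove (1 : Fin 3) = 1 := by decide
  have a22 : (2 : Fin 4).succAbove (2 : Fin 3) = 3 := by decide
  have a30 : (3 : Fin 4).succAbove (0 : Fin 3) = 0 := by decide
  have a31 : (3 : Fin 4).succAbove (1 : Fin 3) = 1 := by decide
  have a32 : (3 : Fin 4).succAbove (2 : Fin 3) = 2 := by decide
  have p3 : (-1 : ℝ) ^ 3 = -1 := by norm_num
  rw [Fin.sum_univ_four, Fin.sum_univ_four]
  simp only [e, h0, h1, h2, h3, Finset.sum_empty, Finset.sum_singleton,
    Finset.sum_pair (show (0 : Fin 4) ≠ 1 by decide), s3,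
    a00, a01, a02, a10, a11, a12, a20, a21, a22, a30, a31, a32]
  simp [p3]
  ring

end MaurerCartan

section Integrability

variable {n : ℕ} {M : Type*} [TopologicalSpace M] [ChartedSpace (EuclideanSpace ℝ (Fin n)) M]
  [IsManifold (𝓡 n) ∞ M]
variable {F : Type*} [NormedAddCommGroup F] [NormedSpace ℝ F] [FiniteDimensional ℝ F]
variable {L : M → Type*} [∀ x, AddCommGroup (L x)] [∀ x, Module ℝ (L x)]
  [∀ x, TopologicalSpace (L x)] [TopologicalSpace (TotalSpace F L)]
  [∀ x, IsTopologicalAddGroup (L x)] [∀ x, ContinuousSMul ℝ (L x)]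
  [FiberBundle F L] [VectorBundle ℝ F L] [ContMDiffVectorBundle ∞ F L (𝓡 n)]

/-! ### The Maurer-Cartan expression and the Courant bracket -/

variable [T2Space M] (cov : CovariantDerivative (𝓡 n) F L) (C : CourantAlgebroid n F L)
  {η : SecGr L}

/-- The section `i_s η` of `L*`, as a section of `L ⊕ L*`. -/
def flatSec (hη : η ∈ forms n F L 2) (s : SecL (n := n) F L) : SecE (n := n) F L :=
  (0, secFlat hη s)

/-- A section of `L`, as a section of `L ⊕ L*`. -/
def inclSec (s : SecL (n := n) F L) : SecE (n := n) F L := (s, 0)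

lemma graphSec_eq (hη : η ∈ forms n F L 2) (s : SecL (n := n) F L) :
    graphSec hη s = inclSec s + flatSec hη s :=
  Prod.ext (add_zero _).symm (zero_add _).symm

lemma graphSec_smul (hη : η ∈ forms n F L 2) (t : ℝ) (s : SecL (n := n) F L) :
    graphSec (Submodule.smul_mem _ t hη) s = inclSec s + t • flatSec hη s := by
  refine Prod.ext ?_ ?_
  · change s = s + t • (0 : SecL (n := n) F L)
    rw [smul_zero, add_zero]
  · change secFlat (Submodule.smul_mem _ t hη) s = 0 + t • secFlat hη s
    rw [zero_add]
    refine ContMDiffSection.ext fun x ↦ ?_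
    rw [secFlat_apply, Pi.smul_apply, flat_smul]
    exact congrArg (t • ·) (secFlat_apply hη s x).symm

lemma pairE_flatSec (hη : η ∈ forms n F L 2) (e : SecE (n := n) F L) (s : SecL (n := n) F L)
    (x : M) : pairE e (flatSec hη s) x = bilin (η x) (s x) (e.1 x) := by
  change e.2 x 0 + secFlat hη s x (e.1 x) = _
  rw [secFlat_apply, map_zero, zero_add]
  rfl

lemma pairE_flatSec_inclSec (hη : η ∈ forms n F L 2) (s t : SecL (n := n) F L) :
    pairE (flatSec hη s) (inclSec t) = fun x ↦ bilin (η x) (s x) (t x) := by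
  ext x
  rw [pairE_comm, pairE_flatSec]
  rfl

lemma pairE_inclSec_flatSec (hη : η ∈ forms n F L 2) (s t : SecL (n := n) F L) :
    pairE (inclSec t) (flatSec hη s) = fun x ↦ bilin (η x) (s x) (t x) := by
  ext x
  rw [pairE_flatSec]
  rfl

lemma pairE_flatSec_flatSec (hη : η ∈ forms n F L 2) (s t : SecL (n := n) F L) :
    pairE (flatSec hη s) (flatSec hη t) = fun _ ↦ 0 := by
  ext x
  rw [pairE_flatSec]
  exact map_zero _

lemma pairE_smul_left (c : ℝ) (e e' : SecE (n := n) F L) (x : M) :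
    pairE (c • e) e' x = c * pairE e e' x := by
  simp only [pairE, pairing, valE_smul, Prod.smul_fst, Prod.smul_snd, map_smul, smul_apply,
    smul_eq_mul]
  ring

set_option synthInstance.maxHeartbeats 200000 in
/-- The twisted differentials of `η` by the multiples of `η`. -/
lemma evalForm_twistedD_smul (hη : η ∈ forms n F L 2) (t : ℝ) (s₀ s₁ s₂ : SecL (n := n) F L)
    (x : M) :
    evalForm ![s₀ x, s₁ x, s₂ x] (twistedD cov C (t • η) η x)
      = (dirDeriv (fun y ↦ bilin (η y) (s₁ y) (s₂ y)) x (C.anchor x (valE (inclSec s₀) x))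
          - dirDeriv (fun y ↦ bilin (η y) (s₀ y) (s₂ y)) x (C.anchor x (valE (inclSec s₁) x))
          + dirDeriv (fun y ↦ bilin (η y) (s₀ y) (s₁ y)) x (C.anchor x (valE (inclSec s₂) x))
          + pairE (C.bracket (inclSec s₀) (inclSec s₁)) (flatSec hη s₂) x
          - pairE (C.bracket (inclSec s₀) (inclSec s₂)) (flatSec hη s₁) x
          + pairE (C.bracket (inclSec s₁) (inclSec s₂)) (flatSec hη s₀) x)
        + t * (dirDeriv (fun y ↦ bilin (η y) (s₁ y) (s₂ y)) x (C.anchor x (valE (flatSec hη s₀) x))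
          - dirDeriv (fun y ↦ bilin (η y) (s₀ y) (s₂ y)) x (C.anchor x (valE (flatSec hη s₁) x))
          + dirDeriv (fun y ↦ bilin (η y) (s₀ y) (s₁ y)) x (C.anchor x (valE (flatSec hη s₂) x))
          + pairE (C.bracket (inclSec s₀) (flatSec hη s₁)) (flatSec hη s₂) x
          + pairE (C.bracket (flatSec hη s₀) (inclSec s₁)) (flatSec hη s₂) x
          - pairE (C.bracket (inclSec s₀) (flatSec hη s₂)) (flatSec hη s₁) x
          - pairE (C.bracket (flatSec hη s₀) (inclSec s₂)) (flatSec hη s₁) x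
          + pairE (C.bracket (inclSec s₁) (flatSec hη s₂)) (flatSec hη s₀) x
          + pairE (C.bracket (flatSec hη s₁) (inclSec s₂)) (flatSec hη s₀) x)
        + t * t * (pairE (C.bracket (flatSec hη s₀) (flatSec hη s₁)) (flatSec hη s₂) x
          - pairE (C.bracket (flatSec hη s₀) (flatSec hη s₂)) (flatSec hη s₁) x
          + pairE (C.bracket (flatSec hη s₁) (flatSec hη s₂)) (flatSec hη s₀) x) := by
  have h : ∀ (e : SecE (n := n) F L) (s : SecL (n := n) F L),
      bilin (η x) (e.1 x) (s x) = -pairE e (flatSec hη s) x := fun e s ↦ by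
    rw [pairE_flatSec, bilin_swap]
  rw [evalForm_twistedD_two cov C (Submodule.smul_mem _ t hη) hη, h, h, ← pairE_flatSec hη]
  simp only [graphSec_smul hη, valE_add, valE_smul, map_add, map_smul, dirDeriv_map_add,
    dirDeriv_map_smul, LinearMap.add_apply, LinearMap.smul_apply, pairE_add_left, pairE_smul_left]
  ring

/-- The three-form that measures the failure of the graph of `η` to be closed under the Courant
bracket. -/
def maurerCartanForm (η : SecGr L) : SecGr L :=
  -- Since `d_{tη} η` is quadratic in `t`, its integral over `[0, 1]` is determined by the values at
  -- `0`, `1` and `-1`. The weights send `1`, `t`, `t²` to `1`, `1/2`, `1/3`.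
  (2 / 3 : ℝ) • twistedD cov C ((0 : ℝ) • η) η + (5 / 12 : ℝ) • twistedD cov C ((1 : ℝ) • η) η
    - (1 / 12 : ℝ) • twistedD cov C ((-1 : ℝ) • η) η

lemma maurerCartanForm_mem (hη : η ∈ forms n F L 2) :
    maurerCartanForm cov C η ∈ forms n F L 3 :=
  sub_mem (add_mem
    (Submodule.smul_mem _ _ (twistedD_mem cov C (Submodule.smul_mem _ _ hη) hη))
    (Submodule.smul_mem _ _ (twistedD_mem cov C (Submodule.smul_mem _ _ hη) hη)))
    (Submodule.smul_mem _ _ (twistedD_mem cov C (Submodule.smul_mem _ _ hη) hη))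

/-- The weights applied to `d_L η + t [η, η]_γ + t²/2 [η, η, η]_φ` give the coefficients `1`, `1/2`
and `1/6`. In this form, membership in the three-forms is inherited from `twistedD`. -/
lemma maurerCartan_eq (hη : η ∈ forms n F L 2) :
    maurerCartan C cov η = pull n (maurerCartanForm cov C η) := by
  have h : ∀ t : ℝ, pull n (twistedD cov C (t • η) η) = _ := fun t ↦
    (dEta_pull_eq cov C (Submodule.smul_mem _ t hη) (mem_allForms hη)).symm.trans
      (dEta_smul_pull cov C t hη (mem_allForms hη))
  have h' : pull n (maurerCartanForm cov C η)
      = (2 / 3 : ℝ) • pull n (twistedD cov C ((0 : ℝ) • η) η)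
        + (5 / 12 : ℝ) • pull n (twistedD cov C ((1 : ℝ) • η) η)
        - (1 / 12 : ℝ) • pull n (twistedD cov C ((-1 : ℝ) • η) η) := rfl
  rw [h', h, h, h, maurerCartan, pull_dL cov C hη]
  module

/-- Split each graph section into its `L` and `L*` parts. The part of `h([g₀, g₁], g₂)` with `m`
entries `i_s η` occurs `m` times in the coefficient of `t^(m-1)` in `d_{tη} η`, and the weights
divide by `m`. The part with `m = 0` vanishes since `L` is Dirac. -/
lemma evalForm_maurerCartanForm (hC : C.IsDirac) (hη : η ∈ forms n F L 2)
    (s₀ s₁ s₂ : SecL (n := n) F L) (x : M) :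
    evalForm ![s₀ x, s₁ x, s₂ x] (maurerCartanForm cov C η x)
      = pairE (C.bracket (graphSec hη s₀) (graphSec hη s₁)) (graphSec hη s₂) x := by
  have hv : ∀ s t u : SecL (n := n) F L,
      pairE (C.bracket (inclSec s) (inclSec t)) (inclSec u) x = 0 := fun s t u ↦ by
    change (C.bracket (s, 0) (t, 0)).2 x (u x) + (0 : SecDual (n := n) F L) x _ = 0
    rw [hC s t]
    exact add_zero _
  have h0 : ∀ v : TangentSpace (𝓡 n) x, dirDeriv (fun _ : M ↦ (0 : ℝ)) x v = 0 := dirDeriv_const 0 x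
  have hm : evalForm ![s₀ x, s₁ x, s₂ x] (maurerCartanForm cov C η x)
      = 2 / 3 * evalForm ![s₀ x, s₁ x, s₂ x] (twistedD cov C ((0 : ℝ) • η) η x)
        + 5 / 12 * evalForm ![s₀ x, s₁ x, s₂ x] (twistedD cov C ((1 : ℝ) • η) η x)
        - 1 / 12 * evalForm ![s₀ x, s₁ x, s₂ x] (twistedD cov C ((-1 : ℝ) • η) η x) := by
    simp only [maurerCartanForm, Pi.add_apply, Pi.sub_apply, Pi.smul_apply, map_add, map_sub,
      map_smul, smul_eq_mul]
  rw [hm]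
  simp only [evalForm_twistedD_smul cov C hη]
  have a := C.pairE_bracket_add (F := F) (L := L)
  have b := C.pairE_bracket_swap (F := F) (L := L)
  -- The relations up to `r₃` concern one entry from `L*`, those from `r₄` to `r₉` two, and the last
  -- three concern three entries. They express that `h([e₁, e₂], e₃)` is skew up to derivatives of
  -- pairings.
  have r₁ := a (inclSec s₀) (flatSec hη s₁) (inclSec s₂) x
  have r₂ := b (flatSec hη s₀) (inclSec s₁) (inclSec s₂) x
  have r₃ := a (inclSec s₁) (flatSec hη s₀) (inclSec s₂) x
  have r₄ := a (inclSec s₀) (flatSec hη s₁) (flatSec hη s₂) x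
  have r₅ := a (flatSec hη s₀) (inclSec s₂) (flatSec hη s₁) x
  have r₆ := a (flatSec hη s₁) (inclSec s₂) (flatSec hη s₀) x
  have r₇ := b (flatSec hη s₁) (flatSec hη s₀) (inclSec s₂) x
  have r₈ := a (inclSec s₁) (flatSec hη s₂) (flatSec hη s₀) x
  have r₉ := b (inclSec s₁) (flatSec hη s₀) (flatSec hη s₂) x
  have r₁₀ := a (flatSec hη s₀) (flatSec hη s₁) (flatSec hη s₂) x
  have r₁₁ := a (flatSec hη s₁) (flatSec hη s₂) (flatSec hη s₀) x
  have r₁₂ := b (flatSec hη s₁) (flatSec hη s₀) (flatSec hη s₂) x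
  simp only [pairE_flatSec_inclSec, pairE_inclSec_flatSec, pairE_flatSec_flatSec, h0]
    at r₁ r₂ r₃ r₄ r₅ r₆ r₇ r₈ r₉ r₁₀ r₁₁ r₁₂
  have hv' := hv s₀ s₁ s₂
  simp only [graphSec_eq, map_add, LinearMap.add_apply, pairE_add_left, pairE_add_right]
  linarith

/-- The Courant bracket satisfies the Jacobi identity, so the Maurer-Cartan expression is closed
under the twisted differential. -/
lemma twistedD_maurerCartanForm (hC : C.IsDirac) (hη : η ∈ forms n F L 2) :
    twistedD cov C η (maurerCartanForm cov C η) = 0 := by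
  funext x
  have hm := maurerCartanForm_mem cov C hη
  refine eq_of_evalForm_eq (sum_coframeL_smul_frameL (F := F) x)
    ((twistedD_mem cov C hη hm).1 x) (zero_mem _) fun v ↦ ?_
  obtain ⟨s, rfl⟩ : ∃ s : Fin 4 → SecL (n := n) F L, v = fun i ↦ s i x :=
    ⟨fun i ↦ extL F L x (v i), funext fun i ↦ (extL_apply x (v i)).symm⟩
  have hz : evalForm (fun i ↦ s i x) ((0 : SecGr L) x) = 0 := map_zero _
  rw [evalForm_twistedD_three cov C hη hm s, hz]
  simp only [evalForm_maurerCartanForm cov C hC hη]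
  generalize s 0 = s₀
  generalize s 1 = s₁
  generalize s 2 = s₂
  generalize s 3 = s₃
  have a := C.pairE_bracket_add (F := F) (L := L)
  have b := C.pairE_bracket_swap (F := F) (L := L)
  have h0 : ∀ v : TangentSpace (𝓡 n) x, dirDeriv (0 : M → ℝ) x v = 0 := dirDeriv_const 0 x
  -- Replacing each second argument by the graph section over its `L`-part adds two `η`-terms that
  -- cancel by skewness. It expresses the pairing of two brackets, neither of which need lie in the
  -- graph, through values of the three-form.
  have hsplit : ∀ e e' : SecE (n := n) F L,
      pairE e e' x = pairE e (graphSec hη e'.1) x + pairE e' (graphSec hη e.1) x := by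
    intro e e'
    change e.2 x (e'.1 x) + e'.2 x (e.1 x)
      = (e.2 x (e'.1 x) + secFlat hη e'.1 x (e.1 x)) + (e'.2 x (e.1 x) + secFlat hη e.1 x (e'.1 x))
    rw [secFlat_apply, secFlat_apply, flat_apply, flat_apply, bilin_swap]
    ring
  have hr : ∀ t₁ t₂ t₃ : SecL (n := n) F L,
      pairE (C.bracket (graphSec hη t₁) (graphSec hη t₃)) (graphSec hη t₂) x
        = -pairE (C.bracket (graphSec hη t₁) (graphSec hη t₂)) (graphSec hη t₃) x := by
    intro t₁ t₂ t₃
    have := a (graphSec hη t₁) (graphSec hη t₂) (graphSec hη t₃) x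
    rw [pairE_graphSec, h0] at this
    linarith
  have hl : ∀ t₁ t₂ t₃ : SecL (n := n) F L,
      pairE (C.bracket (graphSec hη t₂) (graphSec hη t₁)) (graphSec hη t₃) x
        = -pairE (C.bracket (graphSec hη t₁) (graphSec hη t₂)) (graphSec hη t₃) x := by
    intro t₁ t₂ t₃
    have := b (graphSec hη t₁) (graphSec hη t₂) (graphSec hη t₃) x
    rw [pairE_graphSec, h0] at this
    linarith
  have hcyc : ∀ t₁ t₂ t₃ : SecL (n := n) F L,
      pairE (C.bracket (graphSec hη t₁) (graphSec hη t₂)) (graphSec hη t₃) x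
        = pairE (C.bracket (graphSec hη t₂) (graphSec hη t₃)) (graphSec hη t₁) x := by
    intro t₁ t₂ t₃
    rw [hl t₂ t₁, hr t₂ t₁ t₃]
  -- The Jacobi identity for three graph sections, paired with the fourth. The relations `k` trade
  -- double brackets for derivatives and pairings of brackets, `l` turns these pairings into values
  -- on `pr_L` of brackets, and `m` reorders the arguments to match the Koszul formula.
  have j := congrArg (fun e ↦ pairE e (graphSec hη s₃) x)
    (C.jacobi (graphSec hη s₀) (graphSec hη s₁) (graphSec hη s₂))
  simp only [pairE_add_left] at j
  set g₀ := graphSec hη s₀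
  set g₁ := graphSec hη s₁
  set g₂ := graphSec hη s₂
  set g₃ := graphSec hη s₃
  have k₁ := a g₀ (C.bracket g₁ g₂) g₃ x
  have k₂ := b (C.bracket g₀ g₁) g₂ g₃ x
  have k₃ := a g₂ (C.bracket g₀ g₁) g₃ x
  have k₄ := a g₁ (C.bracket g₀ g₂) g₃ x
  have l₁ := hsplit (C.bracket g₀ g₃) (C.bracket g₁ g₂)
  have l₂ := hsplit (C.bracket g₂ g₃) (C.bracket g₀ g₁)
  have l₃ := hsplit (C.bracket g₁ g₃) (C.bracket g₀ g₂)
  have m₁ := hcyc (C.bracket g₀ g₁).1 s₂ s₃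
  have m₂ := hcyc (C.bracket g₀ g₂).1 s₁ s₃
  have m₃ := hr s₀ s₃ (C.bracket g₁ g₂).1
  have m₄ := hcyc (C.bracket g₀ g₃).1 s₁ s₂
  have m₅ := hr s₀ s₂ (C.bracket g₁ g₃).1
  linarith

end Integrability

end DiracDeformation

end

/-! ### The theorem -/

theorem mainTheorem2 {n : ℕ} {M : Type*} [TopologicalSpace M]
    [ChartedSpace (EuclideanSpace ℝ (Fin n)) M] [IsManifold (𝓡 n) ∞ M]
    [T2Space M] [SecondCountableTopology M]
    {F : Type*} [NormedAddCommGroup F] [NormedSpace ℝ F] [FiniteDimensional ℝ F]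
    {L : M → Type*} [∀ x, AddCommGroup (L x)] [∀ x, Module ℝ (L x)]
    [∀ x, TopologicalSpace (L x)] [TopologicalSpace (TotalSpace F L)]
    [∀ x, IsTopologicalAddGroup (L x)] [∀ x, ContinuousSMul ℝ (L x)]
    [FiberBundle F L] [VectorBundle ℝ F L] [ContMDiffVectorBundle ∞ F L (𝓡 n)]
    (C : CourantAlgebroid n F L) (hL : C.IsDirac)
    (cov : CovariantDerivative (𝓡 n) F L) [CovariantDerivative.ContMDiffCovariantDerivative cov ∞]
    (η : SecGr L) (hη : η ∈ forms n F L 2) :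
    -- `d_η` maps `Γ(Λ^k L*)` to `Γ(Λ^{k+1} L*)`
    (∀ (k : ℕ), ∀ θ ∈ forms n F L k,
      ∃ θ' ∈ forms n F L (k + 1), dEta C cov η (pull n θ) = pull n θ') ∧
    -- it is `ℝ`-linear on `Γ(Λ^• L*)`
    (∀ θ₁ ∈ allForms n F L, ∀ θ₂ ∈ allForms n F L, ∀ a b : ℝ,
      dEta C cov η (pull n (a • θ₁ + b • θ₂)) =
        a • dEta C cov η (pull n θ₁) + b • dEta C cov η (pull n θ₂)) ∧
    -- it satisfies the graded Leibniz rule with respect to the wedge product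
    (∀ (k : ℕ), ∀ θ₁ ∈ forms n F L k, ∀ θ₂ ∈ allForms n F L,
      dEta C cov η (pull n (θ₁ * θ₂)) =
        dEta C cov η (pull n θ₁) * pull n θ₂
          + (-1 : ℝ) ^ k • (pull n θ₁ * dEta C cov η (pull n θ₂))) ∧
    -- `d_η = d_L + [η, ·]_γ + ½ [η, η, ·]_φ`
    (∀ (k : ℕ), ∀ θ ∈ forms n F L k,
      dEta C cov η (pull n θ) =
        pull n (dL C k θ) + gammaBracket C cov (pull n η) (pull n θ)
          + (1 / 2 : ℝ) • phiBracket C cov (pull n η) (pull n η) (pull n θ)) ∧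
    -- the Maurer-Cartan expression is a three-form, annihilated by `d_η`
    (∃ m ∈ forms n F L 3, maurerCartan C cov η = pull n m) ∧
    dEta C cov η (maurerCartan C cov η) = 0 := by
  refine ⟨fun k θ hθ ↦ ⟨twistedD cov C η θ, twistedD_mem cov C hη hθ,
    dEta_pull_eq cov C hη (mem_allForms hθ)⟩, fun θ₁ hθ₁ θ₂ hθ₂ a b ↦ ?_,
    fun k θ₁ hθ₁ θ₂ hθ₂ ↦ ?_, fun k θ hθ ↦ ?_,
    ⟨maurerCartanForm cov C η, maurerCartanForm_mem cov C hη, maurerCartan_eq cov C hη⟩, ?_⟩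
  · have h₁ := Submodule.smul_mem _ a hθ₁
    have h₂ := Submodule.smul_mem _ b hθ₂
    rw [dEta_pull_eq cov C hη (add_mem h₁ h₂), dEta_pull_eq cov C hη hθ₁,
      dEta_pull_eq cov C hη hθ₂]
    funext x p
    exact (koszulOp_add cov _ _ h₁ h₂).trans
      (congrArg₂ (· + ·) (koszulOp_smul cov _ _ a hθ₁) (koszulOp_smul cov _ _ b hθ₂))
  · rw [dEta_pull_eq cov C hη (mul_mem_allForms hθ₁ hθ₂), dEta_pull_eq cov C hη (mem_allForms hθ₁),
      dEta_pull_eq cov C hη hθ₂]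
    funext x p
    exact koszulOp_mul cov _ _ hθ₁ hθ₂
  · rw [pull_dL cov C hθ]
    rfl
  · rw [maurerCartan_eq cov C hη,
      dEta_pull_eq cov C hη (mem_allForms (maurerCartanForm_mem cov C hη)),
      twistedD_maurerCartanForm cov C hL hη]
    rfl
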